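/- **System.** For $i\in\{L,C,R\}$ let $H^i(x,y)=\frac{b_i}{2}y^2-\frac{c_i}{2}x^2+a_ixy+\alpha_iy-\beta_ix$, $f_i(x,y)=p_ix+q_iy+r_i$ and $g_i(x,y)=s_ix+u_iy+v_i$ with real coefficients, and consider for $\varepsilon\ge 0$ the discontinuous planar piecewise linear near-Hamiltonian system $$\dot x=H^i_y(x,y)+\varepsilon f_i(x,y),\qquad \dot y=-H^i_x(x,y)+\varepsilon g_i(x,y),\tag{$*$}$$ where $i=L$ in the left zone $x<-1$, $i=C$ in the central zone $-1<x<1$, and $i=R$ in the right zone $x>1$. A point of $x=\pm1$ is a crossing point if the $\dot x$-components of the two adjacent fields have a positive product there, and a tangent point of an adjacent field if the $\dot x$-component of that field vanishes there. Solutions pass from one zone to the next at crossing points. A crossing periodic orbit is a non-constant periodic solution that meets the lines $x=\pm1$ only at crossing points; a limit cycle is a crossing periodic orbit that has a neighbourhood containing no other crossing periodic orbit. A singular point of the field used in a zone is real if it lies in that (open) zone and virtual otherwise. Assume of the unperturbed system ($\varepsilon=0$): - (H1) the central subsystem has a real center, and each of the two outer subsystems has a center or a saddle; - (H2) every point of the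 lines $x=\pm1$ is a crossing point or a tangent point of one of the adjacent fields; - (H3) there is a periodic annulus: a nonempty open interval $J$ such that for each $h\in J$ there is a crossing periodic orbit $L_h$ that goes from $(1,h)$ through the right zone to a lower point of $x=1$, then through the central zone to a point of $x=-1$, then through the left zone to a higher point of $x=-1$, then through the central zone back to $(1,h)$, and winds once clockwise around the origin. **Theorem 1.** At least three limit cycles can bifurcate from the periodic annulus under piecewise linear perturbations. Precisely: 1. For every unperturbed system satisfying (H1)–(H3) with annulus $(L_h)_{h\in J}$ there are three different $h_1,h_2,h_3\in J$ and, for each $\varepsilon$, piecewise linear $f_\varepsilon,g_\varepsilon$ as above with all coefficients in $[-1,1]$, such that for all sufficiently small $\varepsilon>0$ system $(*)$ with $f=f_\varepsilon$, $g=g_\varepsilon$ has three different limit cycles $\Gamma_1(\varepsilon),\Gamma_2(\varepsilon),\Gamma_3(\varepsilon)$ with $\Gamma_j(\varepsilon)\to L_{h_j}$ in the Hausdorff distance as $\varepsilon\to0^+$. 2. For each choice, separately for the left and for the right subsystem, of one of the kinds "real saddle", "real center", "virtual center", there is an unperturbed system satisfying (H1)–(H3) whose outer singular points are of the chosen kinds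 and for which the conclusion of 1 holds with some $f,g$ that do not depend on $\varepsilon$ (with real coefficients, no bound required). -/

import Mathlib

open Set Filter Topology

noncomputable section

namespace ThreeZone

/-! ### The data of the piecewise linear near-Hamiltonian system -/

/-- Coefficients of a quadratic Hamiltonian
`H(x,y) = (b/2) y² - (c/2) x² + a x y + α y - β x`. -/
structure HamCoeffs where
  a : ℝ
  b : ℝ
  c : ℝ
  α : ℝ
  β : ℝ

/-- The quadratic Hamiltonian. -/
def HamCoeffs.H (k : HamCoeffs) (z : ℝ × ℝ) : ℝ :=
  k.b / 2 * z.2 ^ 2 - k.c / 2 * z.1 ^ 2 + k.a * z.1 * z.2 + k.α * z.2 - k.β * z.1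

/-- The Hamiltonian vector field `(H_y, -H_x)`. -/
def HamCoeffs.field (k : HamCoeffs) (z : ℝ × ℝ) : ℝ × ℝ :=
  (k.a * z.1 + k.b * z.2 + k.α, k.c * z.1 - k.a * z.2 + k.β)

/-- The first component of the field is `H_y`. -/
theorem HamCoeffs.hasDerivAt_H_snd (k : HamCoeffs) (x y : ℝ) :
    HasDerivAt (fun w : ℝ => k.H (x, w)) (k.field (x, y)).1 y := by
  have h2 := ((hasDerivAt_id y).pow 2).const_mul (k.b / 2)
  have h1 := (hasDerivAt_id y).const_mul (k.a * x)
  have h0 := (hasDerivAt_id y).const_mul k.α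
  have h := (((h2.sub_const (k.c / 2 * x ^ 2)).add h1).add h0).sub_const (k.β * x)
  refine h.congr_deriv ?_
  simp only [HamCoeffs.field, id, Nat.cast_ofNat]
  ring

/-- The second component of the field is `-H_x`. -/
theorem HamCoeffs.hasDerivAt_H_fst (k : HamCoeffs) (x y : ℝ) :
    HasDerivAt (fun w : ℝ => k.H (w, y)) (-(k.field (x, y)).2) x := by
  have h2 := ((hasDerivAt_id x).pow 2).const_mul (k.c / 2)
  have h1 := ((hasDerivAt_id x).const_mul k.a).mul_const y
  have h0 := (hasDerivAt_id x).const_mul k.β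
  have h := (((h2.const_sub (k.b / 2 * y ^ 2)).add h1).add_const (k.α * y)).sub h0
  refine h.congr_deriv ?_
  simp only [HamCoeffs.field, id, Nat.cast_ofNat]
  ring

/-- Matrix of the linear part of the Hamiltonian vector field. -/
def HamCoeffs.linearPart (k : HamCoeffs) : Matrix (Fin 2) (Fin 2) ℝ :=
  !![k.a, k.b; k.c, -k.a]

/-- The singular point is a center.  The linear part has trace zero, so its eigenvalues are a
nonzero purely imaginary pair exactly when its determinant `-a² - b c` is positive. -/
def HamCoeffs.IsCenter (k : HamCoeffs) : Prop := 0 < k.linearPart.det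

/-- The singular point is a saddle: the eigenvalues are real, nonzero and of opposite sign. -/
def HamCoeffs.IsSaddle (k : HamCoeffs) : Prop := k.linearPart.det < 0

/-- Coefficients of a linear perturbation `f = p x + q y + r`, `g = s x + u y + v`. -/
structure PertCoeffs where
  p : ℝ
  q : ℝ
  r : ℝ
  s : ℝ
  u : ℝ
  v : ℝ

/-- The perturbation vector field `(f, g)`. -/
def PertCoeffs.field (m : PertCoeffs) (z : ℝ × ℝ) : ℝ × ℝ :=
  (m.p * z.1 + m.q * z.2 + m.r, m.s * z.1 + m.u * z.2 + m.v)

/-- All coefficients are bounded by `1` in absolute value. -/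
def PertCoeffs.Bounded (m : PertCoeffs) : Prop :=
  |m.p| ≤ 1 ∧ |m.q| ≤ 1 ∧ |m.r| ≤ 1 ∧ |m.s| ≤ 1 ∧ |m.u| ≤ 1 ∧ |m.v| ≤ 1

/-- An unperturbed piecewise Hamiltonian system: left, central and right Hamiltonians. -/
structure HamSystem where
  L : HamCoeffs
  C : HamCoeffs
  R : HamCoeffs

/-- A piecewise linear perturbation: left, central and right parts. -/
structure Perturbation where
  L : PertCoeffs
  C : PertCoeffs
  R : PertCoeffs

/-- All eighteen coefficients are bounded by `1` in absolute value. -/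
def Perturbation.Bounded (P : Perturbation) : Prop :=
  P.L.Bounded ∧ P.C.Bounded ∧ P.R.Bounded

/-- The left zone `x < -1`. -/
def zoneL : Set (ℝ × ℝ) := {z | z.1 < -1}

/-- The central zone `-1 < x < 1`. -/
def zoneC : Set (ℝ × ℝ) := {z | -1 < z.1 ∧ z.1 < 1}

/-- The right zone `x > 1`. -/
def zoneR : Set (ℝ × ℝ) := {z | 1 < z.1}

/-- A triple of vector fields of the plane, to be followed in the left, central and right zone. -/
structure PWField where
  L : ℝ × ℝ → ℝ × ℝ
  C : ℝ × ℝ → ℝ × ℝ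
  R : ℝ × ℝ → ℝ × ℝ

/-- The system with perturbation `P` and parameter `ε`:
`x' = H_y + ε f`, `y' = -H_x + ε g` in each of the three zones. -/
def HamSystem.perturbed (S : HamSystem) (P : Perturbation) (ε : ℝ) : PWField where
  L := fun z => S.L.field z + ε • P.L.field z
  C := fun z => S.C.field z + ε • P.C.field z
  R := fun z => S.R.field z + ε • P.R.field z

/-- The unperturbed system. -/
def HamSystem.unperturbed (S : HamSystem) : PWField where
  L := S.L.field
  C := S.C.field
  R := S.R.field

/-! ### Crossing solutions, periodic orbits and limit cycles -/

/-- Crossing set of the line `x = -1`: the horizontal components of the two adjacent fields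
(their derivatives in the normal direction) are nonzero and have the same sign. -/
def PWField.crossingL (Z : PWField) : Set (ℝ × ℝ) :=
  {z | z.1 = -1 ∧ 0 < (Z.L z).1 * (Z.C z).1}

/-- Crossing set of the line `x = 1`. -/
def PWField.crossingR (Z : PWField) : Set (ℝ × ℝ) :=
  {z | z.1 = 1 ∧ 0 < (Z.R z).1 * (Z.C z).1}

/-- A solution, defined for all times, that meets the switching lines only at crossing points.
In each open zone it solves the differential equation of that zone.  At a point of a switching
line it arrives with the field of the zone it leaves and departs with the field of the zone
it enters. -/
structure PWField.IsCrossingSolution (Z : PWField) (γ : ℝ → ℝ × ℝ) : Prop where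
  left : ∀ t, γ t ∈ zoneL → HasDerivAt γ (Z.L (γ t)) t
  center : ∀ t, γ t ∈ zoneC → HasDerivAt γ (Z.C (γ t)) t
  right : ∀ t, γ t ∈ zoneR → HasDerivAt γ (Z.R (γ t)) t
  crossL : ∀ t, (γ t).1 = -1 → γ t ∈ Z.crossingL
  crossR : ∀ t, (γ t).1 = 1 → γ t ∈ Z.crossingR
  left_to_center : ∀ t, (γ t).1 = -1 → 0 < (Z.C (γ t)).1 →
    HasDerivWithinAt γ (Z.L (γ t)) (Iic t) t ∧ HasDerivWithinAt γ (Z.C (γ t)) (Ici t) t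
  center_to_left : ∀ t, (γ t).1 = -1 → (Z.C (γ t)).1 < 0 →
    HasDerivWithinAt γ (Z.C (γ t)) (Iic t) t ∧ HasDerivWithinAt γ (Z.L (γ t)) (Ici t) t
  center_to_right : ∀ t, (γ t).1 = 1 → 0 < (Z.C (γ t)).1 →
    HasDerivWithinAt γ (Z.C (γ t)) (Iic t) t ∧ HasDerivWithinAt γ (Z.R (γ t)) (Ici t) t
  right_to_center : ∀ t, (γ t).1 = 1 → (Z.C (γ t)).1 < 0 →
    HasDerivWithinAt γ (Z.R (γ t)) (Iic t) t ∧ HasDerivWithinAt γ (Z.C (γ t)) (Ici t) t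

/-- `Γ` is (the trace of) a crossing periodic orbit; equilibria are excluded. -/
def PWField.IsPeriodicOrbit (Z : PWField) (Γ : Set (ℝ × ℝ)) : Prop :=
  ∃ (γ : ℝ → ℝ × ℝ) (T : ℝ), 0 < T ∧ Z.IsCrossingSolution γ ∧ Function.Periodic γ T ∧
    (∃ t, γ t ≠ γ 0) ∧ Γ = range γ

/-- A limit cycle: a periodic orbit that is isolated among the periodic orbits. -/
def PWField.IsLimitCycle (Z : PWField) (Γ : Set (ℝ × ℝ)) : Prop :=
  Z.IsPeriodicOrbit Γ ∧
    ∃ U : Set (ℝ × ℝ), IsOpen U ∧ Γ ⊆ U ∧ ∀ Γ', Z.IsPeriodicOrbit Γ' → Γ' ⊆ U → Γ' = Γ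

/-! ### The hypotheses -/

/-- (H1) The central subsystem has a real center, and each outer subsystem has a center or
a saddle (which may be real or virtual). -/
def HamSystem.H1 (S : HamSystem) : Prop :=
  (S.C.IsCenter ∧ ∃ z ∈ zoneC, S.C.field z = 0) ∧
    (S.L.IsCenter ∨ S.L.IsSaddle) ∧ (S.R.IsCenter ∨ S.R.IsSaddle)

/-- (H2) Every point of the switching lines is a crossing point or a tangent point of one of the
adjacent fields. -/
def HamSystem.H2 (S : HamSystem) : Prop :=
  (∀ z : ℝ × ℝ, z.1 = -1 →
    z ∈ S.unperturbed.crossingL ∨ (S.L.field z).1 = 0 ∨ (S.C.field z).1 = 0) ∧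
  (∀ z : ℝ × ℝ, z.1 = 1 →
    z ∈ S.unperturbed.crossingR ∨ (S.R.field z).1 = 0 ∨ (S.C.field z).1 = 0)

/-- `γ` is a crossing periodic orbit of period `T` starting at `A = (1, h)` which runs through the
right zone to a lower point of `x = 1`, then through the central zone to a point of `x = -1`,
then through the left zone to a higher point of `x = -1`, then through the central zone back
to `A`.  The lower central arc meets the `y`-axis only below the origin and the upper one only
above it, so that the orbit winds exactly once, clockwise, around the origin. -/
def PWField.IsAnnulusOrbit (Z : PWField) (γ : ℝ → ℝ × ℝ) (T h : ℝ) : Prop :=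
  Z.IsCrossingSolution γ ∧ Function.Periodic γ T ∧ γ 0 = (1, h) ∧
  ∃ t₁ t₂ t₃ : ℝ, 0 < t₁ ∧ t₁ < t₂ ∧ t₂ < t₃ ∧ t₃ < T ∧
    (γ t₁).1 = 1 ∧ (γ t₂).1 = -1 ∧ (γ t₃).1 = -1 ∧
    (γ t₁).2 < h ∧ (γ t₂).2 < (γ t₃).2 ∧
    (∀ t ∈ Ioo 0 t₁, γ t ∈ zoneR) ∧
    (∀ t ∈ Ioo t₁ t₂, γ t ∈ zoneC ∧ ((γ t).1 = 0 → (γ t).2 < 0)) ∧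
    (∀ t ∈ Ioo t₂ t₃, γ t ∈ zoneL) ∧
    (∀ t ∈ Ioo t₃ T, γ t ∈ zoneC ∧ ((γ t).1 = 0 → 0 < (γ t).2))

/-- (H3) There is a periodic annulus, parametrized by the ordinate `h`, in a nonempty open
interval `J`, of the point `(1, h)` at which the orbit enters the right zone. -/
def HamSystem.H3 (S : HamSystem) (J : Set ℝ) : Prop :=
  IsOpen J ∧ J.OrdConnected ∧ J.Nonempty ∧
    ∀ h ∈ J, ∃ (γ : ℝ → ℝ × ℝ) (T : ℝ), S.unperturbed.IsAnnulusOrbit γ T h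

/-! ### Bifurcation of limit cycles, configurations -/

/-- `n` limit cycles of the system perturbed by `ε P(ε)` bifurcate from the periodic annulus
given by `J`: there are `n` different orbits of the annulus and, for all sufficiently small
`ε > 0`, `n` different limit cycles of the perturbed system, the `i`-th of which tends to the
`i`-th orbit, in the Hausdorff distance, as `ε` tends to `0`. -/
def HamSystem.LimitCyclesBifurcate (S : HamSystem) (J : Set ℝ) (P : ℝ → Perturbation)
    (n : ℕ) : Prop :=
  ∃ (h : Fin n → ℝ) (γ : Fin n → ℝ → ℝ × ℝ) (T : Fin n → ℝ) (Γ : Fin n → ℝ → Set (ℝ × ℝ)),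
    Function.Injective h ∧
    (∀ i, h i ∈ J ∧ S.unperturbed.IsAnnulusOrbit (γ i) (T i) (h i)) ∧
    (∀ᶠ ε in 𝓝[>] (0 : ℝ),
      Function.Injective (fun i => Γ i ε) ∧
      ∀ i, (S.perturbed (P ε) ε).IsLimitCycle (Γ i ε)) ∧
    ∀ i, Tendsto (fun ε => Metric.hausdorffEDist (Γ i ε) (range (γ i))) (𝓝[>] 0) (𝓝 0)

/-- The possible singular points of an outer subsystem. -/
inductive OuterKind where
  | realSaddle
  | realCenter
  | virtualCenter

/-- The subsystem `k`, followed in the zone `W`, has a singular point of the given kind: real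
if it lies in `W`, virtual otherwise. -/
def HamCoeffs.HasKind (k : HamCoeffs) (W : Set (ℝ × ℝ)) : OuterKind → Prop
  | .realSaddle => k.IsSaddle ∧ ∃ z ∈ W, k.field z = 0
  | .realCenter => k.IsCenter ∧ ∃ z ∈ W, k.field z = 0
  | .virtualCenter => k.IsCenter ∧ ∃ z ∉ W, k.field z = 0

end ThreeZone

end

/-!
A periodic annulus forces a normal form: `b > 0` in all three zones and, since by (H2) the product
of the two horizontal velocities along a switching line is nowhere negative, the two adjacent fields
have their tangent point on that line in common (`HamSystem.exists_normalForm`). In every zone the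
abscissa satisfies `x'' = -D x + c + κ b x'`, with `κ = 0` for the unperturbed system, so that the
conservation law of `x'' = -D x + c`, disturbed by `κ b` times the area `∫ x'²` under the arc,
determines the ordinates at the ends of an arc.

The perturbations shift the tangent points of the two outer fields, add dissipation in the right and
in the central zone, and a constant force in the central zone (`HamSystem.deform`). Let `u` and `w`
be the distances of the points of the orbit on `x = 1` and on `x = -1` from the tangent points, in
the unperturbed system; then `w² = u² - K`, where `K` is a positive multiple of the abscissa `ξ` of
the central singular point. Summing the energy balances over one turn gives the displacement of the
return map. Its leading coefficient is a combination, with arbitrary coefficients, of the four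
functions `u`, `w`, `(u² + k) T` and `(u² + m) T'` of `u`, up to terms in `u` and `w`, where `T` and
`T'` are the times spent in the right and in the central zone
(`HamSystem.IsReturn.sign_displacement_linear`). If `ξ = 0`, then `w = u` and one function is lost;
but then the two shifts can be chosen so that their effects cancel to first order, and to second
order they contribute, through the constant force, the function `1 / u`
(`HamSystem.IsReturn.sign_displacement_quadratic`). The times have algebraic derivatives, and this
makes the four functions linearly independent on every interval (`independent_of_ne_zero`,
`independent_of_eq_zero`); if `ξ = 0` and `k = m` this needs, besides, a comparison of the two times
(`HamSystem.IsReturn.time_ratio`). Hence some combination has three sign changes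
(`exists_three_sign_changes`), and by the intermediate value theorem the return map has a fixed
point near each of the three zeros, for all small `ε > 0`.

These fixed points give limit cycles (`isLimitCycle_of_isolated_fixedPoint`). The flow of an affine
field is analytic in all its arguments, so the return map is analytic, and its fixed points are
isolated as it is not the identity. A crossing periodic orbit that stays close to the given one must
cross the section on `x = 1`; the compact set of the ordinates of its crossings is mapped into
itself by the increasing return map, which forces it to contain the fixed point; and crossing
solutions are determined by a point, forwards in time (`forward_unique`).

The second part needs examples: with `x' = y` in all zones and the central center at `(1/2, 0)`, so
that `ξ ≠ 0` and the perturbation may be chosen independent of `ε`, the arcs in the outer zones can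
be written down explicitly for each kind of singular point (`exists_outer_arc`).
-/

open scoped ContDiff

noncomputable section

namespace ThreeZone

/-! ### Zones, entering and leaving a zone -/

section

/-- The three zones of the plane. -/
inductive Zone where
  | L
  | C
  | R

/-- A function of the abscissa that is positive exactly in the (open) zone and vanishes exactly
on the switching lines bounding it. -/
def Zone.gap : Zone → ℝ → ℝ
  | .L, x => -1 - x
  | .C, x => 1 - x ^ 2
  | .R, x => x - 1

/-- The derivative of `Zone.gap`. -/
def Zone.dgap : Zone → ℝ → ℝ
  | .L, _ => -1
  | .C, x => -2 * x
  | .R, _ => 1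

theorem Zone.hasDerivAt_gap (i : Zone) (x : ℝ) : HasDerivAt i.gap (i.dgap x) x := by
  cases i
  · exact ((hasDerivAt_id x).const_sub (-1)).congr_deriv rfl
  · exact (((hasDerivAt_id x).pow 2).const_sub 1).congr_deriv (by simp [Zone.dgap])
  · exact (hasDerivAt_id x).sub_const 1

theorem Zone.continuous_gap (i : Zone) : Continuous i.gap :=
  continuous_iff_continuousAt.2 fun x => (i.hasDerivAt_gap x).continuousAt

theorem Zone.continuous_dgap (i : Zone) : Continuous i.dgap := by
  cases i
  · exact continuous_const
  · exact continuous_const.mul continuous_id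
  · exact continuous_const

theorem Zone.gap_pos_L {x : ℝ} : 0 < Zone.L.gap x ↔ x < -1 := by
  simp only [Zone.gap]; constructor <;> intro h <;> linarith

theorem Zone.gap_pos_R {x : ℝ} : 0 < Zone.R.gap x ↔ 1 < x := by
  simp only [Zone.gap]; constructor <;> intro h <;> linarith

theorem Zone.gap_pos_C {x : ℝ} : 0 < Zone.C.gap x ↔ -1 < x ∧ x < 1 := by
  simp only [Zone.gap]
  constructor
  · intro h; constructor <;> nlinarith
  · rintro ⟨h1, h2⟩; nlinarith

/-- The field followed in a zone. -/
def PWField.fld (Z : PWField) : Zone → ℝ × ℝ → ℝ × ℝ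
  | .L => Z.L
  | .C => Z.C
  | .R => Z.R

/-- The point is not on a switching line, or it is a crossing point. -/
def PWField.Crossing (Z : PWField) (z : ℝ × ℝ) : Prop :=
  (z.1 = 1 → 0 < (Z.R z).1 * (Z.C z).1) ∧ (z.1 = -1 → 0 < (Z.L z).1 * (Z.C z).1)

/-- A crossing solution at the point `z` is in the zone `i` at all later near times. -/
def PWField.Enters (Z : PWField) (i : Zone) (z : ℝ × ℝ) : Prop :=
  Z.Crossing z ∧ (0 < i.gap z.1 ∨ i.gap z.1 = 0 ∧ 0 < i.dgap z.1 * (Z.fld i z).1)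

/-- A crossing solution at the point `z` was in the zone `i` at all earlier near times. -/
def PWField.Leaves (Z : PWField) (i : Zone) (z : ℝ × ℝ) : Prop :=
  Z.Crossing z ∧ (0 < i.gap z.1 ∨ i.gap z.1 = 0 ∧ i.dgap z.1 * (Z.fld i z).1 < 0)

variable {Z : PWField}

theorem crossing_of_gap_pos {i : Zone} {z : ℝ × ℝ} (h : 0 < i.gap z.1) : Z.Crossing z := by
  cases i
  · rw [Zone.gap_pos_L] at h; constructor <;> intro h' <;> linarith
  · rw [Zone.gap_pos_C] at h; constructor <;> intro h' <;> linarith [h.1, h.2]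
  · rw [Zone.gap_pos_R] at h; constructor <;> intro h' <;> linarith

theorem enters_of_gap_pos {i : Zone} {z : ℝ × ℝ} (h : 0 < i.gap z.1) : Z.Enters i z :=
  ⟨crossing_of_gap_pos h, Or.inl h⟩

theorem leaves_of_gap_pos {i : Zone} {z : ℝ × ℝ} (h : 0 < i.gap z.1) : Z.Leaves i z :=
  ⟨crossing_of_gap_pos h, Or.inl h⟩

theorem Zone.line_of_gap_L {x : ℝ} (h : Zone.L.gap x = 0) : x = -1 := by
  simp only [Zone.gap] at h; linarith

theorem Zone.line_of_gap_R {x : ℝ} (h : Zone.R.gap x = 0) : x = 1 := by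
  simp only [Zone.gap] at h; linarith

theorem Zone.line_of_gap_C {x : ℝ} (h : Zone.C.gap x = 0) : x = 1 ∨ x = -1 := by
  simp only [Zone.gap] at h
  have h' : (x - 1) * (x + 1) = 0 := by linarith
  rcases mul_eq_zero.1 h' with h | h
  · left; linarith
  · right; linarith

theorem PWField.Enters.unique {i j : Zone} {z : ℝ × ℝ} (hi : Z.Enters i z) (hj : Z.Enters j z) :
    i = j := by
  obtain ⟨⟨hR, hL⟩, hi⟩ := hi
  obtain ⟨-, hj⟩ := hj
  by_cases h1 : z.1 = 1
  · have hR := hR h1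
    cases i <;> cases j <;> first | rfl | skip
    all_goals
      simp only [Zone.gap, Zone.dgap, PWField.fld, h1] at hi hj
      rcases hi with hi | ⟨hi', hi⟩ <;> rcases hj with hj | ⟨hj', hj⟩ <;>
        first | linarith | nlinarith
  by_cases h2 : z.1 = -1
  · have hL := hL h2
    cases i <;> cases j <;> first | rfl | skip
    all_goals
      simp only [Zone.gap, Zone.dgap, PWField.fld, h2] at hi hj
      rcases hi with hi | ⟨hi', hi⟩ <;> rcases hj with hj | ⟨hj', hj⟩ <;>
        first | linarith | nlinarith
  have key : ∀ k : Zone, k.gap z.1 ≠ 0 := by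
    intro k hk
    cases k
    · exact h2 (Zone.line_of_gap_L hk)
    · exact (Zone.line_of_gap_C hk).elim h1 h2
    · exact h1 (Zone.line_of_gap_R hk)
  replace hi : 0 < i.gap z.1 := hi.resolve_right fun h => key i h.1
  replace hj : 0 < j.gap z.1 := hj.resolve_right fun h => key j h.1
  cases i <;> cases j <;> first | rfl | skip
  all_goals
    simp only [Zone.gap_pos_L, Zone.gap_pos_R, Zone.gap_pos_C] at hi hj
    exfalso
    linarith

theorem PWField.Leaves.unique {i j : Zone} {z : ℝ × ℝ} (hi : Z.Leaves i z) (hj : Z.Leaves j z) :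
    i = j := by
  obtain ⟨⟨hR, hL⟩, hi⟩ := hi
  obtain ⟨-, hj⟩ := hj
  by_cases h1 : z.1 = 1
  · have hR := hR h1
    cases i <;> cases j <;> first | rfl | skip
    all_goals
      simp only [Zone.gap, Zone.dgap, PWField.fld, h1] at hi hj
      rcases hi with hi | ⟨hi', hi⟩ <;> rcases hj with hj | ⟨hj', hj⟩ <;>
        first | linarith | nlinarith
  by_cases h2 : z.1 = -1
  · have hL := hL h2
    cases i <;> cases j <;> first | rfl | skip
    all_goals
      simp only [Zone.gap, Zone.dgap, PWField.fld, h2] at hi hj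
      rcases hi with hi | ⟨hi', hi⟩ <;> rcases hj with hj | ⟨hj', hj⟩ <;>
        first | linarith | nlinarith
  have key : ∀ k : Zone, k.gap z.1 ≠ 0 := by
    intro k hk
    cases k
    · exact h2 (Zone.line_of_gap_L hk)
    · exact (Zone.line_of_gap_C hk).elim h1 h2
    · exact h1 (Zone.line_of_gap_R hk)
  replace hi : 0 < i.gap z.1 := hi.resolve_right fun h => key i h.1
  replace hj : 0 < j.gap z.1 := hj.resolve_right fun h => key j h.1
  cases i <;> cases j <;> first | rfl | skip
  all_goals
    simp only [Zone.gap_pos_L, Zone.gap_pos_R, Zone.gap_pos_C] at hi hj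
    exfalso
    linarith

/-! ### One-sided derivatives -/

theorem eventually_pos_right {f : ℝ → ℝ} {f' t : ℝ} (h : HasDerivWithinAt f f' (Ici t) t)
    (h0 : 0 < f t ∨ f t = 0 ∧ 0 < f') : ∀ᶠ s in 𝓝[>] t, 0 < f s := by
  rcases h0 with h0 | ⟨h0, h1⟩
  · exact (h.continuousWithinAt.eventually (lt_mem_nhds h0)).filter_mono
      (nhdsWithin_mono t Ioi_subset_Ici_self)
  · have h2 := (hasDerivWithinAt_iff_tendsto_slope' (lt_irrefl t)).1 (h.mono Ioi_subset_Ici_self)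
    filter_upwards [h2.eventually (lt_mem_nhds h1), self_mem_nhdsWithin] with s hs hts
    rw [slope_def_field, h0, sub_zero] at hs
    exact (div_pos_iff_of_pos_right (sub_pos.2 hts)).1 hs

theorem eventually_pos_left {f : ℝ → ℝ} {f' t : ℝ} (h : HasDerivWithinAt f f' (Iic t) t)
    (h0 : 0 < f t ∨ f t = 0 ∧ f' < 0) : ∀ᶠ s in 𝓝[<] t, 0 < f s := by
  rcases h0 with h0 | ⟨h0, h1⟩
  · exact (h.continuousWithinAt.eventually (lt_mem_nhds h0)).filter_mono
      (nhdsWithin_mono t Iio_subset_Iic_self)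
  · have h2 := (hasDerivWithinAt_iff_tendsto_slope' (s := Iio t) (lt_irrefl t)).1
      (h.mono Iio_subset_Iic_self)
    filter_upwards [h2.eventually (gt_mem_nhds h1), self_mem_nhdsWithin] with s hs hts
    rw [slope_def_field, h0, sub_zero] at hs
    have hts' : s - t < 0 := sub_neg.2 hts
    by_contra hneg
    exact absurd (div_nonneg_of_nonpos (not_lt.1 hneg) hts'.le) (not_le.2 hs)

theorem hasDerivWithinAt_gap {φ : ℝ → ℝ × ℝ} {v : ℝ × ℝ} {s : Set ℝ} {t : ℝ} (i : Zone)
    (h : HasDerivWithinAt φ v s t) :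
    HasDerivWithinAt (fun r => i.gap (φ r).1) (i.dgap (φ t).1 * v.1) s t :=
  have h1 : HasDerivWithinAt (fun r => (φ r).1) v.1 s t := h.fst
  HasDerivAt.comp_hasDerivWithinAt (h₂ := i.gap) (h := fun r => (φ r).1) t
    (i.hasDerivAt_gap _) h1

theorem PWField.Enters.eventually_right {i : Zone} {φ : ℝ → ℝ × ℝ} {t : ℝ} (h : Z.Enters i (φ t))
    (hd : HasDerivWithinAt φ (Z.fld i (φ t)) (Ici t) t) :
    ∀ᶠ s in 𝓝[>] t, 0 < i.gap (φ s).1 :=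
  eventually_pos_right (hasDerivWithinAt_gap i hd) h.2

theorem PWField.Leaves.eventually_left {i : Zone} {φ : ℝ → ℝ × ℝ} {t : ℝ} (h : Z.Leaves i (φ t))
    (hd : HasDerivWithinAt φ (Z.fld i (φ t)) (Iic t) t) :
    ∀ᶠ s in 𝓝[<] t, 0 < i.gap (φ s).1 :=
  eventually_pos_left (hasDerivWithinAt_gap i hd) h.2

theorem HasDerivWithinAt.shift_Ici {f : ℝ → ℝ × ℝ} {f' : ℝ × ℝ} {a t : ℝ}
    (h : HasDerivWithinAt f f' (Ici (a + t)) (a + t)) :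
    HasDerivWithinAt (fun s => f (a + s)) f' (Ici t) t := by
  have := HasDerivWithinAt.scomp t h ((hasDerivWithinAt_id t (Ici t)).const_add a)
    (fun s hs => by simpa using hs)
  simpa [Function.comp_def] using this

theorem HasDerivWithinAt.shift_Iic {f : ℝ → ℝ × ℝ} {f' : ℝ × ℝ} {a t : ℝ}
    (h : HasDerivWithinAt f f' (Iic (a + t)) (a + t)) :
    HasDerivWithinAt (fun s => f (a + s)) f' (Iic t) t := by
  have := HasDerivWithinAt.scomp t h ((hasDerivWithinAt_id t (Iic t)).const_add a)
    (fun s hs => by simpa using hs)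
  simpa [Function.comp_def] using this

/-! ### Paths following the fields -/

/-- At the time `t` the path departs with the field of the zone it enters. -/
def PWField.DepartsAt (Z : PWField) (φ : ℝ → ℝ × ℝ) (t : ℝ) : Prop :=
  ∃ i, Z.Enters i (φ t) ∧ HasDerivWithinAt φ (Z.fld i (φ t)) (Ici t) t

/-- At the time `t` the path arrives with the field of the zone it leaves. -/
def PWField.ArrivesAt (Z : PWField) (φ : ℝ → ℝ × ℝ) (t : ℝ) : Prop :=
  ∃ i, Z.Leaves i (φ t) ∧ HasDerivWithinAt φ (Z.fld i (φ t)) (Iic t) t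

/-- On the time interval `[0, b]` the path is a crossing solution. -/
structure PWField.PathOn (Z : PWField) (φ : ℝ → ℝ × ℝ) (b : ℝ) : Prop where
  departs : ∀ t ∈ Ico 0 b, Z.DepartsAt φ t
  arrives : ∀ t ∈ Ioc 0 b, Z.ArrivesAt φ t

theorem PWField.DepartsAt.shift {φ : ℝ → ℝ × ℝ} {a t : ℝ} (h : Z.DepartsAt φ (a + t)) :
    Z.DepartsAt (fun s => φ (a + s)) t :=
  let ⟨i, hi, hd⟩ := h
  ⟨i, hi, HasDerivWithinAt.shift_Ici hd⟩

theorem PWField.ArrivesAt.shift {φ : ℝ → ℝ × ℝ} {a t : ℝ} (h : Z.ArrivesAt φ (a + t)) :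
    Z.ArrivesAt (fun s => φ (a + s)) t :=
  let ⟨i, hi, hd⟩ := h
  ⟨i, hi, HasDerivWithinAt.shift_Iic hd⟩

theorem PWField.DepartsAt.congr {φ ψ : ℝ → ℝ × ℝ} {t : ℝ} (h : Z.DepartsAt φ t)
    (he : ψ =ᶠ[𝓝[≥] t] φ) : Z.DepartsAt ψ t := by
  obtain ⟨i, hi, hd⟩ := h
  have h0 : ψ t = φ t := he.self_of_nhdsWithin self_mem_Ici
  exact ⟨i, h0 ▸ hi, h0 ▸ hd.congr_of_eventuallyEq he h0⟩

theorem PWField.ArrivesAt.congr {φ ψ : ℝ → ℝ × ℝ} {t : ℝ} (h : Z.ArrivesAt φ t)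
    (he : ψ =ᶠ[𝓝[≤] t] φ) : Z.ArrivesAt ψ t := by
  obtain ⟨i, hi, hd⟩ := h
  have h0 : ψ t = φ t := he.self_of_nhdsWithin self_mem_Iic
  exact ⟨i, h0 ▸ hi, h0 ▸ hd.congr_of_eventuallyEq he h0⟩

theorem continuousAt_of_departs_arrives {φ : ℝ → ℝ × ℝ} {t : ℝ} (h : Z.DepartsAt φ t)
    (h' : Z.ArrivesAt φ t) : ContinuousAt φ t := by
  obtain ⟨i, -, hd⟩ := h
  obtain ⟨j, -, hd'⟩ := h'
  exact continuousAt_iff_continuous_left_right.2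
    ⟨hd'.continuousWithinAt, hd.continuousWithinAt⟩

theorem PWField.PathOn.continuousOn {φ : ℝ → ℝ × ℝ} {b : ℝ} (h : Z.PathOn φ b) :
    ContinuousOn φ (Icc 0 b) := by
  intro t ht
  rcases eq_or_lt_of_le ht.1 with h0 | h0
  · rcases eq_or_lt_of_le ht.2 with hb | hb
    · have : Icc (0 : ℝ) b = {t} := by rw [← h0, ← hb, ← h0, Icc_self]
      rw [this]; exact continuousWithinAt_singleton
    · obtain ⟨i, -, hd⟩ := h.departs t ⟨ht.1, hb⟩
      exact hd.continuousWithinAt.mono fun s hs => h0 ▸ hs.1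
  · rcases eq_or_lt_of_le ht.2 with hb | hb
    · obtain ⟨i, -, hd⟩ := h.arrives t ⟨h0, ht.2⟩
      exact hd.continuousWithinAt.mono fun s hs => hb ▸ hs.2
    · exact (continuousAt_of_departs_arrives (h.departs t ⟨ht.1, hb⟩)
        (h.arrives t ⟨h0, ht.2⟩)).continuousWithinAt

/-- Every zone field is Lipschitz. -/
def PWField.Lipschitz (Z : PWField) : Prop := ∀ i, ∃ K, LipschitzWith K (Z.fld i)

/-- Crossing solutions are determined forwards in time by their initial point. -/
theorem forward_unique (hZ : Z.Lipschitz) {φ ψ : ℝ → ℝ × ℝ} {b : ℝ}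
    (hφ : ContinuousOn φ (Icc 0 b)) (hψ : ContinuousOn ψ (Icc 0 b))
    (hφ' : ∀ t ∈ Ico 0 b, Z.DepartsAt φ t) (hψ' : ∀ t ∈ Ico 0 b, Z.DepartsAt ψ t)
    (h0 : φ 0 = ψ 0) : EqOn φ ψ (Icc 0 b) := by
  rcases lt_or_ge b 0 with hb | hb
  · simp [Icc_eq_empty (not_le.2 hb)]
  set A : Set ℝ := {t | EqOn φ ψ (Icc 0 t)} with hA
  have hle : ∀ {t}, t ∈ A → ∀ {s}, s ≤ t → s ∈ A := fun ht s hs r hr =>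
    ht ⟨hr.1, hr.2.trans hs⟩
  have hclosed : IsClosed (A ∩ Icc 0 b) := by
    have hE : IsClosed {t ∈ Icc 0 b | φ t = ψ t} := by
      have := (hφ.prodMk hψ).preimage_isClosed_of_isClosed isClosed_Icc isClosed_diagonal
      convert this using 1
      ext t
      simp [mem_diagonal_iff]
    refine isClosed_of_closure_subset fun t ht => ?_
    have htI : t ∈ Icc 0 b :=
      isClosed_Icc.closure_subset (closure_mono inter_subset_right ht)
    refine ⟨fun r hr => ?_, htI⟩
    rcases eq_or_lt_of_le hr.2 with rfl | hrt
    · refine (hE.closure_subset (closure_mono (fun s hs => ?_) ht)).2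
      exact ⟨hs.2, hs.1 ⟨hs.2.1, le_rfl⟩⟩
    · obtain ⟨s, hs, hsA⟩ := mem_closure_iff.1 ht (Ioi r) isOpen_Ioi hrt
      exact hsA.1 ⟨hr.1, le_of_lt hs⟩
  have h0A : (0 : ℝ) ∈ A := fun r hr => by
    rw [Icc_self, mem_singleton_iff] at hr; rw [hr, h0]
  refine hclosed.Icc_subset_of_forall_mem_nhdsWithin h0A (fun t ht => ?_) ⟨hb, le_rfl⟩
  obtain ⟨htA, ht⟩ := ht
  have hpt : φ t = ψ t := htA ⟨ht.1, le_rfl⟩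
  obtain ⟨i, hi, hdi⟩ := hφ' t ht
  obtain ⟨j, hj, hdj⟩ := hψ' t ht
  obtain rfl : i = j := hi.unique (hpt ▸ hj)
  have hev : ∀ᶠ s in 𝓝[>] t, 0 < i.gap (φ s).1 ∧ 0 < i.gap (ψ s).1 ∧ s < b :=
    (hi.eventually_right hdi).and ((hj.eventually_right hdj).and
      (nhdsWithin_le_nhds (Iio_mem_nhds ht.2)))
  obtain ⟨c, hc, hev⟩ := (mem_nhdsGT_iff_exists_Ioo_subset.1 hev)
  obtain ⟨K, hK⟩ := hZ i
  refine mem_nhdsGT_iff_exists_Ioo_subset.2 ⟨c, hc, fun r hr => ?_⟩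
  have hrb : r < b := (hev hr).2.2
  have hstep : ∀ {χ : ℝ → ℝ × ℝ}, (∀ t ∈ Ico 0 b, Z.DepartsAt χ t) → Z.Enters i (χ t) →
      (∀ s ∈ Ioo t c, 0 < i.gap (χ s).1) →
      ∀ s ∈ Ico t r, HasDerivWithinAt χ (Z.fld i (χ s)) (Ici s) s := by
    intro χ hχ hχt hχg s hs
    obtain ⟨k, hk, hdk⟩ := hχ s ⟨ht.1.trans hs.1, hs.2.trans hrb⟩
    have : Z.Enters i (χ s) := by
      rcases eq_or_lt_of_le hs.1 with rfl | h
      · exact hχt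
      · exact enters_of_gap_pos (hχg s ⟨h, hs.2.trans hr.2⟩)
    rwa [hk.unique this] at hdk
  have hsub : Icc t r ⊆ Icc 0 b := Icc_subset_Icc ht.1 hrb.le
  have huniq := ODE_solution_unique (v := fun _ => Z.fld i) (fun _ => hK) (hφ.mono hsub)
    (hstep hφ' hi fun s hs => (hev hs).1) (hψ.mono hsub)
    (hstep hψ' hj fun s hs => (hev hs).2.1) hpt
  intro s hs
  rcases le_total s t with h | h
  · exact htA ⟨hs.1, h⟩
  · exact huniq ⟨h, hs.2⟩

/-- Concatenation of paths. -/
def concat (φ ψ : ℝ → ℝ × ℝ) (b : ℝ) (t : ℝ) : ℝ × ℝ := if t ≤ b then φ t else ψ (t - b)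

theorem concat_of_le {φ ψ : ℝ → ℝ × ℝ} {b t : ℝ} (h : t ≤ b) : concat φ ψ b t = φ t := if_pos h

theorem concat_of_ge {φ ψ : ℝ → ℝ × ℝ} {b t : ℝ} (h0 : φ b = ψ 0) (h : b ≤ t) :
    concat φ ψ b t = ψ (t - b) := by
  rcases eq_or_lt_of_le h with rfl | h
  · rw [concat_of_le le_rfl, sub_self, h0]
  · exact if_neg (not_le.2 h)

theorem PWField.PathOn.concat {φ ψ : ℝ → ℝ × ℝ} {b c : ℝ} (hφ : Z.PathOn φ b) (hψ : Z.PathOn ψ c)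
    (h0 : φ b = ψ 0) : Z.PathOn (concat φ ψ b) (b + c) := by
  constructor
  · intro t ht
    rcases lt_or_ge t b with h | h
    · refine (hφ.departs t ⟨ht.1, h⟩).congr ?_
      filter_upwards [nhdsWithin_le_nhds (Iio_mem_nhds h)] with s hs
      exact concat_of_le (le_of_lt hs)
    · have h1 : Z.DepartsAt ψ (-b + t) :=
        hψ.departs _ ⟨by linarith, by linarith [ht.2]⟩
      refine h1.shift.congr ?_
      filter_upwards [self_mem_nhdsWithin] with s hs'
      rw [concat_of_ge h0 (h.trans hs'), neg_add_eq_sub]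
  · intro t ht
    rcases le_or_gt t b with h | h
    · refine (hφ.arrives t ⟨ht.1, h⟩).congr ?_
      filter_upwards [self_mem_nhdsWithin] with s hs
      exact concat_of_le (le_trans hs h)
    · have h1 : Z.ArrivesAt ψ (-b + t) :=
        hψ.arrives _ ⟨by linarith, by linarith [ht.2]⟩
      refine h1.shift.congr ?_
      filter_upwards [nhdsWithin_le_nhds (Ioi_mem_nhds h)] with s hs'
      rw [concat_of_ge h0 (le_of_lt hs'), neg_add_eq_sub]

theorem concat_image {φ ψ : ℝ → ℝ × ℝ} {b c : ℝ} (hb : 0 ≤ b) (hc : 0 ≤ c) (h0 : φ b = ψ 0) :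
    concat φ ψ b '' Icc 0 (b + c) = φ '' Icc 0 b ∪ ψ '' Icc 0 c := by
  ext z
  constructor
  · rintro ⟨t, ht, rfl⟩
    rcases le_total t b with h | h
    · exact Or.inl ⟨t, ⟨ht.1, h⟩, (concat_of_le h).symm⟩
    · exact Or.inr ⟨t - b, ⟨by linarith, by linarith [ht.2]⟩, (concat_of_ge h0 h).symm⟩
  · rintro (⟨t, ht, rfl⟩ | ⟨t, ht, rfl⟩)
    · exact ⟨t, ⟨ht.1, by linarith [ht.2]⟩, concat_of_le ht.2⟩
    · refine ⟨t + b, ⟨by linarith [ht.1], by linarith [ht.2]⟩, ?_⟩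
      rw [concat_of_ge h0 (by linarith [ht.1]), add_sub_cancel_right]

/-! ### Crossing solutions -/

theorem isCrossingSolution_of_departs_arrives {γ : ℝ → ℝ × ℝ} (hd : ∀ t, Z.DepartsAt γ t)
    (ha : ∀ t, Z.ArrivesAt γ t) : Z.IsCrossingSolution γ := by
  have hcr : ∀ t, Z.Crossing (γ t) := fun t => let ⟨i, hi, _⟩ := hd t; hi.1
  have hin : ∀ (i : Zone) t, 0 < i.gap (γ t).1 → HasDerivAt γ (Z.fld i (γ t)) t := by
    intro i t h
    obtain ⟨j, hj, hjd⟩ := hd t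
    obtain rfl := hj.unique (enters_of_gap_pos h)
    obtain ⟨k, hk, hkd⟩ := ha t
    have hjk : k = j := by
      have h1 := hk.eventually_left hkd
      have h2 : ∀ᶠ s in 𝓝[<] t, 0 < j.gap (γ s).1 := by
        have hc := continuousAt_of_departs_arrives (hd t) (ha t)
        exact nhdsWithin_le_nhds ((j.continuous_gap.continuousAt.comp
          (continuous_fst.continuousAt.comp hc)).eventually (lt_mem_nhds h))
      obtain ⟨s, hs1, hs2⟩ := (h1.and h2).exists
      exact (enters_of_gap_pos (Z := Z) hs1).unique (enters_of_gap_pos hs2)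
    subst hjk
    have := hkd.union hjd
    rwa [Iic_union_Ici, hasDerivWithinAt_univ] at this
  have hright : ∀ (i : Zone) t, Z.Enters i (γ t) → HasDerivWithinAt γ (Z.fld i (γ t)) (Ici t) t :=
    fun i t hi => let ⟨j, hj, hjd⟩ := hd t; hj.unique hi ▸ hjd
  have hleft : ∀ (i : Zone) t, Z.Leaves i (γ t) → HasDerivWithinAt γ (Z.fld i (γ t)) (Iic t) t :=
    fun i t hi => let ⟨j, hj, hjd⟩ := ha t; hj.unique hi ▸ hjd
  constructor
  · exact fun t ht => hin .L t (Zone.gap_pos_L.2 ht)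
  · exact fun t ht => hin .C t (Zone.gap_pos_C.2 ht)
  · exact fun t ht => hin .R t (Zone.gap_pos_R.2 ht)
  · exact fun t ht => ⟨ht, (hcr t).2 ht⟩
  · exact fun t ht => ⟨ht, (hcr t).1 ht⟩
  · intro t ht hpos
    have h12 := (hcr t).2 ht
    refine ⟨hleft .L t ⟨hcr t, Or.inr ⟨?_, ?_⟩⟩, hright .C t ⟨hcr t, Or.inr ⟨?_, ?_⟩⟩⟩ <;>
      simp only [Zone.gap, Zone.dgap, PWField.fld, ht] <;> nlinarith
  · intro t ht hpos
    have h12 := (hcr t).2 ht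
    refine ⟨hleft .C t ⟨hcr t, Or.inr ⟨?_, ?_⟩⟩, hright .L t ⟨hcr t, Or.inr ⟨?_, ?_⟩⟩⟩ <;>
      simp only [Zone.gap, Zone.dgap, PWField.fld, ht] <;> nlinarith
  · intro t ht hpos
    have h12 := (hcr t).1 ht
    refine ⟨hleft .C t ⟨hcr t, Or.inr ⟨?_, ?_⟩⟩, hright .R t ⟨hcr t, Or.inr ⟨?_, ?_⟩⟩⟩ <;>
      simp only [Zone.gap, Zone.dgap, PWField.fld, ht] <;> nlinarith
  · intro t ht hpos
    have h12 := (hcr t).1 ht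
    refine ⟨hleft .R t ⟨hcr t, Or.inr ⟨?_, ?_⟩⟩, hright .C t ⟨hcr t, Or.inr ⟨?_, ?_⟩⟩⟩ <;>
      simp only [Zone.gap, Zone.dgap, PWField.fld, ht] <;> nlinarith

theorem PWField.IsCrossingSolution.departs_arrives {γ : ℝ → ℝ × ℝ} (h : Z.IsCrossingSolution γ)
    (t : ℝ) : Z.DepartsAt γ t ∧ Z.ArrivesAt γ t := by
  by_cases h1 : (γ t).1 = 1
  · have hp := (h.crossR t h1).2
    have hcr : Z.Crossing (γ t) := ⟨fun _ => hp, fun h => by linarith⟩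
    rcases lt_or_gt_of_ne (fun h0 : (Z.C (γ t)).1 = 0 => by simp [h0] at hp) with h0 | h0
    · obtain ⟨ha, hd⟩ := h.right_to_center t h1 h0
      refine ⟨⟨.C, ⟨hcr, Or.inr ⟨?_, ?_⟩⟩, hd⟩, ⟨.R, ⟨hcr, Or.inr ⟨?_, ?_⟩⟩, ha⟩⟩ <;>
        simp only [Zone.gap, Zone.dgap, PWField.fld, h1] <;> nlinarith
    · obtain ⟨ha, hd⟩ := h.center_to_right t h1 h0
      refine ⟨⟨.R, ⟨hcr, Or.inr ⟨?_, ?_⟩⟩, hd⟩, ⟨.C, ⟨hcr, Or.inr ⟨?_, ?_⟩⟩, ha⟩⟩ <;>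
        simp only [Zone.gap, Zone.dgap, PWField.fld, h1] <;> nlinarith
  by_cases h2 : (γ t).1 = -1
  · have hp := (h.crossL t h2).2
    have hcr : Z.Crossing (γ t) := ⟨fun _ => by linarith, fun _ => hp⟩
    rcases lt_or_gt_of_ne (fun h0 : (Z.C (γ t)).1 = 0 => by simp [h0] at hp) with h0 | h0
    · obtain ⟨ha, hd⟩ := h.center_to_left t h2 h0
      refine ⟨⟨.L, ⟨hcr, Or.inr ⟨?_, ?_⟩⟩, hd⟩, ⟨.C, ⟨hcr, Or.inr ⟨?_, ?_⟩⟩, ha⟩⟩ <;>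
        simp only [Zone.gap, Zone.dgap, PWField.fld, h2] <;> nlinarith
    · obtain ⟨ha, hd⟩ := h.left_to_center t h2 h0
      refine ⟨⟨.C, ⟨hcr, Or.inr ⟨?_, ?_⟩⟩, hd⟩, ⟨.L, ⟨hcr, Or.inr ⟨?_, ?_⟩⟩, ha⟩⟩ <;>
        simp only [Zone.gap, Zone.dgap, PWField.fld, h2] <;> nlinarith
  have hin : ∀ i : Zone, 0 < i.gap (γ t).1 → HasDerivAt γ (Z.fld i (γ t)) t →
      Z.DepartsAt γ t ∧ Z.ArrivesAt γ t := fun i hi hd =>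
    ⟨⟨i, enters_of_gap_pos hi, hd.hasDerivWithinAt⟩, ⟨i, leaves_of_gap_pos hi, hd.hasDerivWithinAt⟩⟩
  rcases lt_or_gt_of_ne h1 with h1 | h1
  · rcases lt_or_gt_of_ne h2 with h2 | h2
    · exact hin .L (Zone.gap_pos_L.2 h2) (h.left t h2)
    · exact hin .C (Zone.gap_pos_C.2 ⟨h2, h1⟩) (h.center t ⟨h2, h1⟩)
  · exact hin .R (Zone.gap_pos_R.2 h1) (h.right t h1)

theorem PWField.IsCrossingSolution.continuous {γ : ℝ → ℝ × ℝ} (h : Z.IsCrossingSolution γ) :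
    Continuous γ :=
  continuous_iff_continuousAt.2 fun t =>
    continuousAt_of_departs_arrives (h.departs_arrives t).1 (h.departs_arrives t).2

/-- A crossing solution through the initial point of a path follows the path. -/
theorem PWField.IsCrossingSolution.follows (hZ : Z.Lipschitz) {γ φ : ℝ → ℝ × ℝ}
    (h : Z.IsCrossingSolution γ) {s b : ℝ} (hφ : ContinuousOn φ (Icc 0 b))
    (hφ' : ∀ t ∈ Ico 0 b, Z.DepartsAt φ t) (h0 : γ s = φ 0) :
    ∀ t ∈ Icc 0 b, γ (s + t) = φ t :=
  forward_unique hZ (h.continuous.comp (continuous_const.add continuous_id)).continuousOn hφ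
    (fun t _ => (h.departs_arrives (s + t)).1.shift) hφ' (by simpa using h0)

/-- Periodic crossing solutions with a common point have the same trace. -/
theorem range_eq_of_common_point (hZ : Z.Lipschitz) {γ δ : ℝ → ℝ × ℝ} {S T s s' : ℝ}
    (hγ : Z.IsCrossingSolution γ) (hδ : Z.IsCrossingSolution δ) (hS : 0 < S) (hT : 0 < T)
    (hγS : Function.Periodic γ S) (hδT : Function.Periodic δ T) (h : γ s = δ s') :
    range γ = range δ := by
  have key : ∀ t, 0 ≤ t → γ (s + t) = δ (s' + t) := fun t ht =>
    hγ.follows hZ (φ := fun t => δ (s' + t)) (b := t)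
      (hδ.continuous.comp (continuous_const.add continuous_id)).continuousOn
      (fun r _ => (hδ.departs_arrives (s' + r)).1.shift) (by simpa using h) t ⟨ht, le_rfl⟩
  apply Subset.antisymm
  · rintro _ ⟨t, rfl⟩
    obtain ⟨y, hy, hyt⟩ := hγS.exists_mem_Ico hS t s
    exact ⟨s' + (y - s), by rw [← key _ (by linarith [hy.1]), hyt]; congr 1; ring⟩
  · rintro _ ⟨t, rfl⟩
    obtain ⟨y, hy, hyt⟩ := hδT.exists_mem_Ico hT t s'
    exact ⟨s + (y - s'), by rw [key _ (by linarith [hy.1]), hyt]; congr 1; ring⟩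

/-- The periodic extension of a closed path. -/
def periodize (φ : ℝ → ℝ × ℝ) {b : ℝ} (hb : 0 < b) (t : ℝ) : ℝ × ℝ := φ (toIcoMod hb 0 t)

theorem periodize_periodic (φ : ℝ → ℝ × ℝ) {b : ℝ} (hb : 0 < b) :
    Function.Periodic (periodize φ hb) b := fun t => by
  simp only [periodize, toIcoMod_add_right]

theorem periodize_of_mem {φ : ℝ → ℝ × ℝ} {b t : ℝ} (hb : 0 < b) (h0 : φ b = φ 0)
    (ht : t ∈ Icc 0 b) : periodize φ hb t = φ t := by
  rcases eq_or_lt_of_le ht.2 with h | h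
  · have h1 := periodize_periodic φ hb 0
    rw [zero_add] at h1
    rw [h, h1, h0, periodize, (toIcoMod_eq_self hb).2 ⟨le_rfl, by simpa using hb⟩]
  · rw [periodize, (toIcoMod_eq_self hb).2 ⟨ht.1, by simpa using h⟩]

theorem range_periodize {φ : ℝ → ℝ × ℝ} {b : ℝ} (hb : 0 < b) (h0 : φ b = φ 0) :
    range (periodize φ hb) = φ '' Icc 0 b := by
  ext z
  constructor
  · rintro ⟨t, rfl⟩
    obtain ⟨y, hy, hyt⟩ := (periodize_periodic φ hb).exists_mem_Ico₀ hb t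
    exact ⟨y, Ico_subset_Icc_self hy, by
      rw [hyt, periodize_of_mem hb h0 (Ico_subset_Icc_self hy)]⟩
  · rintro ⟨t, ht, rfl⟩
    exact ⟨t, periodize_of_mem hb h0 ht⟩

theorem PWField.PathOn.isCrossingSolution {φ : ℝ → ℝ × ℝ} {b : ℝ} (h : Z.PathOn φ b) (hb : 0 < b)
    (h0 : φ b = φ 0) : Z.IsCrossingSolution (periodize φ hb) := by
  have hper : ∀ (k : ℤ) t, periodize φ hb (k • b + t) = periodize φ hb t := fun k t => by
    rw [add_comm]; exact ((periodize_periodic φ hb).zsmul k) t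
  have hshift : ∀ k : ℤ, (fun s => periodize φ hb (k • b + s)) = periodize φ hb := fun k =>
    funext (hper k)
  apply isCrossingSolution_of_departs_arrives
  · intro t
    obtain ⟨k, hr, -⟩ := existsUnique_add_zsmul_mem_Ico hb t 0
    rw [zero_add, add_comm] at hr
    have h1 : Z.DepartsAt (periodize φ hb) (k • b + t) := by
      refine (h.departs _ hr).congr ?_
      filter_upwards [self_mem_nhdsWithin, nhdsWithin_le_nhds (Iio_mem_nhds hr.2)] with s hs hs'
      exact periodize_of_mem hb h0 ⟨hr.1.trans hs, le_of_lt hs'⟩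
    exact hshift k ▸ h1.shift
  · intro t
    obtain ⟨k, hr, -⟩ := existsUnique_add_zsmul_mem_Ioc hb t 0
    rw [zero_add, add_comm] at hr
    have h1 : Z.ArrivesAt (periodize φ hb) (k • b + t) := by
      refine (h.arrives _ hr).congr ?_
      filter_upwards [self_mem_nhdsWithin, nhdsWithin_le_nhds (Ioi_mem_nhds hr.1)] with s hs hs'
      exact periodize_of_mem hb h0 ⟨le_of_lt hs', le_trans hs hr.2⟩
    exact hshift k ▸ h1.shift

end

/-! ### The flow of an affine field -/

section

/-- The linear operator on the space of the `(z, s)` that extends the affine field: it maps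
`(z, 1)` to `(m.field z, 0)`. -/
def PertCoeffs.aug (m : PertCoeffs) : ((ℝ × ℝ) × ℝ) →L[ℝ] ((ℝ × ℝ) × ℝ) :=
  let X : ((ℝ × ℝ) × ℝ) →L[ℝ] ℝ := (ContinuousLinearMap.fst ℝ ℝ ℝ).comp
    (ContinuousLinearMap.fst ℝ (ℝ × ℝ) ℝ)
  let Y : ((ℝ × ℝ) × ℝ) →L[ℝ] ℝ := (ContinuousLinearMap.snd ℝ ℝ ℝ).comp
    (ContinuousLinearMap.fst ℝ (ℝ × ℝ) ℝ)
  let S : ((ℝ × ℝ) × ℝ) →L[ℝ] ℝ := ContinuousLinearMap.snd ℝ (ℝ × ℝ) ℝ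
  m.p • X.smulRight ((1, 0), 0) + m.q • Y.smulRight ((1, 0), 0) + m.r • S.smulRight ((1, 0), 0) +
    m.s • X.smulRight ((0, 1), 0) + m.u • Y.smulRight ((0, 1), 0) + m.v • S.smulRight ((0, 1), 0)

theorem PertCoeffs.aug_apply (m : PertCoeffs) (z : ℝ × ℝ) (s : ℝ) :
    m.aug (z, s) = ((m.p * z.1 + m.q * z.2 + m.r * s, m.s * z.1 + m.u * z.2 + m.v * s), 0) := by
  simp [PertCoeffs.aug]

/-- The flow of an affine field. -/
def PertCoeffs.flow (m : PertCoeffs) (t : ℝ) (z : ℝ × ℝ) : ℝ × ℝ :=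
  (NormedSpace.exp (t • m.aug) (z, 1)).1

theorem PertCoeffs.hasDerivAt_exp (m : PertCoeffs) (t : ℝ) (w : (ℝ × ℝ) × ℝ) :
    HasDerivAt (fun t : ℝ => NormedSpace.exp (t • m.aug) w)
      (m.aug (NormedSpace.exp (t • m.aug) w)) t := by
  have h := hasDerivAt_exp_smul_const' (𝕂 := ℝ) m.aug t
  exact (h.clm_apply (hasDerivAt_const t w)).congr_deriv (by simp)

theorem PertCoeffs.exp_snd (m : PertCoeffs) (t : ℝ) (z : ℝ × ℝ) :
    (NormedSpace.exp (t • m.aug) (z, (1 : ℝ))).2 = 1 := by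
  have h : ∀ t, HasDerivAt (fun t : ℝ => (NormedSpace.exp (t • m.aug) (z, (1 : ℝ))).2) 0 t :=
    fun t => by
      have : HasDerivAt (fun t : ℝ => (NormedSpace.exp (t • m.aug) (z, (1 : ℝ))).2)
        (m.aug (NormedSpace.exp (t • m.aug) (z, (1 : ℝ)))).2 t := (m.hasDerivAt_exp t (z, 1)).snd
      rwa [show (m.aug (NormedSpace.exp (t • m.aug) (z, (1 : ℝ)))).2 = 0 from by
        rw [← Prod.mk.eta (p := NormedSpace.exp (t • m.aug) (z, (1 : ℝ))), aug_apply]] at this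
  have := is_const_of_deriv_eq_zero (fun t => (h t).differentiableAt) (fun t => (h t).deriv) t 0
  rw [this]
  simp

theorem PertCoeffs.exp_eq (m : PertCoeffs) (t : ℝ) (z : ℝ × ℝ) :
    NormedSpace.exp (t • m.aug) (z, (1 : ℝ)) = (m.flow t z, 1) :=
  Prod.ext rfl (m.exp_snd t z)

theorem PertCoeffs.hasDerivAt_flow (m : PertCoeffs) (t : ℝ) (z : ℝ × ℝ) :
    HasDerivAt (fun t => m.flow t z) (m.field (m.flow t z)) t := by
  have h : HasDerivAt (fun t : ℝ => (NormedSpace.exp (t • m.aug) (z, (1 : ℝ))).1)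
    (m.aug (NormedSpace.exp (t • m.aug) (z, (1 : ℝ)))).1 t := (m.hasDerivAt_exp t (z, 1)).fst
  refine h.congr_deriv ?_
  rw [exp_eq, aug_apply]
  simp [PertCoeffs.field]

theorem PertCoeffs.flow_zero (m : PertCoeffs) (z : ℝ × ℝ) : m.flow 0 z = z := by
  simp [PertCoeffs.flow]

theorem PertCoeffs.flow_add (m : PertCoeffs) (s t : ℝ) (z : ℝ × ℝ) :
    m.flow (s + t) z = m.flow s (m.flow t z) := by
  have h : NormedSpace.exp ((s + t) • m.aug) =
      NormedSpace.exp (s • m.aug) * NormedSpace.exp (t • m.aug) := by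
    let _ : NormedAlgebra ℚ (((ℝ × ℝ) × ℝ) →L[ℝ] ((ℝ × ℝ) × ℝ)) :=
      NormedAlgebra.restrictScalars ℚ ℝ (((ℝ × ℝ) × ℝ) →L[ℝ] ((ℝ × ℝ) × ℝ))
    rw [add_smul]
    exact NormedSpace.exp_add_of_commute (((Commute.refl m.aug).smul_left s).smul_right t)
  have h2 := m.exp_eq (s + t) z
  rw [h, mul_apply_eq_comp, exp_eq, exp_eq] at h2
  exact (congrArg Prod.fst h2).symm

variable {E : Type*} [NormedAddCommGroup E] [NormedSpace ℝ E]

/-- An affine field whose coefficients are analytic functions of a parameter. -/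
structure AnalyticCoeffs (m : E → PertCoeffs) : Prop where
  p : ContDiff ℝ ω fun e => (m e).p
  q : ContDiff ℝ ω fun e => (m e).q
  r : ContDiff ℝ ω fun e => (m e).r
  s : ContDiff ℝ ω fun e => (m e).s
  u : ContDiff ℝ ω fun e => (m e).u
  v : ContDiff ℝ ω fun e => (m e).v

theorem AnalyticCoeffs.contDiff_flow {m : E → PertCoeffs} (h : AnalyticCoeffs m) :
    ContDiff ℝ ω fun x : E × ℝ × (ℝ × ℝ) => (m x.1).flow x.2.1 x.2.2 := by
  have haug : ContDiff ℝ ω fun e => (m e).aug := by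
    unfold PertCoeffs.aug
    exact (((((h.p.smul contDiff_const).add (h.q.smul contDiff_const)).add
      (h.r.smul contDiff_const)).add (h.s.smul contDiff_const)).add
      (h.u.smul contDiff_const)).add (h.v.smul contDiff_const)
  have hexp : ContDiff ℝ ω
      (NormedSpace.exp : (((ℝ × ℝ) × ℝ) →L[ℝ] ((ℝ × ℝ) × ℝ)) → _) :=
    contDiff_iff_contDiffAt.2 fun x => (NormedSpace.exp_analytic (𝕂 := ℝ) x).contDiffAt
  have h1 : ContDiff ℝ ω fun x : E × ℝ × (ℝ × ℝ) =>
      NormedSpace.exp (x.2.1 • (m x.1).aug) :=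
    hexp.comp ((contDiff_fst.comp contDiff_snd).smul (haug.comp contDiff_fst))
  exact contDiff_fst.comp (h1.clm_apply ((contDiff_snd.comp contDiff_snd).prodMk contDiff_const))

theorem AnalyticCoeffs.continuous_field {m : E → PertCoeffs} (h : AnalyticCoeffs m) :
    Continuous fun x : E × (ℝ × ℝ) => (m x.1).field x.2 := by
  have hx : Continuous fun x : E × (ℝ × ℝ) => x.2.1 := continuous_fst.comp continuous_snd
  have hy : Continuous fun x : E × (ℝ × ℝ) => x.2.2 := continuous_snd.comp continuous_snd
  exact ((((h.p.continuous.comp continuous_fst).mul hx).add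
    ((h.q.continuous.comp continuous_fst).mul hy)).add (h.r.continuous.comp continuous_fst)).prodMk
    ((((h.s.continuous.comp continuous_fst).mul hx).add
    ((h.u.continuous.comp continuous_fst).mul hy)).add (h.v.continuous.comp continuous_fst))

theorem AnalyticCoeffs.const (m : PertCoeffs) : AnalyticCoeffs fun _ : E => m :=
  ⟨contDiff_const, contDiff_const, contDiff_const, contDiff_const, contDiff_const, contDiff_const⟩

theorem PertCoeffs.lipschitz_field (m : PertCoeffs) : ∃ K, LipschitzWith K m.field := by
  refine ⟨‖(ContinuousLinearMap.fst ℝ (ℝ × ℝ) ℝ) ∘L m.aug ∘L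
    (ContinuousLinearMap.inl ℝ (ℝ × ℝ) ℝ)‖₊, fun z w => ?_⟩
  have := ((ContinuousLinearMap.fst ℝ (ℝ × ℝ) ℝ) ∘L m.aug ∘L
    (ContinuousLinearMap.inl ℝ (ℝ × ℝ) ℝ)).lipschitz z w
  have h : ∀ z, m.field z = ((ContinuousLinearMap.fst ℝ (ℝ × ℝ) ℝ) ∘L m.aug ∘L
    (ContinuousLinearMap.inl ℝ (ℝ × ℝ) ℝ)) z + (m.r, m.v) := fun z => by
    simp [PertCoeffs.field, PertCoeffs.aug_apply]
  rw [h, h, edist_add_right]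
  exact this

/-- A triple of affine fields, one for each zone. -/
def Perturbation.toField (P : Perturbation) : PWField := ⟨P.L.field, P.C.field, P.R.field⟩

/-- The coefficients in a zone. -/
def Perturbation.coeffs (P : Perturbation) : Zone → PertCoeffs
  | .L => P.L
  | .C => P.C
  | .R => P.R

theorem Perturbation.fld_toField (P : Perturbation) (i : Zone) :
    P.toField.fld i = (P.coeffs i).field := by
  cases i <;> rfl

theorem Perturbation.lipschitz_toField (P : Perturbation) : P.toField.Lipschitz := fun i => by
  rw [P.fld_toField]; exact (P.coeffs i).lipschitz_field

end

/-! ### Exit times -/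

section

/-- Persistence of a transversal first exit: if `F q₀` is positive on `(0, τ₀)`, vanishes with
negative derivative at `τ₀`, and does not start tangentially at `0`, then for `q` near `q₀`
with `F q 0 ≥ 0` the function `F q` is positive until a first zero close to `τ₀`. -/
theorem eventually_exists_exit {Q : Type*} [TopologicalSpace Q] {F F' : Q → ℝ → ℝ}
    (hF : Continuous (Function.uncurry F)) (hF' : Continuous (Function.uncurry F'))
    (hd : ∀ q s, HasDerivAt (F q) (F' q s) s) {q₀ : Q} {τ₀ : ℝ} (hτ : 0 ≤ τ₀)
    (hpos : ∀ s ∈ Ioo 0 τ₀, 0 < F q₀ s) (hend : F q₀ τ₀ = 0) (hend' : F' q₀ τ₀ < 0)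
    (h0 : τ₀ = 0 ∨ 0 < F q₀ 0 ∨ 0 < F' q₀ 0) {r : ℝ} (hr : 0 < r) :
    ∀ᶠ q in 𝓝 q₀, 0 ≤ F q 0 →
      ∃ s, 0 ≤ s ∧ |s - τ₀| < r ∧ F q s = 0 ∧ ∀ s' ∈ Ioo 0 s, 0 < F q s' := by
  have hFq : ∀ q, Continuous (F q) := fun q => hF.comp (Continuous.prodMk_right q)
  have hFs : ∀ s, Continuous fun q => F q s := fun s => hF.comp (Continuous.prodMk_left s)
  -- near the exit the function is strictly decreasing
  have hev : ∀ᶠ x : Q × ℝ in 𝓝 (q₀, τ₀), F' x.1 x.2 < 0 :=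
    hF'.continuousAt.eventually (gt_mem_nhds hend')
  rw [nhds_prod_eq] at hev
  obtain ⟨pa, ha, pb, hb, hab⟩ := eventually_prod_iff.1 hev
  obtain ⟨δ₁, hδ₁, hb⟩ := Metric.eventually_nhds_iff.1 hb
  obtain ⟨δ, hδ, hδlt⟩ : ∃ δ, 0 < δ ∧ δ < δ₁ ∧ δ < r ∧ (0 < τ₀ → δ < τ₀) := by
    rcases eq_or_lt_of_le hτ with h | h
    · refine ⟨min δ₁ r / 2, by positivity, ?_, ?_, fun h' => absurd h h'.ne⟩
      · linarith [min_le_left δ₁ r, lt_min hδ₁ hr]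
      · linarith [min_le_right δ₁ r, lt_min hδ₁ hr]
    · have hm : 0 < min (min δ₁ r) τ₀ := by positivity
      refine ⟨min (min δ₁ r) τ₀ / 2, by positivity, ?_, ?_, fun _ => ?_⟩
      · linarith [min_le_left (min δ₁ r) τ₀, min_le_left δ₁ r]
      · linarith [min_le_left (min δ₁ r) τ₀, min_le_right δ₁ r]
      · linarith [min_le_right (min δ₁ r) τ₀]
  obtain ⟨hδ1, hδr, hδτ⟩ := hδlt
  have hanti : ∀ q, pa q → StrictAntiOn (F q) (Icc (τ₀ - δ) (τ₀ + δ)) := by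
    intro q hq
    refine strictAntiOn_of_deriv_neg (convex_Icc _ _) (hFq q).continuousOn fun s hs => ?_
    rw [interior_Icc] at hs
    rw [(hd q s).deriv]
    refine hab hq (hb ?_)
    rw [Real.dist_eq, abs_lt]
    constructor <;> linarith [hs.1, hs.2]
  have hq₀ := ha.self_of_nhds
  have hlt : F q₀ (τ₀ + δ) < 0 := by
    rw [← hend]
    exact hanti q₀ hq₀ ⟨by linarith, by linarith⟩ ⟨by linarith, le_rfl⟩ (by linarith)
  have hlt' := (hFs (τ₀ + δ)).continuousAt.eventually (gt_mem_nhds hlt)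
  rcases eq_or_lt_of_le hτ with h | h
  · -- the exit is immediate
    subst h
    filter_upwards [ha, hlt'] with q hqa hq h0
    simp only [zero_add, zero_sub] at hq hanti
    obtain ⟨s, hs, hs0⟩ := intermediate_value_Icc' hδ.le (hFq q).continuousOn ⟨hq.le, h0⟩
    refine ⟨s, hs.1, ?_, hs0, fun s' hs' => ?_⟩
    · rw [sub_zero, abs_of_nonneg hs.1]; linarith [hs.2]
    · rw [← hs0]
      exact hanti q hqa ⟨by linarith [hs'.1], by linarith [hs'.2, hs.2]⟩
        ⟨by linarith [hs.1], hs.2⟩ hs'.2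
  · have hδτ := hδτ h
    -- away from the exit the function stays positive, by compactness
    have hmid : ∀ᶠ q in 𝓝 q₀, ∀ s ∈ Icc 0 (τ₀ - δ), 0 < s → 0 ≤ F q 0 → 0 < F q s := by
      refine isCompact_Icc.eventually_forall_of_forall_eventually
        (P := fun q s => 0 < s → 0 ≤ F q 0 → 0 < F q s) fun s hs => ?_
      by_cases hs0 : 0 < F q₀ s
      · have := hF.continuousAt (x := (q₀, s)) |>.eventually (lt_mem_nhds hs0)
        filter_upwards [this] with x hx _ _ using hx
      · have hs00 : s = 0 := by
          by_contra hne
          exact hs0 (hpos s ⟨lt_of_le_of_ne hs.1 (Ne.symm hne), by linarith [hs.2]⟩)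
        subst hs00
        have hF'0 : 0 < F' q₀ 0 := (h0.resolve_left h.ne').resolve_left hs0
        have hev0 : ∀ᶠ x : Q × ℝ in 𝓝 (q₀, 0), 0 < F' x.1 x.2 :=
          hF'.continuousAt.eventually (lt_mem_nhds hF'0)
        rw [nhds_prod_eq] at hev0 ⊢
        obtain ⟨pc, hc, pd, hd', hcd⟩ := eventually_prod_iff.1 hev0
        obtain ⟨δ₂, hδ₂, hd'⟩ := Metric.eventually_nhds_iff.1 hd'
        refine eventually_prod_iff.2 ⟨pc, hc, fun s => |s| < δ₂,
          Metric.eventually_nhds_iff.2 ⟨δ₂, hδ₂, fun {y} hy => by simpa using hy⟩, ?_⟩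
        intro q hq s hs hs0 hq0
        have hmono : StrictMonoOn (F q) (Icc 0 s) := by
          refine strictMonoOn_of_deriv_pos (convex_Icc _ _) (hFq q).continuousOn fun t ht => ?_
          rw [interior_Icc] at ht
          rw [(hd q t).deriv]
          refine hcd hq (hd' ?_)
          rw [Real.dist_eq, sub_zero, abs_of_pos ht.1]
          exact ht.2.trans_le ((le_abs_self s).trans hs.le)
        exact hq0.trans_lt (hmono ⟨le_rfl, hs0.le⟩ ⟨hs0.le, le_rfl⟩ hs0)
    filter_upwards [ha, hlt', hmid] with q hqa hq hqm h0
    have hp := hqm (τ₀ - δ) ⟨by linarith, le_rfl⟩ (by linarith) h0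
    obtain ⟨s, hs, hs0⟩ := intermediate_value_Icc' (by linarith) (hFq q).continuousOn
      (show (0 : ℝ) ∈ Icc (F q (τ₀ + δ)) (F q (τ₀ - δ)) from ⟨hq.le, hp.le⟩)
    refine ⟨s, by linarith [hs.1], ?_, hs0, fun s' hs' => ?_⟩
    · rw [abs_lt]; constructor <;> linarith [hs.1, hs.2]
    · rcases le_total s' (τ₀ - δ) with h' | h'
      · exact hqm s' ⟨hs'.1.le, h'⟩ hs'.1 h0
      · rw [← hs0]
        exact hanti q hqa ⟨h', by linarith [hs'.2, hs.2]⟩ hs hs'.2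

/-! ### Arcs in one zone -/

/-- From `p` to `p'`, both on the boundary of the zone `i`, the flow of the zone runs for the
time `τ` through the zone, entering and leaving it at crossing points. -/
structure Perturbation.IsArc (P : Perturbation) (i : Zone) (p p' : ℝ × ℝ) (τ : ℝ) : Prop where
  pos : 0 < τ
  gap_start : i.gap p.1 = 0
  gap_end : i.gap p'.1 = 0
  enters : P.toField.Enters i p
  leaves : P.toField.Leaves i p'
  inside : ∀ t ∈ Ioo 0 τ, 0 < i.gap ((P.coeffs i).flow t p).1
  exit : (P.coeffs i).flow τ p = p'

theorem hasDerivAt_fld_flow (P : Perturbation) (i : Zone) (t : ℝ) (z : ℝ × ℝ) :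
    HasDerivAt (fun t => (P.coeffs i).flow t z) (P.toField.fld i ((P.coeffs i).flow t z)) t := by
  rw [P.fld_toField]; exact (P.coeffs i).hasDerivAt_flow t z

theorem Perturbation.IsArc.pathOn {P : Perturbation} {i : Zone} {p p' : ℝ × ℝ} {τ : ℝ}
    (h : P.IsArc i p p' τ) : P.toField.PathOn (fun t => (P.coeffs i).flow t p) τ := by
  constructor
  · intro t ht
    refine ⟨i, ?_, (hasDerivAt_fld_flow P i t p).hasDerivWithinAt⟩
    rcases eq_or_lt_of_le ht.1 with rfl | h0
    · change P.toField.Enters i ((P.coeffs i).flow 0 p)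
      rw [PertCoeffs.flow_zero]; exact h.enters
    · exact enters_of_gap_pos (h.inside t ⟨h0, ht.2⟩)
  · intro t ht
    refine ⟨i, ?_, (hasDerivAt_fld_flow P i t p).hasDerivWithinAt⟩
    rcases eq_or_lt_of_le ht.2 with rfl | h0
    · change P.toField.Leaves i ((P.coeffs i).flow t p)
      rw [h.exit]; exact h.leaves
    · exact leaves_of_gap_pos (h.inside t ⟨ht.1, h0⟩)

variable {E : Type*} [NormedAddCommGroup E] [NormedSpace ℝ E]

/-- A family of piecewise affine fields whose coefficients are analytic in the parameter. -/
def AnalyticFamily (m : E → Perturbation) : Prop := ∀ i, AnalyticCoeffs fun e => (m e).coeffs i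

theorem AnalyticFamily.const (P : Perturbation) : AnalyticFamily fun _ : E => P :=
  fun i => AnalyticCoeffs.const (P.coeffs i)

variable {m : E → Perturbation}

theorem AnalyticFamily.continuous_fld (hm : AnalyticFamily m) (i : Zone) :
    Continuous fun x : E × (ℝ × ℝ) => (m x.1).toField.fld i x.2 := by
  simp only [Perturbation.fld_toField]
  exact (hm i).continuous_field

theorem AnalyticFamily.eventually_crossing (hm : AnalyticFamily m) {e₀ : E} {z₀ : ℝ × ℝ}
    (h : (m e₀).toField.Crossing z₀) :
    ∀ᶠ x : E × (ℝ × ℝ) in 𝓝 (e₀, z₀), (m x.1).toField.Crossing x.2 := by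
  have key : ∀ (i : Zone) (a : ℝ), (z₀.1 = a → 0 < ((m e₀).toField.fld i z₀).1 *
      ((m e₀).toField.fld .C z₀).1) → ∀ᶠ x : E × (ℝ × ℝ) in 𝓝 (e₀, z₀), x.2.1 = a →
      0 < ((m x.1).toField.fld i x.2).1 * ((m x.1).toField.fld .C x.2).1 := by
    intro i a ha
    by_cases hz : z₀.1 = a
    · have hc : Continuous fun x : E × (ℝ × ℝ) =>
          ((m x.1).toField.fld i x.2).1 * ((m x.1).toField.fld .C x.2).1 :=
        (continuous_fst.comp (hm.continuous_fld i)).mul (continuous_fst.comp (hm.continuous_fld .C))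
      filter_upwards [hc.continuousAt.eventually (lt_mem_nhds (ha hz))] with x hx _ using hx
    · have hc : Continuous fun x : E × (ℝ × ℝ) => x.2.1 := continuous_fst.comp continuous_snd
      filter_upwards [hc.continuousAt.eventually_ne hz] with x hx hx' using absurd hx' hx
  exact (key .R 1 h.1).and (key .L (-1) h.2)

theorem AnalyticFamily.eventually_dgap (hm : AnalyticFamily m) (i : Zone) (e₀ : E)
    (z₀ : ℝ × ℝ) : ContinuousAt (fun x : E × (ℝ × ℝ) =>
      i.dgap x.2.1 * ((m x.1).toField.fld i x.2).1) (e₀, z₀) :=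
  ((i.continuous_dgap.comp (continuous_fst.comp continuous_snd)).mul
    (continuous_fst.comp (hm.continuous_fld i))).continuousAt

theorem AnalyticFamily.eventually_enters (hm : AnalyticFamily m) {i : Zone} {e₀ : E} {z₀ : ℝ × ℝ}
    (h : (m e₀).toField.Enters i z₀) (h0 : i.gap z₀.1 = 0) :
    ∀ᶠ x : E × (ℝ × ℝ) in 𝓝 (e₀, z₀), i.gap x.2.1 = 0 → (m x.1).toField.Enters i x.2 := by
  have h1 := (h.2.resolve_left h0.not_gt).2
  filter_upwards [hm.eventually_crossing h.1,
    (hm.eventually_dgap i e₀ z₀).eventually (lt_mem_nhds h1)] with x hx hx1 hx2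
  exact ⟨hx, Or.inr ⟨hx2, hx1⟩⟩

theorem AnalyticFamily.eventually_leaves (hm : AnalyticFamily m) {i : Zone} {e₀ : E} {z₀ : ℝ × ℝ}
    (h : (m e₀).toField.Leaves i z₀) (h0 : i.gap z₀.1 = 0) :
    ∀ᶠ x : E × (ℝ × ℝ) in 𝓝 (e₀, z₀), i.gap x.2.1 = 0 → (m x.1).toField.Leaves i x.2 := by
  have h1 := (h.2.resolve_left h0.not_gt).2
  filter_upwards [hm.eventually_crossing h.1,
    (hm.eventually_dgap i e₀ z₀).eventually (gt_mem_nhds h1)] with x hx hx1 hx2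
  exact ⟨hx, Or.inr ⟨hx2, hx1⟩⟩

theorem Zone.eventually_eq_of_gap {i : Zone} {x₀ : ℝ} (h0 : i.gap x₀ = 0) :
    ∀ᶠ x in 𝓝 x₀, i.gap x = 0 → x = x₀ := by
  cases i
  · have := Zone.line_of_gap_L h0
    exact Eventually.of_forall fun x hx => by rw [Zone.line_of_gap_L hx, this]
  · rcases Zone.line_of_gap_C h0 with rfl | rfl
    · filter_upwards [lt_mem_nhds (show (0 : ℝ) < 1 by norm_num)] with x hx hx0
      rcases Zone.line_of_gap_C hx0 with h | h <;> linarith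
    · filter_upwards [gt_mem_nhds (show (-1 : ℝ) < 0 by norm_num)] with x hx hx0
      rcases Zone.line_of_gap_C hx0 with h | h <;> linarith
  · have := Zone.line_of_gap_R h0
    exact Eventually.of_forall fun x hx => by rw [Zone.line_of_gap_R hx, this]

/-- Persistence of arcs: near an arc of the field with parameter `0` there are arcs of the fields
with small parameters, and their transition times are analytic. -/
theorem Perturbation.IsArc.persist [CompleteSpace E] (hm : AnalyticFamily m) {i : Zone}
    {x y₀ τ₀ : ℝ} {p' : ℝ × ℝ}
    (h : (m 0).IsArc i (x, y₀) p' τ₀) :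
    ∃ τ : E × ℝ → ℝ, ContDiffAt ℝ ω τ (0, y₀) ∧ τ (0, y₀) = τ₀ ∧
      ∀ᶠ p : E × ℝ in 𝓝 (0, y₀),
        (m p.1).IsArc i (x, p.2) (p'.1, (((m p.1).coeffs i).flow (τ p) (x, p.2)).2) (τ p) := by
  have hflow := (hm i).contDiff_flow
  have hinc : ContDiff ℝ ω fun v : (E × ℝ) × ℝ => (v.1.1, v.2, (x, v.1.2)) :=
    (contDiff_fst.comp contDiff_fst).prodMk (contDiff_snd.prodMk
      (contDiff_const.prodMk (contDiff_snd.comp contDiff_fst)))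
  have hG : ContDiff ℝ ω fun v : (E × ℝ) × ℝ =>
      ((m v.1.1).coeffs i).flow v.2 (x, v.1.2) := hflow.comp hinc
  have hgap : ContDiff ℝ ω i.gap := by
    cases i
    · exact contDiff_const.sub contDiff_id
    · exact contDiff_const.sub (contDiff_id.pow 2)
    · exact contDiff_id.sub contDiff_const
  set f : (E × ℝ) × ℝ → ℝ := fun v => i.gap (((m v.1.1).coeffs i).flow v.2 (x, v.1.2)).1 with hf
  have hfc : ContDiff ℝ ω f := hgap.comp (contDiff_fst.comp hG)
  set F' : E × ℝ → ℝ → ℝ := fun p s =>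
    i.dgap (((m p.1).coeffs i).flow s (x, p.2)).1 *
      ((m p.1).toField.fld i (((m p.1).coeffs i).flow s (x, p.2))).1 with hF'
  have hd : ∀ (p : E × ℝ) s, HasDerivAt (fun s => f (p, s)) (F' p s) s := fun p s => by
    have := hasDerivWithinAt_gap i
      (hasDerivAt_fld_flow (m p.1) i s (x, p.2)).hasDerivWithinAt (s := univ)
    exact hasDerivWithinAt_univ.1 this
  have hF'c : Continuous (Function.uncurry F') := by
    have h1 : Continuous fun v : (E × ℝ) × ℝ =>
        (v.1.1, ((m v.1.1).coeffs i).flow v.2 (x, v.1.2)) :=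
      (continuous_fst.comp continuous_fst).prodMk hG.continuous
    exact (i.continuous_dgap.comp (continuous_fst.comp hG.continuous)).mul
      (continuous_fst.comp ((hm.continuous_fld i).comp h1))
  have hend : f ((0, y₀), τ₀) = 0 := by simp only [hf, h.exit, h.gap_end]
  have hend' : F' (0, y₀) τ₀ < 0 := by
    simp only [hF', h.exit]; exact (h.leaves.2.resolve_left h.gap_end.not_gt).2
  have hinv : (fderiv ℝ f ((0, y₀), τ₀) ∘L
      ContinuousLinearMap.inr ℝ (E × ℝ) ℝ).IsInvertible := by
    refine ⟨ContinuousLinearEquiv.unitsEquivAut ℝ (Units.mk0 _ hend'.ne), ?_⟩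
    ext
    have h1 := (hfc.differentiable (by simp) ((0, y₀), τ₀)).hasFDerivAt
    have h2 : HasDerivAt (fun s : ℝ => (((0 : E), y₀), s)) ((0 : E × ℝ), (1 : ℝ)) τ₀ :=
      (hasDerivAt_const τ₀ ((0 : E), y₀)).prodMk (hasDerivAt_id τ₀)
    have h3 := h1.comp_hasDerivAt τ₀ h2
    have := (hd (0, y₀) τ₀).unique h3
    simp [this]
  have hω : (ω : WithTop ℕ∞) ≠ 0 := by simp
  have hfa : ContDiffAt ℝ ω f ((0, y₀), τ₀) := hfc.contDiffAt
  refine ⟨hfa.implicitFunction hω hinv, hfa.contDiffAt_implicitFunction hω hinv,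
    hfa.implicitFunction_apply_self hω hinv, ?_⟩
  -- near the exit point the implicit function gives the only zero, and the exit is transversal
  have hnear : ∀ᶠ v : (E × ℝ) × ℝ in 𝓝 ((0, y₀), τ₀),
      (f v = 0 → hfa.implicitFunction hω hinv v.1 = v.2) ∧
      (f v = 0 → (((m v.1.1).coeffs i).flow v.2 (x, v.1.2)).1 = p'.1) ∧
      (f v = 0 → (m v.1.1).toField.Leaves i (((m v.1.1).coeffs i).flow v.2 (x, v.1.2))) ∧
      0 < v.2 := by
    refine Eventually.and ?_ (Eventually.and ?_ (Eventually.and ?_ ?_))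
    · filter_upwards [hfa.eventually_apply_eq_iff_implicitFunction hω hinv] with v hv hv0
      exact hv.1 (by rw [hv0, hend])
    · have hc : ContinuousAt (fun v : (E × ℝ) × ℝ =>
          (((m v.1.1).coeffs i).flow v.2 (x, v.1.2)).1) ((0, y₀), τ₀) :=
        (continuous_fst.comp hG.continuous).continuousAt
      have h1 : ∀ᶠ a in 𝓝 (((m 0).coeffs i).flow τ₀ (x, y₀)).1, i.gap a = 0 → a = p'.1 := by
        rw [h.exit]; exact Zone.eventually_eq_of_gap h.gap_end
      exact hc.eventually h1
    · have hc : ContinuousAt (fun v : (E × ℝ) × ℝ =>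
          (v.1.1, ((m v.1.1).coeffs i).flow v.2 (x, v.1.2))) ((0, y₀), τ₀) :=
        ((continuous_fst.comp continuous_fst).prodMk hG.continuous).continuousAt
      have h1 : ∀ᶠ a : E × (ℝ × ℝ) in 𝓝 (0, ((m 0).coeffs i).flow τ₀ (x, y₀)),
          i.gap a.2.1 = 0 → (m a.1).toField.Leaves i a.2 := by
        rw [h.exit]; exact hm.eventually_leaves h.leaves h.gap_end
      exact hc.eventually h1
    · exact continuous_snd.continuousAt.eventually (lt_mem_nhds h.pos)
  rw [nhds_prod_eq] at hnear
  obtain ⟨pa, ha, pb, hb, hab⟩ := eventually_prod_iff.1 hnear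
  obtain ⟨r, hr, hb⟩ := Metric.eventually_nhds_iff.1 hb
  have hexit := eventually_exists_exit (F := fun p s => f (p, s)) (F' := F') (q₀ := (0, y₀))
    (by exact hfc.continuous) hF'c hd h.pos.le (fun s hs => h.inside s hs) hend hend'
    (Or.inr (Or.inr (by
      simp only [hF', PertCoeffs.flow_zero]
      exact (h.enters.2.resolve_left h.gap_start.not_gt).2))) hr
  have hent : ∀ᶠ p : E × ℝ in 𝓝 (0, y₀), (m p.1).toField.Enters i (x, p.2) := by
    have hc : ContinuousAt (fun p : E × ℝ => (p.1, (x, p.2))) (0, y₀) :=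
      (continuous_fst.prodMk (continuous_const.prodMk continuous_snd)).continuousAt
    filter_upwards [hc.eventually (hm.eventually_enters h.enters h.gap_start)] with p hp
    exact hp h.gap_start
  filter_upwards [ha, hexit, hent] with p hpa hpe hpent
  obtain ⟨s, hs0, hsr, hfs, hpos⟩ := hpe (by
    simp only [hf, PertCoeffs.flow_zero]; exact h.gap_start.ge)
  obtain ⟨h1, h2, h3, h4⟩ := hab hpa (hb (y := s) (by rwa [Real.dist_eq]))
  have h1 := h1 hfs
  have h2 := h2 hfs
  have h3 := h3 hfs
  simp only at h1 h2 h3 h4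
  have he : ((m p.1).coeffs i).flow s (x, p.2) =
      (p'.1, (((m p.1).coeffs i).flow s (x, p.2)).2) := Prod.ext h2 rfl
  rw [h1]
  exact ⟨h4, h.gap_start, h.gap_end, hpent, he ▸ h3, hpos, he⟩

end

/-! ### Transitions between switching lines -/

section

/-- Every crossing solution through the point `q` meets the set `A`. -/
def PWField.Hits (Z : PWField) (A : Set (ℝ × ℝ)) (q : ℝ × ℝ) : Prop :=
  ∀ γ, Z.IsCrossingSolution γ → ∀ s, γ s = q → ∃ s', γ s' ∈ A

theorem PWField.hits_of_mem {Z : PWField} {A : Set (ℝ × ℝ)} {q : ℝ × ℝ} (h : q ∈ A) :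
    Z.Hits A q := fun _ _ s hs => ⟨s, hs.symm ▸ h⟩

theorem PWField.Hits.trans {Z : PWField} {A B : Set (ℝ × ℝ)} {q : ℝ × ℝ} (h : Z.Hits A q)
    (hAB : ∀ z ∈ A, Z.Hits B z) : Z.Hits B q := fun γ hγ s hs =>
  let ⟨s', hs'⟩ := h γ hγ s hs
  hAB _ hs' γ hγ s' rfl

/-- All crossing solutions through the points of the closed zone near an arc follow the arc to its
end. -/
theorem Perturbation.IsArc.hits {P : Perturbation} {i : Zone} {p p' : ℝ × ℝ} {τ : ℝ}
    (h : P.IsArc i p p' τ) {O : Set (ℝ × ℝ)} (hO : O ∈ 𝓝 p') {t : ℝ} (ht : t ∈ Icc 0 τ) :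
    ∀ᶠ q in 𝓝 ((P.coeffs i).flow t p), 0 ≤ i.gap q.1 →
      P.toField.Hits {z | z ∈ O ∧ z.1 = p'.1} q := by
  have hm : AnalyticFamily fun _ : ℝ => P := AnalyticFamily.const P
  have hG : Continuous fun v : (ℝ × ℝ) × ℝ => (P.coeffs i).flow v.2 v.1 :=
    (hm i).contDiff_flow.continuous.comp (continuous_const.prodMk
      (continuous_snd.prodMk continuous_fst) :
        Continuous fun v : (ℝ × ℝ) × ℝ => ((0 : ℝ), v.2, v.1))
  have hfld : Continuous (P.toField.fld i) :=
    (hm.continuous_fld i).comp (continuous_const.prodMk continuous_id :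
      Continuous fun z : ℝ × ℝ => ((0 : ℝ), z))
  set F : ℝ × ℝ → ℝ → ℝ := fun q s => i.gap ((P.coeffs i).flow s q).1 with hF
  set F' : ℝ × ℝ → ℝ → ℝ := fun q s => i.dgap ((P.coeffs i).flow s q).1 *
      (P.toField.fld i ((P.coeffs i).flow s q)).1 with hF'
  have hFc : Continuous (Function.uncurry F) := i.continuous_gap.comp (continuous_fst.comp hG)
  have hFc' : Continuous (Function.uncurry F') :=
    (i.continuous_dgap.comp (continuous_fst.comp hG)).mul (continuous_fst.comp (hfld.comp hG))
  have hd : ∀ q s, HasDerivAt (F q) (F' q s) s := fun q s =>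
    hasDerivWithinAt_univ.1
      (hasDerivWithinAt_gap i (hasDerivAt_fld_flow P i s q).hasDerivWithinAt (s := univ))
  set q₀ := (P.coeffs i).flow t p with hq₀
  have hadd : ∀ s, (P.coeffs i).flow s q₀ = (P.coeffs i).flow (s + t) p := fun s =>
    ((P.coeffs i).flow_add s t p).symm
  have hexit : (P.coeffs i).flow (τ - t) q₀ = p' := by rw [hadd, sub_add_cancel, h.exit]
  -- near the end of the arc, points of the boundary of the zone are in the target
  have htarget : ∀ᶠ z in 𝓝 p', i.gap z.1 = 0 → z ∈ O ∧ z.1 = p'.1 := by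
    filter_upwards [hO, continuous_fst.continuousAt.eventually
      (Zone.eventually_eq_of_gap h.gap_end)] with z hz hz' hz0
    exact ⟨hz, hz' hz0⟩
  have hnear : ∀ᶠ v : (ℝ × ℝ) × ℝ in 𝓝 (q₀, τ - t), i.gap ((P.coeffs i).flow v.2 v.1).1 = 0 →
      (P.coeffs i).flow v.2 v.1 ∈ O ∧ ((P.coeffs i).flow v.2 v.1).1 = p'.1 :=
    (hexit ▸ hG.continuousAt : Tendsto (fun v : (ℝ × ℝ) × ℝ => (P.coeffs i).flow v.2 v.1)
      (𝓝 (q₀, τ - t)) (𝓝 p')).eventually htarget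
  rw [nhds_prod_eq] at hnear
  obtain ⟨pa, ha, pb, hb, hab⟩ := eventually_prod_iff.1 hnear
  obtain ⟨r, hr, hb⟩ := Metric.eventually_nhds_iff.1 hb
  have hex := eventually_exists_exit (F := F) (F' := F') (q₀ := q₀)
    (τ₀ := τ - t) hFc hFc' hd (by linarith [ht.2]) (fun s hs => by
      simp only [hF, hadd]; exact h.inside _ ⟨by linarith [hs.1, ht.1], by linarith [hs.2]⟩)
    (by simp only [hF, hexit, h.gap_end])
    (by simp only [hF', hexit]; exact (h.leaves.2.resolve_left h.gap_end.not_gt).2)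
    (by
      rcases eq_or_lt_of_le ht.2 with h1 | h1
      · left; linarith
      right
      rcases eq_or_lt_of_le ht.1 with h2 | h2
      · right
        simp only [hF', PertCoeffs.flow_zero, hq₀, ← h2]
        exact (h.enters.2.resolve_left h.gap_start.not_gt).2
      · left
        simp only [hF, PertCoeffs.flow_zero]
        exact h.inside t ⟨h2, h1⟩) hr
  -- a boundary point near the given point is entering the zone or is already in the target
  have hstart : ∀ᶠ q in 𝓝 q₀, i.gap q.1 = 0 →
      P.toField.Enters i q ∨ (q ∈ O ∧ q.1 = p'.1) := by
    rcases eq_or_lt_of_le ht.2 with h1 | h1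
    · have hqp : q₀ = p' := by rw [hq₀, h1, h.exit]
      rw [hqp]
      filter_upwards [htarget] with q hq hq0 using Or.inr (hq hq0)
    rcases eq_or_lt_of_le ht.1 with h2 | h2
    · have hqp : q₀ = p := by rw [hq₀, ← h2, PertCoeffs.flow_zero]
      rw [hqp]
      have hc : ContinuousAt (fun q : ℝ × ℝ => ((0 : ℝ), q)) p :=
        (continuous_const.prodMk continuous_id).continuousAt
      filter_upwards [hc.eventually (hm.eventually_enters h.enters h.gap_start)] with q hq hq0
      exact Or.inl (hq hq0)
    · have : ContinuousAt (fun q : ℝ × ℝ => i.gap q.1) q₀ :=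
        (i.continuous_gap.comp continuous_fst).continuousAt
      filter_upwards [this.eventually (lt_mem_nhds (h.inside t ⟨h2, h1⟩))] with q hq hq0
      exact absurd hq hq0.not_gt
  filter_upwards [ha, hex, hstart] with q hqa hqe hqs hq0
  have hq : P.toField.Enters i q ∨ (q ∈ O ∧ q.1 = p'.1) := by
    rcases eq_or_lt_of_le hq0 with h1 | h1
    · exact hqs h1.symm
    · exact Or.inl (enters_of_gap_pos h1)
  rcases hq with hq | hq
  swap
  · exact PWField.hits_of_mem hq
  obtain ⟨s, hs0, hsr, hfs, hpos⟩ := hqe (by simpa only [hF, PertCoeffs.flow_zero] using hq0)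
  have hmem := hab hqa (hb (y := s) (by rwa [Real.dist_eq])) hfs
  intro γ hγ s₁ hs₁
  refine ⟨s₁ + s, ?_⟩
  rw [hγ.follows P.lipschitz_toField (φ := fun s => (P.coeffs i).flow s q) (b := s)
    (fun r _ => ((P.coeffs i).hasDerivAt_flow r q).continuousAt.continuousWithinAt) ?_
    (by rw [PertCoeffs.flow_zero, hs₁]) s ⟨hs0, le_rfl⟩]
  · exact hmem
  · intro r hr
    refine ⟨i, ?_, (hasDerivAt_fld_flow P i r q).hasDerivWithinAt⟩
    rcases eq_or_lt_of_le hr.1 with rfl | h0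
    · change P.toField.Enters i ((P.coeffs i).flow 0 q)
      rwa [PertCoeffs.flow_zero]
    · exact enters_of_gap_pos (hpos r ⟨h0, hr.2⟩)

variable {E : Type*} [NormedAddCommGroup E] [NormedSpace ℝ E]

/-- Transition maps. For parameters and ordinates `p = (e, y)` near `(0, y₀)` the path `φ p` of the
field `m e` runs, within the time `τ p`, from the point `(x, y)`, where it enters the zone `i`, to
the point `(x', Y p)`, where it leaves the zone `j`.  The interior of the path avoids the section
`{1} × [c, ∞)`, its trace depends continuously on `p`, and crossing solutions near the path follow
it to its end. -/
structure Transition (m : E → Perturbation) (c : ℝ) (i j : Zone) (x x' y₀ : ℝ)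
    (Y τ : E × ℝ → ℝ) (φ : E × ℝ → ℝ → ℝ × ℝ) : Prop where
  contDiffAt : ContDiffAt ℝ ω Y (0, y₀)
  gap_start : i.gap x = 0
  path : ∀ᶠ p in 𝓝 (0, y₀), 0 < τ p ∧ φ p 0 = (x, p.2) ∧ φ p (τ p) = (x', Y p) ∧
    (m p.1).toField.PathOn (φ p) (τ p)
  avoid : ∀ᶠ p in 𝓝 (0, y₀), ∀ t ∈ Ioo 0 (τ p), ¬ ((φ p t).1 = 1 ∧ c ≤ (φ p t).2)
  near : ∀ᶠ p in 𝓝 (0, y₀), Tendsto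
    (fun p' => Metric.hausdorffEDist (φ p' '' Icc 0 (τ p')) (φ p '' Icc 0 (τ p))) (𝓝 p) (𝓝 0)
  hits : ∀ᶠ p in 𝓝 (0, y₀), ∀ O ∈ 𝓝 (x', Y p),
    (∀ t ∈ Ioo 0 (τ p), ∀ᶠ q in 𝓝 (φ p t), (m p.1).toField.Hits {z | z ∈ O ∧ z.1 = x'} q) ∧
    (∀ᶠ q in 𝓝 (x, p.2), 0 ≤ i.gap q.1 → (m p.1).toField.Hits {z | z ∈ O ∧ z.1 = x'} q) ∧
    (∀ᶠ q in 𝓝 (x', Y p), 0 ≤ j.gap q.1 → (m p.1).toField.Hits {z | z ∈ O ∧ z.1 = x'} q)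

variable {m : E → Perturbation} {c : ℝ}

/-- Continuity of traces, for a jointly continuous family of curves. -/
theorem tendsto_hausdorffEDist_image {A : Type*} [TopologicalSpace A] {φ : A → ℝ → ℝ × ℝ}
    {τ : A → ℝ} {p : A}
    (hφ : Continuous (Function.uncurry φ)) (hτ : ContinuousAt τ p) (hpos : 0 < τ p) :
    Tendsto (fun p' => Metric.hausdorffEDist (φ p' '' Icc 0 (τ p')) (φ p '' Icc 0 (τ p)))
      (𝓝 p) (𝓝 0) := by
  rw [ENNReal.tendsto_nhds_zero]
  intro ε hε
  have hev : ∀ᶠ p' in 𝓝 p, ∀ s ∈ Icc (0 : ℝ) 1,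
      edist (φ p' (s * τ p')) (φ p (s * τ p)) < ε := by
    refine isCompact_Icc.eventually_forall_of_forall_eventually
      (P := fun p' s => edist (φ p' (s * τ p')) (φ p (s * τ p)) < ε) fun s _ => ?_
    have h1 : ContinuousAt (fun v : A × ℝ => φ v.1 (v.2 * τ v.1)) (p, s) :=
      hφ.continuousAt.comp (continuousAt_fst.prodMk (continuousAt_snd.mul
        (ContinuousAt.comp (f := Prod.fst) (x := (p, s)) (by exact hτ) continuousAt_fst)))
    have h2 : ContinuousAt (fun v : A × ℝ => φ p (v.2 * τ p)) (p, s) :=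
      (hφ.comp (Continuous.prodMk continuous_const
        (continuous_snd.mul continuous_const))).continuousAt
    exact (h1.edist h2).eventually (gt_mem_nhds (by simpa using hε))
  filter_upwards [hev, hτ.eventually (lt_mem_nhds hpos)] with p' hp' hpos'
  refine Metric.hausdorffEDist_le_of_mem_edist ?_ ?_
  · rintro _ ⟨t, ht, rfl⟩
    have hs : t / τ p' ∈ Icc (0 : ℝ) 1 :=
      ⟨div_nonneg ht.1 hpos'.le, (div_le_one hpos').2 ht.2⟩
    refine ⟨_, ⟨t / τ p' * τ p, ⟨mul_nonneg hs.1 hpos.le, by nlinarith [hs.2]⟩, rfl⟩, ?_⟩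
    have := hp' _ hs
    rw [div_mul_cancel₀ _ hpos'.ne'] at this
    exact this.le
  · rintro _ ⟨t, ht, rfl⟩
    have hs : t / τ p ∈ Icc (0 : ℝ) 1 :=
      ⟨div_nonneg ht.1 hpos.le, (div_le_one hpos).2 ht.2⟩
    refine ⟨_, ⟨t / τ p * τ p', ⟨mul_nonneg hs.1 hpos'.le, by nlinarith [hs.2]⟩, rfl⟩, ?_⟩
    have := hp' _ hs
    rw [div_mul_cancel₀ _ hpos.ne'] at this
    rw [edist_comm]
    exact this.le

/-- The path of a single arc. -/
def arcPath (m : E → Perturbation) (i : Zone) (x : ℝ) (p : E × ℝ) (t : ℝ) : ℝ × ℝ :=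
  ((m p.1).coeffs i).flow t (x, p.2)

theorem AnalyticFamily.contDiff_arcPath (hm : AnalyticFamily m) (i : Zone) (x : ℝ) :
    ContDiff ℝ ω (Function.uncurry (arcPath m i x)) :=
  (hm i).contDiff_flow.comp ((contDiff_fst.comp contDiff_fst).prodMk (contDiff_snd.prodMk
      (contDiff_const.prodMk (contDiff_snd.comp contDiff_fst))) :
    ContDiff ℝ ω fun v : (E × ℝ) × ℝ => (v.1.1, v.2, (x, v.1.2)))

theorem Perturbation.IsArc.transition (hm : AnalyticFamily m) {i : Zone} {x x' y₀ : ℝ}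
    {τ : E × ℝ → ℝ} (hτ : ContDiffAt ℝ ω τ (0, y₀))
    (h : ∀ᶠ p : E × ℝ in 𝓝 (0, y₀),
      (m p.1).IsArc i (x, p.2) (x', (arcPath m i x p (τ p)).2) (τ p)) (c : ℝ) :
    Transition m c i i x x' y₀ (fun p => (arcPath m i x p (τ p)).2) τ (arcPath m i x) where
  contDiffAt := by
    have h1 := (hm.contDiff_arcPath i x).contDiffAt.comp (0, y₀)
      (contDiffAt_id.prodMk hτ : ContDiffAt ℝ ω (fun p : E × ℝ => (p, τ p)) (0, y₀))
    exact contDiffAt_snd.comp _ h1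
  gap_start := h.self_of_nhds.gap_start
  path := by
    filter_upwards [h] with p hp
    exact ⟨hp.pos, PertCoeffs.flow_zero _ _, hp.exit, hp.pathOn⟩
  avoid := by
    filter_upwards [h] with p hp t ht h1
    have hin := hp.inside t ht
    change (((m p.1).coeffs i).flow t (x, p.2)).1 = 1 ∧ _ at h1
    rw [h1.1] at hin
    cases i <;> norm_num [Zone.gap] at hin
  near := by
    filter_upwards [h, hτ.eventually (by simp)] with p hp hτp
    exact tendsto_hausdorffEDist_image (hm.contDiff_arcPath i x).continuous hτp.continuousAt hp.pos
  hits := by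
    filter_upwards [h] with p hp O hO
    refine ⟨fun t ht => ?_, ?_, ?_⟩
    · have h1 := hp.hits hO (Ioo_subset_Icc_self ht)
      have h2 : ContinuousAt (fun q : ℝ × ℝ => i.gap q.1) (arcPath m i x p t) :=
        (i.continuous_gap.comp continuous_fst).continuousAt
      filter_upwards [h1, h2.eventually (lt_mem_nhds (hp.inside t ht))] with q hq hq'
      exact hq (le_of_lt hq')
    · have h1 := hp.hits hO (t := 0) ⟨le_rfl, hp.pos.le⟩
      rwa [PertCoeffs.flow_zero] at h1
    · have h1 := hp.hits hO (t := τ p) ⟨hp.pos.le, le_rfl⟩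
      rwa [hp.exit] at h1

/-- Composition of transitions. -/
theorem Transition.comp {i j i' j' : Zone} {x x' x'' y₀ y₁ : ℝ} {Y₁ τ₁ Y₂ τ₂ : E × ℝ → ℝ}
    {φ₁ φ₂ : E × ℝ → ℝ → ℝ × ℝ} (h₁ : Transition m c i j x x' y₀ Y₁ τ₁ φ₁)
    (h₂ : Transition m c i' j' x' x'' y₁ Y₂ τ₂ φ₂) (hy : Y₁ (0, y₀) = y₁)
    (hcover : ∀ᶠ a in 𝓝 x', 0 ≤ j.gap a ∨ 0 ≤ i'.gap a) (hsec : x' ≠ 1 ∨ y₁ < c) :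
    Transition m c i j' x x'' y₀ (fun p => Y₂ (p.1, Y₁ p)) (fun p => τ₁ p + τ₂ (p.1, Y₁ p))
      (fun p => concat (φ₁ p) (φ₂ (p.1, Y₁ p)) (τ₁ p)) := by
  subst hy
  have hn : ContDiffAt ℝ ω (fun p : E × ℝ => (p.1, Y₁ p)) (0, y₀) :=
    contDiffAt_fst.prodMk h₁.contDiffAt
  have hnc : Tendsto (fun p : E × ℝ => (p.1, Y₁ p)) (𝓝 (0, y₀)) (𝓝 (0, Y₁ (0, y₀))) :=
    hn.continuousAt
  have hj : ∀ᶠ p : E × ℝ in 𝓝 (0, y₀), φ₁ p (τ₁ p) = φ₂ (p.1, Y₁ p) 0 := by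
    filter_upwards [h₁.path, hnc.eventually h₂.path] with p hp1 hp2
    rw [hp1.2.2.1, hp2.2.1]
  refine ⟨ContDiffAt.comp (0, y₀) h₂.contDiffAt hn, h₁.gap_start, ?_, ?_, ?_, ?_⟩
  · filter_upwards [h₁.path, hnc.eventually h₂.path, hj] with p hp1 hp2 hpj
    refine ⟨add_pos hp1.1 hp2.1, ?_, ?_, hp1.2.2.2.concat hp2.2.2.2 hpj⟩
    · rw [concat_of_le hp1.1.le, hp1.2.1]
    · rw [concat_of_ge hpj (by linarith [hp2.1]), add_sub_cancel_left, hp2.2.2.1]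
  · have hsec' : ∀ᶠ p : E × ℝ in 𝓝 (0, y₀), ¬ (x' = 1 ∧ c ≤ Y₁ p) := by
      rcases hsec with h | h
      · exact Eventually.of_forall fun p hp => h hp.1
      · filter_upwards [h₁.contDiffAt.continuousAt.eventually (gt_mem_nhds h)] with p hp hp'
        linarith [hp'.2]
    filter_upwards [h₁.path, hnc.eventually h₂.path, hj, h₁.avoid, hnc.eventually h₂.avoid,
      hsec'] with p hp1 hp2 hpj ha1 ha2 hs t ht
    rcases lt_trichotomy t (τ₁ p) with h | h | h
    · rw [concat_of_le h.le]; exact ha1 t ⟨ht.1, h⟩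
    · rw [h, concat_of_le le_rfl, hp1.2.2.1]; exact hs
    · rw [concat_of_ge hpj h.le]; exact ha2 _ ⟨by linarith, by linarith [ht.2]⟩
  · filter_upwards [h₁.path.eventually_nhds, (hnc.eventually h₂.path).eventually_nhds,
      hj.eventually_nhds, h₁.near, hnc.eventually h₂.near, hn.eventually (by simp)]
      with p hp1 hp2 hpj hn1 hn2 hcp
    have himg : ∀ᶠ p' : E × ℝ in 𝓝 p, concat (φ₁ p') (φ₂ (p'.1, Y₁ p')) (τ₁ p') ''
        Icc 0 (τ₁ p' + τ₂ (p'.1, Y₁ p')) = φ₁ p' '' Icc 0 (τ₁ p') ∪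
          φ₂ (p'.1, Y₁ p') '' Icc 0 (τ₂ (p'.1, Y₁ p')) := by
      filter_upwards [hp1, hp2, hpj] with p' h1 h2 h3
      exact concat_image h1.1.le h2.1.le h3
    have hmax := hn1.max (hn2.comp hcp.continuousAt.tendsto)
    rw [max_self] at hmax
    refine tendsto_of_tendsto_of_tendsto_of_le_of_le' tendsto_const_nhds hmax
      (Eventually.of_forall fun _ => zero_le) ?_
    filter_upwards [himg] with p' hp'
    rw [hp', himg.self_of_nhds]
    exact Metric.hausdorffEDist_union_le
  · have hcov : ∀ y, ∀ᶠ q : ℝ × ℝ in 𝓝 (x', y), 0 ≤ j.gap q.1 ∨ 0 ≤ i'.gap q.1 := fun y =>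
      (continuous_fst.continuousAt (x := (x', y))).eventually hcover
    filter_upwards [h₁.path, hnc.eventually h₂.path, hj, h₁.hits, hnc.eventually h₂.hits]
      with p hp1 hp2 hpj hh1 hh2 O hO
    obtain ⟨ha2, hb2, hc2⟩ := hh2 O hO
    set A := {z : ℝ × ℝ | z ∈ O ∧ z.1 = x''} with hA
    obtain ⟨ha1, hb1, hc1⟩ := hh1 {z | 0 ≤ i'.gap z.1 → (m p.1).toField.Hits A z} hb2
    have hchain : ∀ z ∈ {z : ℝ × ℝ | z ∈ {z : ℝ × ℝ | 0 ≤ i'.gap z.1 →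
        (m p.1).toField.Hits A z} ∧ z.1 = x'}, (m p.1).toField.Hits A z := fun z hz =>
      hz.1 (by rw [hz.2, h₂.gap_start])
    refine ⟨fun t ht => ?_, ?_, ?_⟩
    · rcases lt_trichotomy t (τ₁ p) with h | h | h
      · rw [concat_of_le h.le]
        filter_upwards [ha1 t ⟨ht.1, h⟩] with q hq using hq.trans hchain
      · rw [h, concat_of_le le_rfl, hp1.2.2.1]
        filter_upwards [hb2, hc1, hcov (Y₁ p)] with q hq1 hq2 hq3
        rcases hq3 with h | h
        · exact (hq2 h).trans hchain
        · exact hq1 h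
      · rw [concat_of_ge hpj h.le]
        exact ha2 _ ⟨by linarith, by linarith [ht.2]⟩
    · filter_upwards [hb1] with q hq hq0 using (hq hq0).trans hchain
    · exact hc2

end

/-! ### Limit cycles from isolated fixed points of the return map -/

section

/-- A closed path whose start lies on the section `{1} × [c, ∞)` and whose interior avoids the
section is a periodic orbit. -/
theorem PWField.PathOn.isPeriodicOrbit {Z : PWField} {φ : ℝ → ℝ × ℝ} {b c y : ℝ}
    (h : Z.PathOn φ b) (hb : 0 < b) (h0 : φ 0 = (1, y)) (h1 : φ b = (1, y)) (hc : c ≤ y)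
    (havoid : ∀ t ∈ Ioo 0 b, ¬ ((φ t).1 = 1 ∧ c ≤ (φ t).2)) :
    Z.IsPeriodicOrbit (φ '' Icc 0 b) := by
  have hcl : φ b = φ 0 := h1.trans h0.symm
  refine ⟨periodize φ hb, b, hb, h.isCrossingSolution hb hcl, periodize_periodic φ hb,
    ⟨b / 2, fun heq => ?_⟩, (range_periodize hb hcl).symm⟩
  have hmem : b / 2 ∈ Ioo 0 b := ⟨by linarith, by linarith⟩
  rw [periodize_of_mem hb hcl (Ioo_subset_Icc_self hmem),
    periodize_of_mem hb hcl ⟨le_rfl, hb.le⟩, h0] at heq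
  exact havoid _ hmem (by rw [heq]; exact ⟨rfl, hc⟩)

/-- An isolated fixed point of an increasing return map gives a limit cycle. A periodic orbit `Γ'`
near the closed path meets the section in a nonempty compact set near `y₀` that is invariant under
the return map; such a set contains `y₀`. -/
theorem isLimitCycle_of_isolated_fixedPoint {Z : PWField} (hZ : Z.Lipschitz) {c y₀ r : ℝ}
    {φ : ℝ → ℝ → ℝ × ℝ} {τ Y : ℝ → ℝ} (hr : 0 < r)
    (hpath : ∀ y, |y - y₀| < r → 0 < τ y ∧ φ y 0 = (1, y) ∧ φ y (τ y) = (1, Y y) ∧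
      Z.PathOn (φ y) (τ y))
    (hcont : ∀ y, |y - y₀| < r → ContinuousAt Y y)
    (hmono : ∀ y y', |y - y₀| < r → |y' - y₀| < r → y < y' → Y y < Y y')
    (hc : ∀ y, |y - y₀| < r → c ≤ y ∧ c ≤ Y y)
    (hfix : ∀ y, |y - y₀| < r → (Y y = y ↔ y = y₀))
    (havoid : ∀ t ∈ Ioo 0 (τ y₀), ¬ ((φ y₀ t).1 = 1 ∧ c ≤ (φ y₀ t).2))
    (hhits : ∀ t ∈ Icc 0 (τ y₀), ∀ᶠ q in 𝓝 (φ y₀ t),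
      Z.Hits {z | z ∈ {z : ℝ × ℝ | |z.2 - y₀| < r} ∧ z.1 = 1 } q) :
    Z.IsLimitCycle (φ y₀ '' Icc 0 (τ y₀)) := by
  have hy₀ : |y₀ - y₀| < r := by simpa using hr
  obtain ⟨hτ, hs, he, hp⟩ := hpath y₀ hy₀
  rw [(hfix y₀ hy₀).2 rfl] at he
  refine ⟨hp.isPeriodicOrbit hτ hs he (hc y₀ hy₀).1 havoid, ?_⟩
  set A : Set (ℝ × ℝ) := {z | z ∈ {z : ℝ × ℝ | |z.2 - y₀| < r} ∧ z.1 = 1} with hA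
  set B : Set (ℝ × ℝ) := {z | z.1 = 1 ∧ c ≤ z.2 ∧ r / 2 ≤ |z.2 - y₀|} with hB
  have hBc : IsClosed B :=
    (isClosed_eq continuous_fst continuous_const).inter
      ((isClosed_le continuous_const continuous_snd).inter
        (isClosed_le continuous_const (continuous_snd.sub continuous_const).abs))
  refine ⟨{q | ∀ᶠ q' in 𝓝 q, Z.Hits A q'} ∩ Bᶜ,
    isOpen_setOfPred_eventually_nhds.inter hBc.isOpen_compl, ?_, ?_⟩
  · rintro _ ⟨t, ht, rfl⟩
    refine ⟨hhits t ht, fun hBt => ?_⟩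
    have hnot : ¬ (φ y₀ t = (1, y₀)) := fun h => by
      have := hBt.2.2
      rw [h, sub_self, abs_zero] at this
      linarith
    rcases eq_or_lt_of_le ht.1 with h | h
    · exact hnot (h ▸ hs)
    rcases eq_or_lt_of_le ht.2 with h' | h'
    · exact hnot (h' ▸ he)
    · exact havoid t ⟨h, h'⟩ ⟨hBt.1, hBt.2.1⟩
  rintro _ ⟨γ, T, hT, hγ, hγT, -, rfl⟩ hU
  -- the section ordinates of the periodic orbit
  set K : Set ℝ := {y | c ≤ y ∧ (1, y) ∈ range γ} with hK
  have hKr : ∀ y ∈ K, |y - y₀| < r / 2 := fun y hy => by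
    by_contra hcon
    exact (hU hy.2).2 ⟨rfl, hy.1, not_lt.1 hcon⟩
  have hKr' : ∀ y ∈ K, |y - y₀| < r := fun y hy => (hKr y hy).trans (by linarith)
  have hKc : IsCompact K := by
    have hcl : IsClosed K := isClosed_Ici.inter
      ((hγT.compact_of_continuous hT.ne' hγ.continuous).isClosed.preimage
        (Continuous.prodMk_right (1 : ℝ)))
    refine (isCompact_Icc (a := y₀ - r / 2) (b := y₀ + r / 2)).of_isClosed_subset hcl
      fun y hy => ?_
    have := abs_lt.1 (hKr y hy)
    exact ⟨by linarith, by linarith⟩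
  have hKY : ∀ y ∈ K, Y y ∈ K := by
    rintro y ⟨hcy, t, ht⟩
    have hy := hKr' y ⟨hcy, t, ht⟩
    obtain ⟨h1, h2, h3, h4⟩ := hpath y hy
    refine ⟨(hc y hy).2, t + τ y, ?_⟩
    rw [hγ.follows hZ h4.continuousOn h4.departs (ht.trans h2.symm) _ ⟨h1.le, le_rfl⟩, h3]
  have hKne : K.Nonempty := by
    obtain ⟨s, hs1, hs2⟩ := (hU ⟨0, rfl⟩).1.self_of_nhds γ hγ 0 rfl
    exact ⟨(γ s).2, (hc _ hs1).1, s, Prod.ext hs2 rfl⟩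
  have hmem : y₀ ∈ K := by
    by_contra hnot
    obtain ⟨y, hy⟩ := hKne
    have hne : ∀ z ∈ K, Y z ≠ z := fun z hz h =>
      hnot ((hfix z (hKr' z hz)).1 h ▸ hz)
    -- no fixed point may lie between two points of `K` on the same side of `y₀`
    have hivt : ∀ a b, a ∈ K → b ∈ K → a ≤ b → (b < y₀ ∨ y₀ < a) → a < Y a → Y b < b → False := by
      intro a b ha hb hab hside hYa hYb
      have hin : ∀ z ∈ Icc a b, |z - y₀| < r := fun z hz => by
        have h1 := abs_lt.1 (hKr' a ha)
        have h2 := abs_lt.1 (hKr' b hb)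
        rw [abs_lt]; constructor <;> linarith [hz.1, hz.2]
      have hco : ContinuousOn (fun z => Y z - z) (Icc a b) := fun z hz =>
        ((hcont z (hin z hz)).sub continuousAt_id).continuousWithinAt
      obtain ⟨z, hz, hz0⟩ := intermediate_value_Icc' hab hco
        (show (0 : ℝ) ∈ Icc (Y b - b) (Y a - a) from ⟨by linarith, by linarith⟩)
      have := (hfix z (hin z hz)).1 (by linarith [hz0])
      rcases hside with h | h <;> linarith [hz.1, hz.2]
    rcases lt_or_gt_of_ne (fun h : y = y₀ => hnot (h ▸ hy)) with hlt | hgt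
    · have hK' : IsCompact (K ∩ Iic y₀) := hKc.inter_right isClosed_Iic
      obtain ⟨b, ⟨hb, hby⟩, hbmax⟩ := hK'.exists_isGreatest ⟨y, hy, hlt.le⟩
      obtain ⟨a, ha, hamin⟩ := hKc.exists_isLeast ⟨y, hy⟩
      have hby : b < y₀ := lt_of_le_of_ne hby fun h => hnot (h ▸ hb)
      refine hivt a b ha hb (hamin hb) (Or.inl hby)
        (lt_of_le_of_ne (hamin (hKY a ha)) (hne a ha).symm) (lt_of_le_of_ne ?_ (hne b hb))
      refine hbmax ⟨hKY b hb, ?_⟩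
      rw [mem_Iic, ← (hfix y₀ hy₀).2 rfl]
      exact (hmono b y₀ (hKr' b hb) hy₀ hby).le
    · have hK' : IsCompact (K ∩ Ici y₀) := hKc.inter_right isClosed_Ici
      obtain ⟨a, ⟨ha, hay⟩, hamin⟩ := hK'.exists_isLeast ⟨y, hy, hgt.le⟩
      obtain ⟨b, hb, hbmax⟩ := hKc.exists_isGreatest ⟨y, hy⟩
      have hay : y₀ < a := lt_of_le_of_ne hay fun h => hnot (h ▸ ha)
      refine hivt a b ha hb (hbmax ha) (Or.inr hay) (lt_of_le_of_ne ?_ (hne a ha).symm)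
        (lt_of_le_of_ne (hbmax (hKY b hb)) (hne b hb))
      refine hamin ⟨hKY a ha, ?_⟩
      rw [mem_Ici, ← (hfix y₀ hy₀).2 rfl]
      exact (hmono y₀ a hy₀ (hKr' a ha) hay).le
  obtain ⟨-, t, ht⟩ := hmem
  have hcl : φ y₀ (τ y₀) = φ y₀ 0 := he.trans hs.symm
  rw [← range_periodize hτ hcl]
  refine range_eq_of_common_point hZ hγ (hp.isCrossingSolution hτ hcl) hT hτ hγT
    (periodize_periodic _ hτ) (s := t) (s' := 0) ?_
  rw [ht, periodize_of_mem hτ hcl ⟨le_rfl, hτ.le⟩, hs]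

variable {E : Type*} [NormedAddCommGroup E] [NormedSpace ℝ E]

variable {m : E → Perturbation} {c : ℝ}

/-- A box of parameters and ordinates on which a return map close to the identity is well
behaved. -/
theorem Transition.exists_box {h₀ : ℝ} {Y τ : E × ℝ → ℝ} {φ : E × ℝ → ℝ → ℝ × ℝ}
    (ht : Transition m c .R .C 1 1 h₀ Y τ φ) (hc : c < h₀) (hid : ∀ᶠ y in 𝓝 h₀, Y (0, y) = y) :
    ∃ ρ > 0, (∀ e y, ‖e‖ < ρ → |y - h₀| < ρ →
      (0 < τ (e, y) ∧ φ (e, y) 0 = (1, y) ∧ φ (e, y) (τ (e, y)) = (1, Y (e, y)) ∧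
        (m e).toField.PathOn (φ (e, y)) (τ (e, y))) ∧
      (∀ t ∈ Ioo 0 (τ (e, y)), ¬ ((φ (e, y) t).1 = 1 ∧ c ≤ (φ (e, y) t).2)) ∧
      Tendsto (fun p' => Metric.hausdorffEDist (φ p' '' Icc 0 (τ p'))
        (φ (e, y) '' Icc 0 (τ (e, y)))) (𝓝 (e, y)) (𝓝 0) ∧
      (Y (e, y) = y → ∀ O ∈ 𝓝 (1, y), ∀ t ∈ Icc 0 (τ (e, y)), ∀ᶠ q in 𝓝 (φ (e, y) t),
        (m e).toField.Hits {z | z ∈ O ∧ z.1 = 1} q) ∧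
      ContDiffAt ℝ ω Y (e, y) ∧ c ≤ y ∧ c ≤ Y (e, y)) ∧
      (∀ e y y', ‖e‖ < ρ → |y - h₀| < ρ → |y' - h₀| < ρ → y < y' → Y (e, y) < Y (e, y')) ∧
      ∀ y, |y - h₀| < ρ → Y (0, y) = y := by
  have hY0 : Y (0, h₀) = h₀ := hid.self_of_nhds
  have hYc := ht.contDiffAt.continuousAt
  have hcy : ∀ᶠ p : E × ℝ in 𝓝 (0, h₀), c ≤ p.2 ∧ c ≤ Y p :=
    ((continuous_snd.continuousAt (x := ((0 : E), h₀))).eventually (lt_mem_nhds hc)).and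
      (hYc.eventually (lt_mem_nhds (by rwa [hY0]))) |>.mono fun p hp => ⟨hp.1.le, hp.2.le⟩
  have hstr := ht.contDiffAt.hasStrictFDerivAt (by simp)
  set L := fderiv ℝ Y (0, h₀) with hL
  have hL1 : L (0, 1) = 1 := by
    have h1 : HasDerivAt (fun y : ℝ => ((0 : E), y)) ((0 : E), (1 : ℝ)) h₀ :=
      (hasDerivAt_const h₀ (0 : E)).prodMk (hasDerivAt_id h₀)
    have h2 := hstr.hasFDerivAt.comp_hasDerivAt h₀ h1
    have h3 : HasDerivAt (Y ∘ fun y : ℝ => ((0 : E), y)) 1 h₀ :=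
      (hasDerivAt_id h₀).congr_of_eventuallyEq hid
    exact h2.unique h3
  have hlo := hstr.isLittleO.def (c := 1 / 2) (by norm_num)
  rw [nhds_prod_eq (x := ((0 : E), h₀)) (y := ((0 : E), h₀))] at hlo
  obtain ⟨pa, ha, pb, hb, hab⟩ := eventually_prod_iff.1 hlo
  have hid' : ∀ᶠ p : E × ℝ in 𝓝 (0, h₀), Y (0, p.2) = p.2 :=
    (continuous_snd.continuousAt (x := ((0 : E), h₀))).eventually hid
  have hall := (ht.path.and (ht.avoid.and (ht.near.and (ht.hits.and
    ((ht.contDiffAt.eventually (by simp)).and hcy))))).and ((ha.and hb).and hid')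
  obtain ⟨ρ, hρ, hall⟩ := Metric.eventually_nhds_iff.1 hall
  have hdist : ∀ e y, ‖e‖ < ρ → |y - h₀| < ρ → dist (e, y) ((0 : E), h₀) < ρ := fun e y he hy => by
    rw [Prod.dist_eq, dist_zero_right, Real.dist_eq]; exact max_lt he hy
  refine ⟨ρ, hρ, fun e y he hy => ?_, fun e y y' he hy hy' hlt => ?_, fun y hy => ?_⟩
  · obtain ⟨⟨hpath, hav, hnear, hhits, hcd, hcc⟩, -⟩ := hall (hdist e y he hy)
    refine ⟨hpath, hav, hnear, fun hfix O hO t htt => ?_, hcd, hcc⟩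
    obtain ⟨h1, h2, h3⟩ := hhits O (by rw [hfix]; exact hO)
    rw [hfix] at h3
    have hends : ∀ᶠ q in 𝓝 ((1 : ℝ), y), (m e).toField.Hits {z | z ∈ O ∧ z.1 = 1} q := by
      filter_upwards [h2, h3, (continuous_fst.continuousAt (x := ((1 : ℝ), y))).eventually
        (lt_mem_nhds (show (0 : ℝ) < 1 by norm_num))] with q h2 h3 hq0
      rcases le_total 1 q.1 with h | h
      · exact h2 (by simp only [Zone.gap]; linarith)
      · exact h3 (by simp only [Zone.gap]; nlinarith)
    rcases eq_or_lt_of_le htt.1 with h | h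
    · rw [← h, hpath.2.1]; exact hends
    rcases eq_or_lt_of_le htt.2 with h' | h'
    · rw [h', hpath.2.2.1, hfix]; exact hends
    · exact h1 t ⟨h, h'⟩
  · have h := hab (hall (hdist e y' he hy')).2.1.1 (hall (hdist e y he hy)).2.1.2
    simp only at h
    have h1 : ((e, y') : E × ℝ) - (e, y) = (y' - y) • ((0 : E), (1 : ℝ)) := by
      ext <;> simp
    rw [h1, map_smul, hL1, norm_smul] at h
    simp only [smul_eq_mul, mul_one, Real.norm_eq_abs, Prod.norm_def, norm_zero, norm_one] at h
    rw [max_eq_right zero_le_one, mul_one, abs_of_pos (sub_pos.2 hlt)] at h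
    have := (abs_le.1 h).1
    linarith
  · have := (hall (hdist 0 y (by simpa using hρ) hy)).2.2
    exact this

theorem exists_tendsto_of_eventually_exists {Q : ℝ → ℝ → Prop} {h : ℝ}
    (hQ : ∀ η > 0, ∀ᶠ e in 𝓝[>] (0 : ℝ), ∃ y, |y - h| < η ∧ Q e y) :
    ∃ y : ℝ → ℝ, Tendsto y (𝓝[>] 0) (𝓝 h) ∧ ∀ᶠ e in 𝓝[>] (0 : ℝ), Q e (y e) := by
  classical
  have hch : ∀ e : ℝ, ∃ y, 0 < e → (∃ y, Q e y) →
      Q e y ∧ ∀ y', Q e y' → |y - h| < |y' - h| + e := by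
    intro e
    by_cases he : 0 < e ∧ ∃ y, Q e y
    · obtain ⟨he, hne⟩ := he
      have hne' : ((fun y => |y - h|) '' {y | Q e y}).Nonempty := Set.Nonempty.image _ hne
      obtain ⟨_, ⟨y, hy, rfl⟩, hlt⟩ := Real.lt_sInf_add_pos hne' he
      refine ⟨y, fun _ _ => ⟨hy, fun y' hy' => hlt.trans_le ?_⟩⟩
      gcongr
      exact csInf_le ⟨0, by rintro _ ⟨z, -, rfl⟩; exact abs_nonneg _⟩ ⟨y', hy', rfl⟩
    · exact ⟨0, fun h1 h2 => absurd ⟨h1, h2⟩ he⟩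
  choose y hy using hch
  refine ⟨y, ?_, ?_⟩
  · rw [Metric.tendsto_nhds]
    intro η hη
    filter_upwards [hQ (η / 2) (by linarith), self_mem_nhdsWithin,
      nhdsWithin_le_nhds (Iio_mem_nhds (show (0 : ℝ) < η / 2 by linarith))]
      with e ⟨z, hz, hQz⟩ he he'
    rw [Real.dist_eq]
    have := (hy e he ⟨z, hQz⟩).2 z hQz
    rw [mem_Iio] at he'
    linarith
  · filter_upwards [hQ 1 one_pos, self_mem_nhdsWithin] with e ⟨z, _, hQz⟩ he
    exact (hy e he ⟨z, hQz⟩).1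

/-- Bifurcation from sign changes of the displacement: near an annulus orbit with a return map, if
the displacement `Y (e, ·) - id` for small `e > 0` takes both signs arbitrarily close to each of the
ordinates `h i`, then a limit cycle bifurcates from each of the corresponding orbits. -/
theorem Transition.limitCyclesBifurcate {S : HamSystem} {J : Set ℝ}
    (hJ : ∀ h ∈ J, ∃ (γ : ℝ → ℝ × ℝ) (T : ℝ), S.unperturbed.IsAnnulusOrbit γ T h)
    (hS : S.unperturbed = (m 0).toField) {h₀ : ℝ} {Y τ : E × ℝ → ℝ} {φ : E × ℝ → ℝ → ℝ × ℝ}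
    (ht : Transition m c .R .C 1 1 h₀ Y τ φ) (hc : c < h₀) (hid : ∀ᶠ y in 𝓝 h₀, Y (0, y) = y) :
    ∃ ρ > 0, ∀ (P : ℝ → Perturbation) (θ : ℝ → E), Tendsto θ (𝓝[>] 0) (𝓝 0) →
      (∀ᶠ e in 𝓝[>] (0 : ℝ), S.perturbed (P e) e = (m (θ e)).toField) →
      ∀ (n : ℕ) (h : Fin n → ℝ), Function.Injective h →
      (∀ i, h i ∈ J ∧ |h i - h₀| < ρ) →
      (∀ i, ∀ η > 0, ∃ a b, |a - h i| < η ∧ |b - h i| < η ∧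
        ∀ᶠ e in 𝓝[>] (0 : ℝ), a < Y (θ e, a) ∧ Y (θ e, b) < b) →
      S.LimitCyclesBifurcate J P n := by
  obtain ⟨ρ, hρ, hbox, hmono, hid⟩ := ht.exists_box hc hid
  refine ⟨ρ, hρ, fun P θ hθ hP n h hinj hh hsign => ?_⟩
  have hann : ∀ i, ∃ γT : (ℝ → ℝ × ℝ) × ℝ, S.unperturbed.IsAnnulusOrbit γT.1 γT.2 (h i) :=
    fun i => let ⟨γ, T, hγ⟩ := hJ (h i) (hh i).1; ⟨(γ, T), hγ⟩
  choose γT hγT using hann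
  have hsmall : ∀ᶠ e in 𝓝[>] (0 : ℝ), ‖θ e‖ < ρ := by
    filter_upwards [hθ.eventually (Metric.ball_mem_nhds (0 : E) hρ)] with e he
    simpa using he
  -- fixed points near `h i`, together with a witness that the displacement is not identically zero
  set Q : ℝ → ℝ → Prop := fun e y => |y - h₀| < ρ ∧ Y (θ e, y) = y ∧
    ∃ a, |a - h₀| < ρ ∧ Y (θ e, a) ≠ a with hQ
  have hex : ∀ i, ∀ η > 0, ∀ᶠ e in 𝓝[>] (0 : ℝ), ∃ y, |y - h i| < η ∧ Q e y := by
    intro i η hη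
    obtain ⟨a, b, ha, hb, hab⟩ := hsign i (min η (ρ - |h i - h₀|))
      (lt_min hη (sub_pos.2 (hh i).2))
    filter_upwards [hab, hsmall] with e he heρ
    have hball : ∀ z ∈ uIcc a b, |z - h i| < min η (ρ - |h i - h₀|) := fun z hz => by
      have h1 : uIcc a b ⊆ Metric.ball (h i) (min η (ρ - |h i - h₀|)) := by
        rw [← segment_eq_uIcc]
        exact (convex_ball _ _).segment_subset (by simpa [Real.dist_eq] using ha)
          (by simpa [Real.dist_eq] using hb)
      simpa [Real.dist_eq] using h1 hz
    have hballρ : ∀ z ∈ uIcc a b, |z - h₀| < ρ := fun z hz => by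
      have h1 := (hball z hz).trans_le (min_le_right _ _)
      have h2 := abs_sub_le z (h i) h₀
      linarith
    have hco : ContinuousOn (fun z => Y (θ e, z) - z) (uIcc a b) := fun z hz =>
      (ContinuousAt.sub (ContinuousAt.comp (f := fun z : ℝ => (θ e, z))
        (hbox (θ e) z heρ (hballρ z hz)).2.2.2.2.1.continuousAt
        (continuous_const.prodMk continuous_id).continuousAt) continuousAt_id).continuousWithinAt
    obtain ⟨z, hz, hz0⟩ := intermediate_value_uIcc hco
      (show (0 : ℝ) ∈ uIcc (Y (θ e, a) - a) (Y (θ e, b) - b) by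
        rw [uIcc_of_ge (by linarith [he.1, he.2])]
        exact ⟨by linarith [he.2], by linarith [he.1]⟩)
    exact ⟨z, (hball z hz).trans_le (min_le_left _ _), hballρ z hz, by linarith [hz0],
      a, hballρ a left_mem_uIcc, he.1.ne'⟩
  choose y hyt hyQ using fun i => exists_tendsto_of_eventually_exists (hex i)
  refine ⟨h, fun i => (γT i).1, fun i => (γT i).2,
    fun i e => φ (θ e, y i e) '' Icc 0 (τ (θ e, y i e)),
    hinj, fun i => ⟨(hh i).1, hγT i⟩, ?_, fun i => ?_⟩
  · have hdist : ∀ᶠ e in 𝓝[>] (0 : ℝ), ∀ i j, i ≠ j → y i e ≠ y j e := by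
      refine eventually_all.2 fun i => eventually_all.2 fun j => ?_
      by_cases hij : i = j
      · exact Eventually.of_forall fun e hne => absurd hij hne
      · have := ((hyt i).sub (hyt j)).eventually_ne (sub_ne_zero.2 fun h' => hij (hinj h'))
        filter_upwards [this] with e he _ using sub_ne_zero.1 he
    filter_upwards [eventually_all.2 hyQ, hdist, hsmall, hP] with e heQ hed heρ heP
    refine ⟨fun i j hij => ?_, fun i => ?_⟩
    · by_contra hne
      obtain ⟨⟨hi1, hi2, hi3, hi4⟩, -, -, -, -, hci, -⟩ := hbox (θ e) (y i e) heρ (heQ i).1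
      obtain ⟨⟨hj1, hj2, hj3, hj4⟩, hav, -⟩ := hbox (θ e) (y j e) heρ (heQ j).1
      have hmem : (1, y i e) ∈ φ (θ e, y j e) '' Icc 0 (τ (θ e, y j e)) := by
        simp only at hij
        rw [← hij]; exact ⟨0, ⟨le_rfl, hi1.le⟩, hi2⟩
      obtain ⟨t, htt, hteq⟩ := hmem
      have hnot : ¬ ((1, y i e) : ℝ × ℝ) = (1, y j e) := fun h => hed i j hne (Prod.ext_iff.1 h).2
      rcases eq_or_lt_of_le htt.1 with h1 | h1
      · exact hnot (by rw [← hteq, ← h1, hj2])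
      rcases eq_or_lt_of_le htt.2 with h2 | h2
      · exact hnot (by rw [← hteq, h2, hj3, (heQ j).2.1])
      · exact hav t ⟨h1, h2⟩ (by rw [hteq]; exact ⟨rfl, hci⟩)
    · rw [heP]
      obtain ⟨hy1, hy2, a, haρ, hane⟩ := heQ i
      -- the displacement is analytic and not identically zero, so its zeros are isolated
      set I := Ioo (h₀ - ρ) (h₀ + ρ) with hI
      have hmemI : ∀ z, z ∈ I ↔ |z - h₀| < ρ := fun z => by
        rw [abs_lt, hI, mem_Ioo]; constructor <;> rintro ⟨h1, h2⟩ <;> constructor <;> linarith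
      have han : AnalyticOnNhd ℝ (fun z => Y (θ e, z) - z) I := fun z hz => by
        have h1 : ContDiffAt ℝ ω (fun z : ℝ => (θ e, z)) z := contDiffAt_const.prodMk contDiffAt_id
        have h2 : ContDiffAt ℝ ω (fun z : ℝ => Y (θ e, z) - z) z :=
          (ContDiffAt.comp z (hbox (θ e) z heρ ((hmemI z).1 hz)).2.2.2.2.1 h1).sub contDiffAt_id
        exact h2.analyticAt
      have hiso : ∀ᶠ z in 𝓝[≠] (y i e), Y (θ e, z) - z ≠ 0 := by
        by_contra hcon
        have hfr : ∃ᶠ z in 𝓝[≠] (y i e), Y (θ e, z) - z = 0 :=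
          (not_eventually.1 hcon).mono fun z hz => not_not.1 hz
        have := han.eqOn_zero_of_preconnected_of_frequently_eq_zero isPreconnected_Ioo
          ((hmemI _).2 hy1) hfr ((hmemI a).2 haρ)
        exact hane (sub_eq_zero.1 this)
      rw [eventually_nhdsWithin_iff] at hiso
      obtain ⟨r₁, hr₁, hiso⟩ := Metric.eventually_nhds_iff.1 hiso
      set r := min r₁ (ρ - |y i e - h₀|) with hr
      have hrpos : 0 < r := lt_min hr₁ (sub_pos.2 hy1)
      have hin : ∀ z, |z - y i e| < r → |z - h₀| < ρ := fun z hz => by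
        have h1 := hz.trans_le (min_le_right _ _)
        have h2 := abs_sub_le z (y i e) h₀
        linarith
      refine isLimitCycle_of_isolated_fixedPoint (m (θ e)).lipschitz_toField (c := c)
        (φ := fun z => φ (θ e, z)) (τ := fun z => τ (θ e, z)) (Y := fun z => Y (θ e, z)) hrpos
        (fun z hz => (hbox (θ e) z heρ (hin z hz)).1) (fun z hz => ?_)
        (fun z z' hz hz' => hmono (θ e) z z' heρ (hin z hz) (hin z' hz'))
        (fun z hz => (hbox (θ e) z heρ (hin z hz)).2.2.2.2.2) (fun z hz => ⟨fun hfix => ?_, ?_⟩)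
        (hbox (θ e) _ heρ hy1).2.1 ((hbox (θ e) _ heρ hy1).2.2.2.1 hy2 _ ?_)
      · exact ContinuousAt.comp (f := fun z : ℝ => (θ e, z))
          (hbox (θ e) z heρ (hin z hz)).2.2.2.2.1.continuousAt
          (continuous_const.prodMk continuous_id).continuousAt
      · by_contra hne
        exact hiso (by rw [Real.dist_eq]; exact hz.trans_le (min_le_left _ _)) hne
          (sub_eq_zero.2 hfix)
      · rintro rfl; exact hy2
      · have hco : Continuous fun z : ℝ × ℝ => |z.2 - y i e| :=
          (continuous_snd.sub continuous_const).abs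
        exact hco.continuousAt.eventually (gt_mem_nhds (by simpa using hrpos))
  · -- at the parameter `0` the closed path is the orbit of the annulus
    obtain ⟨hcs, hper, hstart, t₁, t₂, t₃, h1, h2, h3, h4, -⟩ := hγT i
    have hT : 0 < (γT i).2 := h1.trans (h2.trans (h3.trans h4))
    obtain ⟨⟨hp1, hp2, hp3, hp4⟩, -, hnear, -⟩ := hbox 0 (h i) (by simpa using hρ) (hh i).2
    have hcl : φ (0, h i) (τ (0, h i)) = φ (0, h i) 0 := by rw [hp3, hp2, hid _ (hh i).2]
    have hrange : range (γT i).1 = φ (0, h i) '' Icc 0 (τ (0, h i)) := by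
      rw [← range_periodize hp1 hcl]
      refine range_eq_of_common_point (m 0).lipschitz_toField (hS ▸ hcs)
        (hp4.isCrossingSolution hp1 hcl) hT hp1 hper (periodize_periodic _ hp1)
        (s := 0) (s' := 0) ?_
      rw [hstart, periodize_of_mem hp1 hcl ⟨le_rfl, hp1.le⟩, hp2]
    rw [hrange]
    refine hnear.comp ?_
    exact hθ.prodMk_nhds (hyt i)

end

/-! ### Energy, area and transition time of an arc -/

/-- Energy balance of `x'' = -D x + c + τ x'`. -/
theorem energy_balance {x V : ℝ → ℝ} {D c τ : ℝ} (hx : ∀ t, HasDerivAt x (V t) t)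
    (hV : ∀ t, HasDerivAt V (-D * x t + c + τ * V t) t) (T : ℝ) :
    V T ^ 2 - V 0 ^ 2 = -D * (x T ^ 2 - x 0 ^ 2) + 2 * c * (x T - x 0) +
      2 * τ * ∫ t in (0 : ℝ)..T, V t ^ 2 := by
  have hVc : Continuous V := continuous_iff_continuousAt.2 fun t => (hV t).continuousAt
  have hd : ∀ t ∈ uIcc 0 T,
      HasDerivAt (fun t => V t ^ 2 + D * x t ^ 2 - 2 * c * x t) (2 * τ * V t ^ 2) t := fun t _ => by
    have h := ((((hV t).pow 2).add (((hx t).pow 2).const_mul D)).sub ((hx t).const_mul (2 * c)))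
    exact h.congr_deriv (by push_cast; ring)
  have := intervalIntegral.integral_eq_sub_of_hasDerivAt hd
    ((continuous_const.mul (hVc.pow 2)).intervalIntegrable 0 T)
  rw [intervalIntegral.integral_const_mul] at this
  rw [this]
  ring

/-- The integral of the squared velocity (the area under the arc in the phase plane) for
`x'' = -D x + c`, in terms of the transition time. -/
theorem two_mul_integral_sq {x V : ℝ → ℝ} {D c : ℝ} (hD : D ≠ 0)
    (hx : ∀ t, HasDerivAt x (V t) t) (hV : ∀ t, HasDerivAt V (-D * x t + c) t) (T : ℝ) :
    2 * ∫ t in (0 : ℝ)..T, V t ^ 2 = x T * V T - x 0 * V 0 +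
      (V 0 ^ 2 + D * x 0 ^ 2 - 2 * c * x 0 + c ^ 2 / D) * T - c / D * (V T - V 0) := by
  have hVc : Continuous V := continuous_iff_continuousAt.2 fun t => (hV t).continuousAt
  have hE : ∀ t, V t ^ 2 + D * x t ^ 2 - 2 * c * x t = V 0 ^ 2 + D * x 0 ^ 2 - 2 * c * x 0 :=
    fun t => by
      have := energy_balance (D := D) (c := c) (τ := 0) hx (fun t => by simpa using hV t) t
      linarith
  have hd : ∀ t ∈ uIcc 0 T, HasDerivAt (fun t => x t * V t +
      (V 0 ^ 2 + D * x 0 ^ 2 - 2 * c * x 0 + c ^ 2 / D) * t - c / D * V t) (2 * V t ^ 2) t :=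
    fun t _ => by
      have h := (((hx t).mul (hV t)).add ((hasDerivAt_id t).const_mul
        (V 0 ^ 2 + D * x 0 ^ 2 - 2 * c * x 0 + c ^ 2 / D))).sub ((hV t).const_mul (c / D))
      refine h.congr_deriv ?_
      have := hE t
      rw [← this]
      field_simp
      ring
  have := intervalIntegral.integral_eq_sub_of_hasDerivAt hd
    ((continuous_const.mul (hVc.pow 2)).intervalIntegrable 0 T)
  rw [intervalIntegral.integral_const_mul] at this
  rw [this]
  ring

/-- The solutions of `S'' = -D S` with `S(0) = 0` and `S'(0) = 1`, that is the circular or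
hyperbolic sine with the proper frequency, and their derivative. -/
theorem exists_sin_cos (D : ℝ) : ∃ S C : ℝ → ℝ, (∀ t, HasDerivAt S (C t) t) ∧
    (∀ t, HasDerivAt C (-D * S t) t) ∧ S 0 = 0 ∧ C 0 = 1 := by
  set k : PertCoeffs := ⟨0, 1, 0, -D, 0, 0⟩ with hk
  refine ⟨fun t => (k.flow t (0, 1)).1, fun t => (k.flow t (0, 1)).2, fun t => ?_, fun t => ?_,
    by simp [PertCoeffs.flow_zero], by simp [PertCoeffs.flow_zero]⟩
  · have h : HasDerivAt (fun t => (k.flow t (0, 1)).1) (k.field (k.flow t (0, 1))).1 t :=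
      (k.hasDerivAt_flow t (0, 1)).fst
    exact h.congr_deriv (by simp [PertCoeffs.field, hk])
  · have h : HasDerivAt (fun t => (k.flow t (0, 1)).2) (k.field (k.flow t (0, 1))).2 t :=
      (k.hasDerivAt_flow t (0, 1)).snd
    exact h.congr_deriv (by simp [PertCoeffs.field, hk])

/-- The solution of `x'' = -D x + c` in terms of the fundamental solutions. -/
theorem solution_relations {x V S C : ℝ → ℝ} {D c : ℝ} (hx : ∀ t, HasDerivAt x (V t) t)
    (hV : ∀ t, HasDerivAt V (-D * x t + c) t) (hS : ∀ t, HasDerivAt S (C t) t)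
    (hC : ∀ t, HasDerivAt C (-D * S t) t) (hS0 : S 0 = 0) (hC0 : C 0 = 1) (t : ℝ) :
    V t * C t + (D * x t - c) * S t = V 0 ∧ (D * x t - c) * C t - D * V t * S t = D * x 0 - c := by
  constructor
  · have h : ∀ t, HasDerivAt (fun t => V t * C t + (D * x t - c) * S t) 0 t := fun t =>
      (((hV t).mul (hC t)).add ((((hx t).const_mul D).sub_const c).mul (hS t))).congr_deriv
        (by ring)
    have := is_const_of_deriv_eq_zero (fun t => (h t).differentiableAt) (fun t => (h t).deriv) t 0
    rw [this, hS0, hC0]; ring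
  · have h : ∀ t, HasDerivAt (fun t => (D * x t - c) * C t - D * V t * S t) 0 t := fun t =>
      (((((hx t).const_mul D).sub_const c).mul (hC t)).sub
        (((hV t).const_mul D).mul (hS t))).congr_deriv (by ring)
    have := is_const_of_deriv_eq_zero (fun t => (h t).differentiableAt) (fun t => (h t).deriv) t 0
    rw [this, hS0, hC0]; ring

/-- Derivative of the transition time of an arc of `x'' = -D x + c` that starts and ends on the
line `x = 1`, with respect to the parameter `y` that determines the velocity `v` at the start. -/
theorem hasDerivAt_time_outer {S C T v : ℝ → ℝ} {D d b y₀ T' : ℝ} (hD : D ≠ 0)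
    (hS : ∀ t, HasDerivAt S (C t) t) (hC : ∀ t, HasDerivAt C (-D * S t) t)
    (hv : HasDerivAt v b y₀) (hv0 : 0 < v y₀) (hT : HasDerivAt T T' y₀)
    (h1 : -v y₀ * C (T y₀) + d * S (T y₀) = v y₀)
    (h2 : ∀ᶠ y in 𝓝 y₀, d * C (T y) + D * v y * S (T y) = d) :
    D * v y₀ ^ 2 + d ^ 2 ≠ 0 ∧ T' = 2 * d * b / (D * v y₀ ^ 2 + d ^ 2) := by
  have h20 := h2.self_of_nhds
  have hne : D * v y₀ ^ 2 + d ^ 2 ≠ 0 := by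
    intro h0
    have h3 : 2 * d * v y₀ = 0 := by
      have : S (T y₀) * (D * v y₀ ^ 2 + d ^ 2) = 2 * d * v y₀ := by
        linear_combination d * h1 + v y₀ * h20
      rw [← this, h0, mul_zero]
    have hd : d = 0 := by
      rcases mul_eq_zero.1 h3 with h | h
      · linarith
      · exact absurd h hv0.ne'
    rw [hd] at h0
    have : D * v y₀ ^ 2 = 0 := by linarith
    rcases mul_eq_zero.1 this with h | h
    · exact hD h
    · exact hv0.ne' (pow_eq_zero_iff (two_ne_zero) |>.1 h)
  refine ⟨hne, ?_⟩
  have hST : HasDerivAt (fun y => S (T y)) (C (T y₀) * T') y₀ := (hS _).comp y₀ hT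
  have hCT : HasDerivAt (fun y => C (T y)) (-D * S (T y₀) * T') y₀ := (hC _).comp y₀ hT
  have hder := (hCT.const_mul d).add ((hv.const_mul D).mul hST)
  have hzero := hder.unique ((hasDerivAt_const y₀ d).congr_of_eventuallyEq h2)
  have h4 : T' * v y₀ = b * S (T y₀) := by
    have : D * (T' * v y₀ - b * S (T y₀)) = 0 := by linear_combination -hzero - D * T' * h1
    rcases mul_eq_zero.1 this with h | h
    · exact absurd h hD
    · linarith
  rw [eq_div_iff hne]
  have h5 : v y₀ * (T' * (D * v y₀ ^ 2 + d ^ 2)) = v y₀ * (2 * d * b) := by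
    linear_combination (D * v y₀ ^ 2 + d ^ 2) * h4 + b * d * h1 + b * v y₀ * h20
  exact mul_left_cancel₀ hv0.ne' h5

/-- Derivative of the transition time of an arc of `x'' = -D (x - ξ)` from the line `x = 1` to
`x = -1`. Here `p = 1 - ξ` and `q = 1 + ξ`, and `-U`, `-W` are the velocities at the ends. -/
theorem hasDerivAt_time_lower {S C T U W : ℝ → ℝ} {D p q b y₀ T' : ℝ}
    (hS : ∀ t, HasDerivAt S (C t) t) (hC : ∀ t, HasDerivAt C (-D * S t) t)
    (hU0 : 0 < U y₀) (hW0 : 0 < W y₀) (hT : HasDerivAt T T' y₀)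
    (hUW : HasDerivAt W (b * U y₀ / W y₀) y₀)
    (hR : U y₀ ^ 2 + D * p ^ 2 = W y₀ ^ 2 + D * q ^ 2) (hR0 : 0 < U y₀ ^ 2 + D * p ^ 2)
    (h1 : W y₀ * C (T y₀) + D * q * S (T y₀) = U y₀)
    (h2 : ∀ᶠ y in 𝓝 y₀, -q * C (T y) + W y * S (T y) = p) :
    T' = -b * (p + q * (U y₀ / W y₀)) / (U y₀ ^ 2 + D * p ^ 2) := by
  have h20 := h2.self_of_nhds
  have hST : HasDerivAt (fun y => S (T y)) (C (T y₀) * T') y₀ := (hS _).comp y₀ hT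
  have hCT : HasDerivAt (fun y => C (T y)) (-D * S (T y₀) * T') y₀ := (hC _).comp y₀ hT
  have hder := (hCT.const_mul (-q)).add (hUW.mul hST)
  have hzero := hder.unique ((hasDerivAt_const y₀ p).congr_of_eventuallyEq h2)
  have hSR : S (T y₀) * (U y₀ ^ 2 + D * p ^ 2) = p * W y₀ + q * U y₀ := by
    rw [hR]; linear_combination q * h1 + W y₀ * h20
  have h4 : T' * W y₀ = -b * S (T y₀) := by
    have : U y₀ * (T' * W y₀) = U y₀ * (-b * S (T y₀)) := by
      have h5 : b * U y₀ / W y₀ * W y₀ = b * U y₀ := div_mul_cancel₀ _ hW0.ne'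
      linear_combination W y₀ * hzero - T' * W y₀ * h1 - S (T y₀) * h5
    exact mul_left_cancel₀ hU0.ne' this
  rw [eq_div_iff hR0.ne']
  have h6 : W y₀ * (T' * (U y₀ ^ 2 + D * p ^ 2)) = -b * (p * W y₀ + q * U y₀) := by
    linear_combination (U y₀ ^ 2 + D * p ^ 2) * h4 - b * hSR
  field_simp
  linear_combination h6

/-- The analogous formula for an arc from `x = -1` back to `x = 1`. -/
theorem hasDerivAt_time_upper {S C T U W : ℝ → ℝ} {D p q b y₀ T' : ℝ}
    (hS : ∀ t, HasDerivAt S (C t) t) (hC : ∀ t, HasDerivAt C (-D * S t) t)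
    (hU : HasDerivAt U b y₀) (hW0 : 0 < W y₀) (hT : HasDerivAt T T' y₀)
    (hR0 : 0 < U y₀ ^ 2 + D * p ^ 2)
    (h1 : U y₀ * C (T y₀) + D * p * S (T y₀) = W y₀)
    (h2 : ∀ᶠ y in 𝓝 y₀, p * C (T y) - U y * S (T y) = -q) :
    T' = -b * (p + q * (U y₀ / W y₀)) / (U y₀ ^ 2 + D * p ^ 2) := by
  have h20 := h2.self_of_nhds
  have hST : HasDerivAt (fun y => S (T y)) (C (T y₀) * T') y₀ := (hS _).comp y₀ hT
  have hCT : HasDerivAt (fun y => C (T y)) (-D * S (T y₀) * T') y₀ := (hC _).comp y₀ hT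
  have hder := (hCT.const_mul p).sub (hU.mul hST)
  have hzero := hder.unique ((hasDerivAt_const y₀ (-q)).congr_of_eventuallyEq h2)
  have hSR : S (T y₀) * (U y₀ ^ 2 + D * p ^ 2) = p * W y₀ + q * U y₀ := by
    linear_combination p * h1 - U y₀ * h20
  have h4 : T' * W y₀ = -b * S (T y₀) := by linear_combination -hzero - T' * h1
  rw [eq_div_iff hR0.ne']
  have h6 : W y₀ * (T' * (U y₀ ^ 2 + D * p ^ 2)) = -b * (p * W y₀ + q * U y₀) := by
    linear_combination (U y₀ ^ 2 + D * p ^ 2) * h4 - b * hSR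
  field_simp
  linear_combination h6

/-! ### Deformations of the Hamiltonian system -/

/-- The determinant of the linear part. -/
def HamCoeffs.D (k : HamCoeffs) : ℝ := -(k.a ^ 2 + k.b * k.c)

theorem HamCoeffs.det_linearPart (k : HamCoeffs) : k.linearPart.det = k.D := by
  rw [HamCoeffs.linearPart, Matrix.det_fin_two_of, HamCoeffs.D]; ring

/-- The perturbation of the Hamiltonian field by `(σ, κ H_y + ν)`: it shifts the tangent points,
adds the trace `κ b`, and moves the singular point. -/
def HamCoeffs.deform (k : HamCoeffs) (σ κ ν : ℝ) : PertCoeffs :=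
  ⟨k.a, k.b, k.α + σ, k.c + κ * k.a, -k.a + κ * k.b, k.β + κ * k.α + ν⟩

/-- The constant term of the equation `x'' = -D x + c + κ b x'` satisfied by the abscissa. -/
def HamCoeffs.forcing (k : HamCoeffs) (σ κ ν : ℝ) : ℝ :=
  k.a * k.α + k.b * k.β + k.a * σ + k.b * ν - k.b * κ * σ

theorem HamCoeffs.hasDerivAt_abscissa (k : HamCoeffs) (σ κ ν : ℝ) (z : ℝ × ℝ) (t : ℝ) :
    HasDerivAt (fun t => ((k.deform σ κ ν).flow t z).1)
      ((k.deform σ κ ν).field ((k.deform σ κ ν).flow t z)).1 t :=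
  ((k.deform σ κ ν).hasDerivAt_flow t z).fst

theorem HamCoeffs.hasDerivAt_velocity (k : HamCoeffs) (σ κ ν : ℝ) (z : ℝ × ℝ) (t : ℝ) :
    HasDerivAt (fun t => ((k.deform σ κ ν).field ((k.deform σ κ ν).flow t z)).1)
      (-k.D * ((k.deform σ κ ν).flow t z).1 + k.forcing σ κ ν +
        k.b * κ * ((k.deform σ κ ν).field ((k.deform σ κ ν).flow t z)).1) t := by
  have h1 := k.hasDerivAt_abscissa σ κ ν z t
  have h2 : HasDerivAt (fun t => ((k.deform σ κ ν).flow t z).2)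
      ((k.deform σ κ ν).field ((k.deform σ κ ν).flow t z)).2 t :=
    ((k.deform σ κ ν).hasDerivAt_flow t z).snd
  refine (((h1.const_mul (k.deform σ κ ν).p).add (h2.const_mul (k.deform σ κ ν).q)).add_const
    (k.deform σ κ ν).r).congr_deriv ?_
  simp only [PertCoeffs.field, HamCoeffs.deform, HamCoeffs.D, HamCoeffs.forcing]
  ring

/-- The area under an arc in the phase plane of abscissa and velocity. -/
def PertCoeffs.area (k : PertCoeffs) (z : ℝ × ℝ) (T : ℝ) : ℝ :=
  ∫ t in (0 : ℝ)..T, (k.field (k.flow t z)).1 ^ 2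

theorem HamCoeffs.energy_balance (k : HamCoeffs) (σ κ ν : ℝ) (z : ℝ × ℝ) (T : ℝ) {z' : ℝ × ℝ}
    (h : (k.deform σ κ ν).flow T z = z') :
    ((k.deform σ κ ν).field z').1 ^ 2 - ((k.deform σ κ ν).field z).1 ^ 2 =
      -k.D * (z'.1 ^ 2 - z.1 ^ 2) + 2 * k.forcing σ κ ν * (z'.1 - z.1) +
        2 * (k.b * κ) * (k.deform σ κ ν).area z T := by
  subst h
  have := ThreeZone.energy_balance (k.hasDerivAt_abscissa σ κ ν z)
    (k.hasDerivAt_velocity σ κ ν z) T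
  simpa only [PertCoeffs.flow_zero, PertCoeffs.area] using this

theorem AnalyticFamily.continuous_area {E : Type*} [NormedAddCommGroup E] [NormedSpace ℝ E]
    {m : E → Perturbation} (hm : AnalyticFamily m) (i : Zone) (x : ℝ) :
    Continuous fun v : (E × ℝ) × ℝ => ((m v.1.1).coeffs i).area (x, v.1.2) v.2 := by
  have h1 : Continuous fun v : (E × ℝ) × ℝ => ((m v.1.1).toField.fld i (arcPath m i x v.1 v.2)).1 :=
    continuous_fst.comp ((hm.continuous_fld i).comp
      ((continuous_fst.comp continuous_fst).prodMk (hm.contDiff_arcPath i x).continuous))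
  have h2 : Continuous (Function.uncurry fun (p : E × ℝ) (t : ℝ) =>
      (((m p.1).coeffs i).field (((m p.1).coeffs i).flow t (x, p.2))).1 ^ 2) := by
    simp only [Perturbation.fld_toField] at h1
    exact h1.pow 2
  exact intervalIntegral.continuous_parametric_primitive_of_continuous
    (μ := MeasureTheory.volume) (a₀ := 0) h2

/-! ### The five-parameter deformation and its return map -/

section

/-- The five-parameter deformation of the system that produces the limit cycles. The coordinates of
`e` are, in this order: the downward shift of the tangent point of the right and of the left field,
the dissipation in the right and in the central zone, and a constant force in the central zone. -/
def HamSystem.deform (S : HamSystem) (e : Fin 5 → ℝ) : Perturbation where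
  L := S.L.deform (S.L.b * e 1) 0 0
  C := S.C.deform 0 (S.C.b * e 3) (e 4)
  R := S.R.deform (S.R.b * e 0) (S.R.b * e 2) 0

/-- The piecewise linear perturbation in the direction `e` of the space of deformations. -/
def HamSystem.pert (S : HamSystem) (e : Fin 5 → ℝ) : Perturbation where
  L := ⟨0, 0, S.L.b * e 1, 0, 0, 0⟩
  C := ⟨0, 0, 0, S.C.b * e 3 * S.C.a, S.C.b * e 3 * S.C.b, S.C.b * e 3 * S.C.α + e 4⟩
  R := ⟨0, 0, S.R.b * e 0, S.R.b * e 2 * S.R.a, S.R.b * e 2 * S.R.b, S.R.b * e 2 * S.R.α⟩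

theorem HamSystem.perturbed_pert (S : HamSystem) (e : Fin 5 → ℝ) (ε : ℝ) :
    S.perturbed (S.pert e) ε = (S.deform (ε • e)).toField := by
  simp only [HamSystem.perturbed, Perturbation.toField, HamSystem.pert, HamSystem.deform,
    PWField.mk.injEq]
  refine ⟨?_, ?_, ?_⟩ <;> funext z <;>
    simp only [HamCoeffs.field, PertCoeffs.field, HamCoeffs.deform, Prod.smul_mk, Prod.mk_add_mk,
      smul_eq_mul, Prod.mk.injEq, Pi.smul_apply] <;> constructor <;> ring

theorem HamSystem.unperturbed_eq (S : HamSystem) : S.unperturbed = (S.deform 0).toField := by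
  simp only [HamSystem.unperturbed, Perturbation.toField, HamSystem.deform, PWField.mk.injEq]
  refine ⟨?_, ?_, ?_⟩ <;> funext z <;>
    simp only [HamCoeffs.field, PertCoeffs.field, HamCoeffs.deform, Prod.mk.injEq,
      Pi.zero_apply] <;> constructor <;> ring

theorem HamSystem.analyticFamily_deform (S : HamSystem) : AnalyticFamily S.deform := by
  have h : ∀ i, ContDiff ℝ ω fun e : Fin 5 → ℝ => e i := fun i => contDiff_apply ℝ ℝ i
  rintro (_ | _ | _) <;> constructor <;>
    simp only [Perturbation.coeffs, HamSystem.deform, HamCoeffs.deform] <;> fun_prop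

/-- Consequences of (H1) and (H2), and of the position of the periodic annulus: on each switching
line the two adjacent fields have the same tangent point, and the `y`-axis is oriented so that the
orbits wind clockwise. The abscissa of the central singular point is `ξ`. -/
structure HamSystem.NormalForm (S : HamSystem) (ξ yR yL : ℝ) : Prop where
  bL_pos : 0 < S.L.b
  bC_pos : 0 < S.C.b
  bR_pos : 0 < S.R.b
  tangent_R : S.R.a + S.R.α = -(S.R.b * yR)
  tangent_CR : S.C.a + S.C.α = -(S.C.b * yR)
  tangent_CL : -S.C.a + S.C.α = -(S.C.b * yL)
  tangent_L : -S.L.a + S.L.α = -(S.L.b * yL)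
  D_pos : 0 < S.C.D
  center : S.C.a * S.C.α + S.C.b * S.C.β = S.C.D * ξ
  neg_one_lt : -1 < ξ
  lt_one : ξ < 1
  D_ne_zero : S.R.D ≠ 0

/-- One turn around the annulus: arcs of the deformed system, in the times `τ`, through the right,
the central, the left and again the central zone, between the points of the switching lines with
ordinates `y`. -/
structure HamSystem.IsTurn (S : HamSystem) (e : Fin 5 → ℝ) (y : Fin 5 → ℝ) (τ : Fin 4 → ℝ) :
    Prop where
  right : (S.deform e).IsArc .R (1, y 0) (1, y 1) (τ 0)
  lower : (S.deform e).IsArc .C (1, y 1) (-1, y 2) (τ 1)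
  left : (S.deform e).IsArc .L (-1, y 2) (-1, y 3) (τ 2)
  upper : (S.deform e).IsArc .C (-1, y 3) (1, y 4) (τ 3)

variable {S : HamSystem} {ξ yR yL : ℝ}

/-- The positions of the endpoints of the arcs relative to the tangent points of the undeformed
system. -/
theorem HamSystem.IsTurn.position (hS : S.NormalForm ξ yR yL) {y : Fin 5 → ℝ} {τ : Fin 4 → ℝ}
    (h : S.IsTurn 0 y τ) : yR < y 0 ∧ y 1 < yR ∧ y 2 < yL ∧ yL < y 3 ∧ yR < y 4 := by
  have h0 := (h.right.enters.2.resolve_left (by norm_num [Zone.gap])).2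
  have h1 := (h.right.leaves.2.resolve_left (by norm_num [Zone.gap])).2
  have h2 := (h.left.enters.2.resolve_left (by norm_num [Zone.gap])).2
  have h3 := (h.left.leaves.2.resolve_left (by norm_num [Zone.gap])).2
  have h4 := (h.upper.leaves.2.resolve_left (by norm_num [Zone.gap])).2
  simp only [Zone.dgap, PWField.fld, Perturbation.toField, HamSystem.deform, HamCoeffs.deform,
    PertCoeffs.field, Pi.zero_apply] at h0 h1 h2 h3 h4
  have e1 := hS.tangent_R
  have e2 := hS.tangent_CR
  have e3 := hS.tangent_L
  have hR : ∀ z, S.R.a * 1 + S.R.b * z + (S.R.α + S.R.b * 0) = S.R.b * (z - yR) := fun z => by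
    linear_combination e1
  have hL : ∀ z, S.L.a * -1 + S.L.b * z + (S.L.α + S.L.b * 0) = S.L.b * (z - yL) := fun z => by
    linear_combination e3
  have hC : ∀ z, S.C.a * 1 + S.C.b * z + (S.C.α + 0) = S.C.b * (z - yR) := fun z => by
    linear_combination e2
  rw [hR] at h0 h1
  rw [hL] at h2 h3
  rw [hC] at h4
  have bR := hS.bR_pos
  have bL := hS.bL_pos
  have bC := hS.bC_pos
  refine ⟨?_, ?_, ?_, ?_, ?_⟩ <;> by_contra hcon <;> push Not at hcon <;> nlinarith

/-- Area under the arc number `i` of a turn. -/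
def HamSystem.turnArea (S : HamSystem) (e : Fin 5 → ℝ) (y : Fin 5 → ℝ) (τ : Fin 4 → ℝ) :
    Fin 3 → ℝ :=
  ![(S.deform e).R.area (1, y 0) (τ 0), (S.deform e).C.area (1, y 1) (τ 1),
    (S.deform e).C.area (-1, y 3) (τ 3)]

/-- Energy balance over the four arcs of a turn. -/
theorem HamSystem.IsTurn.balance (hS : S.NormalForm ξ yR yL) {e : Fin 5 → ℝ} {y : Fin 5 → ℝ}
    {τ : Fin 4 → ℝ} (h : S.IsTurn e y τ) :
    (yR - y 1) ^ 2 - (y 0 - yR) ^ 2 =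
      2 * e 0 * ((y 0 - yR) + (yR - y 1)) + 2 * e 2 * S.turnArea e y τ 0 ∧
    (yL - y 2) ^ 2 - (yR - y 1) ^ 2 =
      -(4 * (S.C.D * ξ + S.C.b * e 4) / S.C.b ^ 2) + 2 * e 3 * S.turnArea e y τ 1 ∧
    (y 3 - yL) ^ 2 - (yL - y 2) ^ 2 = -2 * e 1 * ((yL - y 2) + (y 3 - yL)) ∧
    (y 4 - yR) ^ 2 - (y 3 - yL) ^ 2 =
      4 * (S.C.D * ξ + S.C.b * e 4) / S.C.b ^ 2 + 2 * e 3 * S.turnArea e y τ 2 := by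
  have bR := hS.bR_pos.ne'
  have bL := hS.bL_pos.ne'
  have bC := hS.bC_pos.ne'
  have e1 := hS.tangent_R
  have e2 := hS.tangent_CR
  have e3 := hS.tangent_CL
  have e4 := hS.tangent_L
  have ec := hS.center
  have h0 := S.R.energy_balance _ _ _ _ _ h.right.exit
  have h1 := S.C.energy_balance _ _ _ _ _ h.lower.exit
  have h2 := S.L.energy_balance _ _ _ _ _ h.left.exit
  have h3 := S.C.energy_balance _ _ _ _ _ h.upper.exit
  simp only [turnArea, Matrix.cons_val, HamSystem.deform]
  set A0 := (S.R.deform (S.R.b * e 0) (S.R.b * e 2) 0).area (1, y 0) (τ 0)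
  set A1 := (S.C.deform 0 (S.C.b * e 3) (e 4)).area (1, y 1) (τ 1)
  set A2 := (S.C.deform 0 (S.C.b * e 3) (e 4)).area (-1, y 3) (τ 3)
  simp only [PertCoeffs.field, HamCoeffs.deform, HamCoeffs.forcing] at h0 h1 h2 h3
  have hR : ∀ z, S.R.a * 1 + S.R.b * z + (S.R.α + S.R.b * e 0) = S.R.b * (z - yR + e 0) :=
    fun z => by linear_combination e1
  have hCR : ∀ z, S.C.a * 1 + S.C.b * z + (S.C.α + 0) = S.C.b * (z - yR) := fun z => by
    linear_combination e2
  have hCL : ∀ z, S.C.a * -1 + S.C.b * z + (S.C.α + 0) = S.C.b * (z - yL) := fun z => by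
    linear_combination e3
  have hL : ∀ z, S.L.a * -1 + S.L.b * z + (S.L.α + S.L.b * e 1) = S.L.b * (z - yL + e 1) :=
    fun z => by linear_combination e4
  rw [hR, hR] at h0
  rw [hCL, hCR, ec] at h1
  rw [hL, hL] at h2
  rw [hCR, hCL, ec] at h3
  refine ⟨?_, ?_, ?_, ?_⟩
  · have := mul_left_cancel₀ (pow_ne_zero 2 bR) (a := S.R.b ^ 2)
      (b := (y 1 - yR + e 0) ^ 2 - (y 0 - yR + e 0) ^ 2) (c := 2 * e 2 * A0)
      (by linear_combination h0)
    linear_combination this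
  · field_simp
    linear_combination h1
  · have := mul_left_cancel₀ (pow_ne_zero 2 bL) (a := S.L.b ^ 2)
      (b := (y 3 - yL + e 1) ^ 2 - (y 2 - yL + e 1) ^ 2) (c := 0) (by linear_combination h2)
    linear_combination this
  · field_simp
    linear_combination h3

/-- Turns persist under small deformations and changes of the starting point; the turn closes up to
a transition from the section `x = 1` to itself. -/
theorem HamSystem.IsTurn.persist {y : Fin 5 → ℝ} {τ : Fin 4 → ℝ} (h : S.IsTurn 0 y τ) {c : ℝ}
    (hc : y 1 < c) : ∃ (Y : Fin 5 → (Fin 5 → ℝ) × ℝ → ℝ) (T : Fin 4 → (Fin 5 → ℝ) × ℝ → ℝ)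
      (θ : (Fin 5 → ℝ) × ℝ → ℝ) (φ : (Fin 5 → ℝ) × ℝ → ℝ → ℝ × ℝ),
      Transition S.deform c .R .C 1 1 (y 0) (Y 4) θ φ ∧
      (∀ i, ContDiffAt ℝ ω (Y i) (0, y 0)) ∧ (∀ i, ContDiffAt ℝ ω (T i) (0, y 0)) ∧
      (∀ i, Y i (0, y 0) = y i) ∧ (∀ p, Y 0 p = p.2) ∧
      ∀ᶠ p in 𝓝 (0, y 0), S.IsTurn p.1 (fun i => Y i p) fun i => T i p := by
  have hm := S.analyticFamily_deform
  obtain ⟨τ₀, hτ₀, hv₀, ha₀⟩ := h.right.persist hm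
  obtain ⟨τ₁, hτ₁, hv₁, ha₁⟩ := h.lower.persist hm
  obtain ⟨τ₂, hτ₂, hv₂, ha₂⟩ := h.left.persist hm
  obtain ⟨τ₃, hτ₃, hv₃, ha₃⟩ := h.upper.persist hm
  have t₀ := Perturbation.IsArc.transition hm hτ₀ ha₀ c
  have t₁ := Perturbation.IsArc.transition hm hτ₁ ha₁ c
  have t₂ := Perturbation.IsArc.transition hm hτ₂ ha₂ c
  have t₃ := Perturbation.IsArc.transition hm hτ₃ ha₃ c
  have e₀ : (fun p => (arcPath S.deform .R 1 p (τ₀ p)).2) (0, y 0) = y 1 := by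
    simp only [arcPath, hv₀, h.right.exit]
  have e₁ : (fun p => (arcPath S.deform .C 1 p (τ₁ p)).2) (0, y 1) = y 2 := by
    simp only [arcPath, hv₁, h.lower.exit]
  have e₂ : (fun p => (arcPath S.deform .L (-1) p (τ₂ p)).2) (0, y 2) = y 3 := by
    simp only [arcPath, hv₂, h.left.exit]
  have e₃ : (fun p => (arcPath S.deform .C (-1) p (τ₃ p)).2) (0, y 3) = y 4 := by
    simp only [arcPath, hv₃, h.upper.exit]
  set G₀ := fun p => (arcPath S.deform .R 1 p (τ₀ p)).2
  set G₁ := fun p => (arcPath S.deform .C 1 p (τ₁ p)).2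
  set G₂ := fun p => (arcPath S.deform .L (-1) p (τ₂ p)).2
  set G₃ := fun p => (arcPath S.deform .C (-1) p (τ₃ p)).2
  have hcovR : ∀ᶠ a : ℝ in 𝓝 1, 0 ≤ Zone.R.gap a ∨ 0 ≤ Zone.C.gap a := by
    filter_upwards [lt_mem_nhds (show (0 : ℝ) < 1 by norm_num)] with a ha
    rcases le_total 1 a with h | h
    · left; simp only [Zone.gap]; linarith
    · right; simp only [Zone.gap]; nlinarith
  have hcovL : ∀ᶠ a : ℝ in 𝓝 (-1), 0 ≤ Zone.C.gap a ∨ 0 ≤ Zone.L.gap a := by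
    filter_upwards [gt_mem_nhds (show (-1 : ℝ) < 0 by norm_num)] with a ha
    rcases le_total a (-1) with h | h
    · right; simp only [Zone.gap]; linarith
    · left; simp only [Zone.gap]; nlinarith
  have hcovL' : ∀ᶠ a : ℝ in 𝓝 (-1), 0 ≤ Zone.L.gap a ∨ 0 ≤ Zone.C.gap a :=
    hcovL.mono fun a => Or.symm
  have s₁ := t₀.comp t₁ e₀ hcovR (Or.inr hc)
  have s₂ := s₁.comp t₂ (by simp only [e₀, e₁]) hcovL (Or.inl (by norm_num))
  have s₃ := s₂.comp t₃ (by simp only [e₀, e₁, e₂]) hcovL' (Or.inl (by norm_num))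
  have pull : ∀ {F H : (Fin 5 → ℝ) × ℝ → ℝ} {a : ℝ}, ContDiffAt ℝ ω F (0, y 0) →
      F (0, y 0) = a → ContDiffAt ℝ ω H (0, a) →
      ContDiffAt ℝ ω (fun p => H (p.1, F p)) (0, y 0) := fun {F H a} hF ha hH => by
    subst ha
    exact ContDiffAt.comp (f := fun p : (Fin 5 → ℝ) × ℝ => (p.1, F p)) (0, y 0) hH
      (contDiffAt_fst.prodMk hF)
  have ev : ∀ {F : (Fin 5 → ℝ) × ℝ → ℝ} {a : ℝ} {Q : (Fin 5 → ℝ) × ℝ → Prop},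
      ContDiffAt ℝ ω F (0, y 0) → F (0, y 0) = a → (∀ᶠ p in 𝓝 (0, a), Q p) →
      ∀ᶠ p : (Fin 5 → ℝ) × ℝ in 𝓝 (0, y 0), Q (p.1, F p) := fun {F a Q} hF ha hQ => by
    subst ha
    exact (contDiffAt_fst.prodMk hF : ContDiffAt ℝ ω (fun p : (Fin 5 → ℝ) × ℝ => (p.1, F p))
      (0, y 0)).continuousAt.eventually hQ
  have v₁ : G₁ (0, G₀ (0, y 0)) = y 2 := by rw [e₀, e₁]
  have v₂ : G₂ (0, G₁ (0, G₀ (0, y 0))) = y 3 := by rw [v₁, e₂]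
  have v₃ : G₃ (0, G₂ (0, G₁ (0, G₀ (0, y 0)))) = y 4 := by rw [v₂, e₃]
  refine ⟨![fun p => p.2, G₀, fun p => G₁ (p.1, G₀ p), fun p => G₂ (p.1, G₁ (p.1, G₀ p)),
      fun p => G₃ (p.1, G₂ (p.1, G₁ (p.1, G₀ p)))],
    ![τ₀, fun p => τ₁ (p.1, G₀ p), fun p => τ₂ (p.1, G₁ (p.1, G₀ p)),
      fun p => τ₃ (p.1, G₂ (p.1, G₁ (p.1, G₀ p)))], _, _, s₃, ?_, ?_, ?_, fun p => rfl, ?_⟩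
  · intro i
    fin_cases i
    · exact contDiffAt_snd
    · exact t₀.contDiffAt
    · exact s₁.contDiffAt
    · exact s₂.contDiffAt
    · exact s₃.contDiffAt
  · intro i
    fin_cases i
    · exact hτ₀
    · exact (pull t₀.contDiffAt e₀ hτ₁ :)
    · exact (pull s₁.contDiffAt v₁ hτ₂ :)
    · exact (pull s₂.contDiffAt v₂ hτ₃ :)
  · intro i
    fin_cases i
    · rfl
    · exact e₀
    · exact v₁
    · exact v₂
    · exact v₃
  · filter_upwards [ha₀, ev t₀.contDiffAt e₀ ha₁, ev s₁.contDiffAt v₁ ha₂,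
      ev s₂.contDiffAt v₂ ha₃] with p h0 h1 h2 h3
    exact ⟨h0, h1, h2, h3⟩

end

/-! ### The turns of the undeformed system -/

section

variable {S : HamSystem} {ξ yR yL : ℝ}

/-- Turns of the undeformed system close up, and they are symmetric in the outer zones. -/
theorem HamSystem.IsTurn.closes (hS : S.NormalForm ξ yR yL) {y : Fin 5 → ℝ} {τ : Fin 4 → ℝ}
    (h : S.IsTurn 0 y τ) : yR - y 1 = y 0 - yR ∧ y 3 - yL = yL - y 2 ∧ y 4 = y 0 ∧
      (yL - y 2) ^ 2 = (y 0 - yR) ^ 2 - 4 * S.C.D * ξ / S.C.b ^ 2 := by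
  obtain ⟨p0, p1, p2, p3, p4⟩ := h.position hS
  obtain ⟨b0, b1, b2, b3⟩ := h.balance hS
  simp only [Pi.zero_apply, mul_zero, zero_mul, add_zero] at b0 b1 b2 b3
  have h1 : yR - y 1 = y 0 - yR :=
    (pow_left_inj₀ (by linarith) (by linarith) two_ne_zero).1 (by linarith)
  have h3 : y 3 - yL = yL - y 2 :=
    (pow_left_inj₀ (by linarith) (by linarith) two_ne_zero).1 (by linarith)
  have h4 : y 4 - yR = y 0 - yR :=
    (pow_left_inj₀ (by linarith) (by linarith) two_ne_zero).1
      (by rw [h3] at b3; rw [h1] at b1; linarith)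
  refine ⟨h1, h3, by linarith, ?_⟩
  rw [h1, ← mul_assoc] at b1
  linarith

/-- The constant term of the equation `x'' = -D (x - 1) - d` of the abscissa in the right zone. -/
def HamSystem.pull (S : HamSystem) : ℝ := S.R.D - (S.R.a * S.R.α + S.R.b * S.R.β)

section

variable (hS : S.NormalForm ξ yR yL) {y : Fin 5 → ℝ} {τ : Fin 4 → ℝ} (h : S.IsTurn 0 y τ)
include hS h

theorem HamSystem.IsTurn.right_relations : ∃ x V : ℝ → ℝ, (∀ t, HasDerivAt x (V t) t) ∧
    (∀ t, HasDerivAt V (-S.R.D * x t + (S.R.a * S.R.α + S.R.b * S.R.β)) t) ∧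
    x 0 = 1 ∧ x (τ 0) = 1 ∧ V 0 = S.R.b * (y 0 - yR) ∧ V (τ 0) = -(S.R.b * (y 0 - yR)) ∧
    S.turnArea 0 y τ 0 = ∫ t in (0 : ℝ)..τ 0, V t ^ 2 := by
  have hc := (h.closes hS).1
  have e1 := hS.tangent_R
  set m := S.R.deform (S.R.b * (0 : Fin 5 → ℝ) 0) (S.R.b * (0 : Fin 5 → ℝ) 2) 0 with hm
  have hex : m.flow (τ 0) (1, y 0) = (1, y 1) := h.right.exit
  refine ⟨fun t => (m.flow t (1, y 0)).1, fun t => (m.field (m.flow t (1, y 0))).1,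
    fun t => S.R.hasDerivAt_abscissa _ _ _ _ t, fun t => ?_, ?_, ?_, ?_, ?_, rfl⟩
  · exact (S.R.hasDerivAt_velocity _ _ _ _ t).congr_deriv (by simp [HamCoeffs.forcing, hm])
  · simp only [PertCoeffs.flow_zero]
  · simp only [hex]
  · simp only [PertCoeffs.flow_zero, hm, PertCoeffs.field, HamCoeffs.deform, Pi.zero_apply]
    linear_combination e1
  · simp only [hex]
    simp only [hm, PertCoeffs.field, HamCoeffs.deform, Pi.zero_apply]
    linear_combination e1 - S.R.b * hc

theorem HamSystem.IsTurn.lower_relations : ∃ x V : ℝ → ℝ, (∀ t, HasDerivAt x (V t) t) ∧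
    (∀ t, HasDerivAt V (-S.C.D * x t + S.C.D * ξ) t) ∧
    x 0 = 1 ∧ x (τ 1) = -1 ∧ V 0 = -(S.C.b * (y 0 - yR)) ∧ V (τ 1) = -(S.C.b * (yL - y 2)) ∧
    S.turnArea 0 y τ 1 = (∫ t in (0 : ℝ)..τ 1, V t ^ 2) ∧ ∀ t ∈ Ioo 0 (τ 1), 0 < 1 - x t ^ 2 := by
  have hc := (h.closes hS).1
  have e1 := hS.tangent_CR
  have e2 := hS.tangent_CL
  set m := S.C.deform 0 (S.C.b * (0 : Fin 5 → ℝ) 3) ((0 : Fin 5 → ℝ) 4) with hm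
  have hex : m.flow (τ 1) (1, y 1) = (-1, y 2) := h.lower.exit
  refine ⟨fun t => (m.flow t (1, y 1)).1, fun t => (m.field (m.flow t (1, y 1))).1,
    fun t => S.C.hasDerivAt_abscissa _ _ _ _ t, fun t => ?_, ?_, ?_, ?_, ?_, rfl,
    fun t ht => h.lower.inside t ht⟩
  · exact (S.C.hasDerivAt_velocity _ _ _ _ t).congr_deriv
      (by simp [HamCoeffs.forcing, hm, hS.center])
  · simp only [PertCoeffs.flow_zero]
  · simp only [hex]
  · simp only [PertCoeffs.flow_zero, hm, PertCoeffs.field, HamCoeffs.deform, Pi.zero_apply]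
    linear_combination e1 - S.C.b * hc
  · simp only [hex]
    simp only [hm, PertCoeffs.field, HamCoeffs.deform, Pi.zero_apply]
    linear_combination e2

theorem HamSystem.IsTurn.upper_relations : ∃ x V : ℝ → ℝ, (∀ t, HasDerivAt x (V t) t) ∧
    (∀ t, HasDerivAt V (-S.C.D * x t + S.C.D * ξ) t) ∧
    x 0 = -1 ∧ x (τ 3) = 1 ∧ V 0 = S.C.b * (yL - y 2) ∧ V (τ 3) = S.C.b * (y 0 - yR) ∧
    S.turnArea 0 y τ 2 = (∫ t in (0 : ℝ)..τ 3, V t ^ 2) ∧ ∀ t ∈ Ioo 0 (τ 3), 0 < 1 - x t ^ 2 := by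
  obtain ⟨-, hc, hc', -⟩ := h.closes hS
  have e1 := hS.tangent_CR
  have e2 := hS.tangent_CL
  set m := S.C.deform 0 (S.C.b * (0 : Fin 5 → ℝ) 3) ((0 : Fin 5 → ℝ) 4) with hm
  have hex : m.flow (τ 3) (-1, y 3) = (1, y 4) := h.upper.exit
  refine ⟨fun t => (m.flow t (-1, y 3)).1, fun t => (m.field (m.flow t (-1, y 3))).1,
    fun t => S.C.hasDerivAt_abscissa _ _ _ _ t, fun t => ?_, ?_, ?_, ?_, ?_, rfl,
    fun t ht => h.upper.inside t ht⟩
  · exact (S.C.hasDerivAt_velocity _ _ _ _ t).congr_deriv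
      (by simp [HamCoeffs.forcing, hm, hS.center])
  · simp only [PertCoeffs.flow_zero]
  · simp only [hex]
  · simp only [PertCoeffs.flow_zero, hm, PertCoeffs.field, HamCoeffs.deform, Pi.zero_apply]
    linear_combination e2 + S.C.b * hc
  · simp only [hex]
    simp only [hm, PertCoeffs.field, HamCoeffs.deform, Pi.zero_apply]
    linear_combination e1 + S.C.b * hc'

/-- The area in the right zone. -/
theorem HamSystem.IsTurn.area_right : 2 * S.turnArea 0 y τ 0 =
    S.R.b ^ 2 * (((y 0 - yR) ^ 2 + S.pull ^ 2 / (S.R.D * S.R.b ^ 2)) * τ 0) -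
      2 * S.R.b * S.pull / S.R.D * (y 0 - yR) := by
  obtain ⟨x, V, hx, hV, x0, x1, V0, V1, hA⟩ := h.right_relations hS
  have hD := hS.D_ne_zero
  have hb := hS.bR_pos.ne'
  rw [hA, two_mul_integral_sq hD hx hV, x0, x1, V0, V1, HamSystem.pull]
  field_simp
  ring

/-- The area in the central zone. -/
theorem HamSystem.IsTurn.area_center : 2 * (S.turnArea 0 y τ 1 + S.turnArea 0 y τ 2) =
    S.C.b ^ 2 * (((y 0 - yR) ^ 2 + S.C.D * (1 - ξ) ^ 2 / S.C.b ^ 2) * (τ 1 + τ 3)) +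
      2 * S.C.b * (1 + ξ) * (yL - y 2) + 2 * S.C.b * (1 - ξ) * (y 0 - yR) := by
  obtain ⟨x, V, hx, hV, x0, x1, V0, V1, hA, -⟩ := h.lower_relations hS
  obtain ⟨x', V', hx', hV', x0', x1', V0', V1', hA', -⟩ := h.upper_relations hS
  have hD := hS.D_pos.ne'
  have hb := hS.bC_pos.ne'
  have hw := (h.closes hS).2.2.2
  have hw' : S.C.b ^ 2 * (yL - y 2) ^ 2 = S.C.b ^ 2 * (y 0 - yR) ^ 2 - 4 * S.C.D * ξ := by
    rw [hw]; field_simp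
  rw [mul_add, hA, two_mul_integral_sq hD hx hV, x0, x1, V0, V1, hA',
    two_mul_integral_sq hD hx' hV', x0', x1', V0', V1', mul_pow, mul_pow, neg_sq, mul_pow, hw']
  field_simp
  ring

end

/-- `Y` and `T` are the ordinates and the transition times of a family of turns, near the orbit
of ordinate `y₀` and the undeformed system. -/
structure HamSystem.IsReturn (S : HamSystem) (y₀ : ℝ) (Y : Fin 5 → (Fin 5 → ℝ) × ℝ → ℝ)
    (T : Fin 4 → (Fin 5 → ℝ) × ℝ → ℝ) : Prop where
  contDiffAt_Y : ∀ i, ContDiffAt ℝ ω (Y i) (0, y₀)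
  contDiffAt_T : ∀ i, ContDiffAt ℝ ω (T i) (0, y₀)
  start : ∀ p, Y 0 p = p.2
  turn : ∀ᶠ p in 𝓝 (0, y₀), S.IsTurn p.1 (fun i => Y i p) fun i => T i p

variable {y₀ : ℝ} {Y : Fin 5 → (Fin 5 → ℝ) × ℝ → ℝ} {T : Fin 4 → (Fin 5 → ℝ) × ℝ → ℝ}

theorem eventually_nhds_snd {Q : (Fin 5 → ℝ) × ℝ → Prop} (hQ : ∀ᶠ p in 𝓝 (0, y₀), Q p) :
    ∀ᶠ y in 𝓝 y₀, Q (0, y) :=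
  (continuous_const.prodMk continuous_id : Continuous fun y : ℝ =>
    ((0 : Fin 5 → ℝ), y)).continuousAt.eventually hQ

theorem HamSystem.IsReturn.eventually_nhds (h : S.IsReturn y₀ Y T) :
    ∀ᶠ y in 𝓝 y₀, S.IsReturn y Y T := by
  have h1 := eventually_nhds_snd h.turn.eventually_nhds
  have h2 : ∀ᶠ y in 𝓝 y₀, ∀ i, ContDiffAt ℝ ω (Y i) (0, y) :=
    eventually_all.2 fun i => eventually_nhds_snd ((h.contDiffAt_Y i).eventually (by simp))
  have h3 : ∀ᶠ y in 𝓝 y₀, ∀ i, ContDiffAt ℝ ω (T i) (0, y) :=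
    eventually_all.2 fun i => eventually_nhds_snd ((h.contDiffAt_T i).eventually (by simp))
  filter_upwards [h1, h2, h3] with y h1 h2 h3 using ⟨h2, h3, h.start, h1⟩

theorem HamSystem.IsReturn.turn_zero (h : S.IsReturn y₀ Y T) :
    S.IsTurn 0 (fun i => Y i (0, y₀)) fun i => T i (0, y₀) := h.turn.self_of_nhds

theorem hasDerivAt_snd {F : (Fin 5 → ℝ) × ℝ → ℝ} (hF : ContDiffAt ℝ ω F (0, y₀)) :
    HasDerivAt (fun y => F (0, y)) (deriv (fun y => F (0, y)) y₀) y₀ := by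
  have h : ContDiffAt ℝ ω (fun y => F (0, y)) y₀ :=
    ContDiffAt.comp (f := fun y : ℝ => ((0 : Fin 5 → ℝ), y)) y₀ hF
      (contDiffAt_const.prodMk contDiffAt_id)
  exact (h.differentiableAt (by simp)).hasDerivAt

section

variable (hS : S.NormalForm ξ yR yL) (h : S.IsReturn y₀ Y T)
include hS h

theorem HamSystem.IsReturn.hasDerivAt_time_right :
    (y₀ - yR) ^ 2 + S.pull ^ 2 / (S.R.D * S.R.b ^ 2) ≠ 0 ∧
    HasDerivAt (fun y => T 0 (0, y)) (2 * S.pull / (S.R.D * S.R.b) /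
      ((y₀ - yR) ^ 2 + S.pull ^ 2 / (S.R.D * S.R.b ^ 2))) y₀ := by
  obtain ⟨s, c, hs, hc, hs0, hc0⟩ := exists_sin_cos S.R.D
  have hD := hS.D_ne_zero
  have hb := hS.bR_pos
  have key : ∀ y, S.IsReturn y Y T →
      -(S.R.b * (y - yR)) * c (T 0 (0, y)) + S.pull * s (T 0 (0, y)) = S.R.b * (y - yR) ∧
      S.pull * c (T 0 (0, y)) + S.R.D * (S.R.b * (y - yR)) * s (T 0 (0, y)) = S.pull := by
    intro y hy
    obtain ⟨x, V, hx, hV, x0, x1, V0, V1, -⟩ := hy.turn_zero.right_relations hS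
    obtain ⟨r1, r2⟩ := solution_relations hx hV hs hc hs0 hc0 (T 0 (0, y))
    rw [x0] at r2
    rw [hy.start] at V0 V1
    rw [x1, V1, V0] at r1
    rw [x1, V1] at r2
    rw [HamSystem.pull]
    constructor
    · linear_combination r1
    · linear_combination r2
  have hv : HasDerivAt (fun y => S.R.b * (y - yR)) S.R.b y₀ := by
    simpa using ((hasDerivAt_id y₀).sub_const yR).const_mul S.R.b
  have hu : 0 < y₀ - yR := by
    have := (h.turn_zero.position hS).1
    rw [h.start] at this
    simpa using this
  have hT := hasDerivAt_snd (h.contDiffAt_T 0)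
  obtain ⟨hne, hT'⟩ := hasDerivAt_time_outer hD hs hc hv (mul_pos hb hu) hT (key y₀ h).1
    (h.eventually_nhds.mono fun y hy => (key y hy).2)
  have heq : S.R.D * (S.R.b * (y₀ - yR)) ^ 2 + S.pull ^ 2 = S.R.D * S.R.b ^ 2 *
      ((y₀ - yR) ^ 2 + S.pull ^ 2 / (S.R.D * S.R.b ^ 2)) := by
    field_simp
  rw [heq] at hne hT'
  refine ⟨right_ne_zero_of_mul hne, hT.congr_deriv ?_⟩
  have := right_ne_zero_of_mul hne
  rw [hT', div_div, div_eq_div_iff hne (mul_ne_zero (mul_ne_zero hD hb.ne') this)]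
  ring

theorem HamSystem.IsReturn.velocity_left : 0 < y₀ - yR ∧ 0 < yL - Y 2 (0, y₀) ∧
    (yL - Y 2 (0, y₀)) ^ 2 = (y₀ - yR) ^ 2 - 4 * S.C.D * ξ / S.C.b ^ 2 := by
  have h1 := h.turn_zero.position hS
  have h2 := (h.turn_zero.closes hS).2.2.2
  simp only [h.start] at h1 h2
  exact ⟨by linarith, by linarith, h2⟩

theorem HamSystem.IsReturn.hasDerivAt_velocity_left :
    HasDerivAt (fun y => yL - Y 2 (0, y)) ((y₀ - yR) / (yL - Y 2 (0, y₀))) y₀ := by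
  obtain ⟨-, hw, -⟩ := h.velocity_left hS
  have hW0 := hasDerivAt_snd (h.contDiffAt_Y 2)
  set W' := deriv (fun y => Y 2 (0, y)) y₀
  have hW1 : HasDerivAt (fun y => yL - Y 2 (0, y)) (-W') y₀ := hW0.const_sub yL
  refine hW1.congr_deriv ?_
  have h1 := hW1.pow 2
  have h2 : HasDerivAt (fun y => (y - yR) ^ 2 - 4 * S.C.D * ξ / S.C.b ^ 2)
      (((2 : ℕ) : ℝ) * (y₀ - yR) ^ (2 - 1) * 1) y₀ :=
    (((hasDerivAt_id y₀).sub_const yR).pow 2).sub_const _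
  have h3 := (h1.congr_of_eventuallyEq (h.eventually_nhds.mono fun y hy =>
    ((hy.velocity_left hS).2.2).symm)).unique h2
  simp only [Nat.cast_ofNat, Nat.reduceSub, pow_one, mul_one] at h3
  rw [eq_div_iff hw.ne']
  linear_combination h3 / 2

theorem HamSystem.IsReturn.hasDerivAt_time_center :
    HasDerivAt (fun y => T 1 (0, y) + T 3 (0, y))
      (-(2 / S.C.b) * ((1 - ξ) + (1 + ξ) * ((y₀ - yR) / (yL - Y 2 (0, y₀)))) /
        ((y₀ - yR) ^ 2 + S.C.D * (1 - ξ) ^ 2 / S.C.b ^ 2)) y₀ := by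
  obtain ⟨s, c, hs, hc, hs0, hc0⟩ := exists_sin_cos S.C.D
  have hD := hS.D_pos
  have hb := hS.bC_pos
  have key : ∀ y, S.IsReturn y Y T →
      (S.C.b * (yL - Y 2 (0, y)) * c (T 1 (0, y)) + S.C.D * (1 + ξ) * s (T 1 (0, y)) =
        S.C.b * (y - yR) ∧
      -(1 + ξ) * c (T 1 (0, y)) + S.C.b * (yL - Y 2 (0, y)) * s (T 1 (0, y)) = 1 - ξ) ∧
      (S.C.b * (y - yR) * c (T 3 (0, y)) + S.C.D * (1 - ξ) * s (T 3 (0, y)) =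
        S.C.b * (yL - Y 2 (0, y)) ∧
      (1 - ξ) * c (T 3 (0, y)) - S.C.b * (y - yR) * s (T 3 (0, y)) = -(1 + ξ)) := by
    intro y hy
    constructor
    · obtain ⟨x, V, hx, hV, x0, x1, V0, V1, -, -⟩ := hy.turn_zero.lower_relations hS
      obtain ⟨r1, r2⟩ := solution_relations hx hV hs hc hs0 hc0 (T 1 (0, y))
      rw [hy.start] at V0
      rw [x1, V1, V0] at r1
      rw [x1, V1, x0] at r2
      constructor
      · linear_combination -r1
      · exact mul_left_cancel₀ hD.ne' (by linear_combination r2)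
    · obtain ⟨x, V, hx, hV, x0, x1, V0, V1, -, -⟩ := hy.turn_zero.upper_relations hS
      obtain ⟨r1, r2⟩ := solution_relations hx hV hs hc hs0 hc0 (T 3 (0, y))
      rw [hy.start] at V1
      rw [x1, V1, V0] at r1
      rw [x1, V1, x0] at r2
      constructor
      · linear_combination r1
      · exact mul_left_cancel₀ hD.ne' (by linear_combination r2)
  obtain ⟨hu, hw, hwu⟩ := h.velocity_left hS
  have hv : HasDerivAt (fun y => S.C.b * (y - yR)) S.C.b y₀ := by
    simpa using ((hasDerivAt_id y₀).sub_const yR).const_mul S.C.b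
  have hW : HasDerivAt (fun y => S.C.b * (yL - Y 2 (0, y)))
      (S.C.b * (S.C.b * (y₀ - yR)) / (S.C.b * (yL - Y 2 (0, y₀)))) y₀ :=
    ((h.hasDerivAt_velocity_left hS).const_mul S.C.b).congr_deriv (by
      rw [mul_div_mul_left _ _ hb.ne', mul_div_assoc])
  have hUW : (S.C.b * (y₀ - yR)) ^ 2 + S.C.D * (1 - ξ) ^ 2 =
      (S.C.b * (yL - Y 2 (0, y₀))) ^ 2 + S.C.D * (1 + ξ) ^ 2 := by
    rw [mul_pow, mul_pow, hwu]
    have := hb.ne'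
    field_simp
    ring
  have hR0 : 0 < (S.C.b * (y₀ - yR)) ^ 2 + S.C.D * (1 - ξ) ^ 2 := by positivity
  have hT1 := hasDerivAt_snd (h.contDiffAt_T 1)
  have hT3 := hasDerivAt_snd (h.contDiffAt_T 3)
  have hT1' := hasDerivAt_time_lower hs hc (U := fun y => S.C.b * (y - yR))
    (W := fun y => S.C.b * (yL - Y 2 (0, y))) (mul_pos hb hu) (mul_pos hb hw) hT1 hW hUW hR0
    (key y₀ h).1.1 (h.eventually_nhds.mono fun y hy => (key y hy).1.2)
  have hT3' := hasDerivAt_time_upper hs hc (U := fun y => S.C.b * (y - yR))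
    (W := fun y => S.C.b * (yL - Y 2 (0, y))) hv (mul_pos hb hw) hT3 hR0
    (key y₀ h).2.1 (h.eventually_nhds.mono fun y hy => (key y hy).2.2)
  refine (hT1.add hT3).congr_deriv ?_
  rw [hT1', hT3', mul_div_mul_left _ _ hb.ne']
  have heq : (S.C.b * (y₀ - yR)) ^ 2 + S.C.D * (1 - ξ) ^ 2 = S.C.b ^ 2 *
      ((y₀ - yR) ^ 2 + S.C.D * (1 - ξ) ^ 2 / S.C.b ^ 2) := by
    have := hb.ne'
    field_simp
  have hne : (y₀ - yR) ^ 2 + S.C.D * (1 - ξ) ^ 2 / S.C.b ^ 2 ≠ 0 := by positivity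
  rw [heq]
  have := hb.ne'
  have := hw.ne'
  generalize (y₀ - yR) ^ 2 + S.C.D * (1 - ξ) ^ 2 / S.C.b ^ 2 = q at hne
  field_simp
  ring

end

end

/-! ### The displacement to leading order -/

section

variable {S : HamSystem} {ξ yR yL : ℝ} {y₀ : ℝ} {Y : Fin 5 → (Fin 5 → ℝ) × ℝ → ℝ}
  {T : Fin 4 → (Fin 5 → ℝ) × ℝ → ℝ}

theorem HamSystem.IsReturn.continuousAt_turnArea (h : S.IsReturn y₀ Y T) (i : Fin 3) :
    ContinuousAt (fun p : (Fin 5 → ℝ) × ℝ =>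
      S.turnArea p.1 (fun i => Y i p) (fun i => T i p) i) (0, y₀) := by
  have hm := S.analyticFamily_deform
  have key : ∀ (j : Fin 5) (k : Fin 4), ContinuousAt (fun p : (Fin 5 → ℝ) × ℝ =>
      ((p.1, Y j p), T k p)) (0, y₀) := fun j k =>
    (continuousAt_fst.prodMk (h.contDiffAt_Y j).continuousAt).prodMk (h.contDiffAt_T k).continuousAt
  fin_cases i
  · exact ((hm.continuous_area .R 1).continuousAt.comp (key 0 0) :)
  · exact ((hm.continuous_area .C 1).continuousAt.comp (key 1 1) :)
  · exact ((hm.continuous_area .C (-1)).continuousAt.comp (key 3 3) :)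

/-- The sign of the displacement is the sign of its leading coefficient. -/
theorem HamSystem.IsReturn.sign_displacement (hS : S.NormalForm ξ yR yL) (h : S.IsReturn y₀ Y T)
    {θ : ℝ → Fin 5 → ℝ} (hθ : Tendsto θ (𝓝[>] 0) (𝓝 0)) {N : ℝ → ℝ} {M : ℝ} (k : ℕ)
    (hN : Tendsto N (𝓝[>] 0) (𝓝 M)) (hNd : ∀ᶠ ε in 𝓝[>] (0 : ℝ),
      (Y 4 (θ ε, y₀) - yR) ^ 2 - (y₀ - yR) ^ 2 = ε ^ k * N ε) :
    (0 < M → ∀ᶠ ε in 𝓝[>] (0 : ℝ), y₀ < Y 4 (θ ε, y₀)) ∧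
      (M < 0 → ∀ᶠ ε in 𝓝[>] (0 : ℝ), Y 4 (θ ε, y₀) < y₀) := by
  have hpos := h.turn_zero.position hS
  simp only [h.start] at hpos
  have hp : Tendsto (fun ε => (θ ε, y₀)) (𝓝[>] 0) (𝓝 ((0 : Fin 5 → ℝ), y₀)) :=
    hθ.prodMk_nhds tendsto_const_nhds
  have h4 : ∀ᶠ ε in 𝓝[>] (0 : ℝ), yR < Y 4 (θ ε, y₀) :=
    (((h.contDiffAt_Y 4).continuousAt.tendsto.comp hp).eventually (lt_mem_nhds hpos.2.2.2.2))
  constructor <;> intro hM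
  · filter_upwards [hNd, h4, hN.eventually (lt_mem_nhds hM), self_mem_nhdsWithin] with ε h1 h2 h3 h0
    have := mul_pos (pow_pos h0 k) h3
    have := lt_of_pow_lt_pow_left₀ 2 (by linarith) (show (y₀ - yR) ^ 2 < _ by
      linarith [h1] : (y₀ - yR) ^ 2 < (Y 4 (θ ε, y₀) - yR) ^ 2)
    linarith
  · filter_upwards [hNd, h4, hN.eventually (gt_mem_nhds hM), self_mem_nhdsWithin] with ε h1 h2 h3 h0
    have := mul_neg_of_pos_of_neg (pow_pos h0 k) h3
    have := lt_of_pow_lt_pow_left₀ 2 (by linarith [hpos.1]) (show _ < (y₀ - yR) ^ 2 by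
      linarith [h1] : (Y 4 (θ ε, y₀) - yR) ^ 2 < (y₀ - yR) ^ 2)
    linarith

/-- The energy balance along a curve of deformations, with the limits of all quantities. -/
theorem HamSystem.IsReturn.along_curve (hS : S.NormalForm ξ yR yL) (h : S.IsReturn y₀ Y T)
    {θ : ℝ → Fin 5 → ℝ} (hθ : Tendsto θ (𝓝[>] 0) (𝓝 0)) :
    ∃ u₁ w₂ w₃ A₀ A₁ A₂ : ℝ → ℝ,
      (Tendsto u₁ (𝓝[>] 0) (𝓝 (y₀ - yR)) ∧ Tendsto w₂ (𝓝[>] 0) (𝓝 (yL - Y 2 (0, y₀))) ∧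
        Tendsto w₃ (𝓝[>] 0) (𝓝 (yL - Y 2 (0, y₀)))) ∧
      (Tendsto A₀ (𝓝[>] 0)
          (𝓝 (S.turnArea 0 (fun i => Y i (0, y₀)) (fun i => T i (0, y₀)) 0)) ∧
        Tendsto A₁ (𝓝[>] 0)
          (𝓝 (S.turnArea 0 (fun i => Y i (0, y₀)) (fun i => T i (0, y₀)) 1)) ∧
        Tendsto A₂ (𝓝[>] 0)
          (𝓝 (S.turnArea 0 (fun i => Y i (0, y₀)) (fun i => T i (0, y₀)) 2))) ∧
      ∀ᶠ ε in 𝓝[>] (0 : ℝ), (0 < u₁ ε ∧ 0 < w₂ ε ∧ 0 < w₃ ε) ∧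
        u₁ ε ^ 2 - (y₀ - yR) ^ 2 = 2 * θ ε 0 * ((y₀ - yR) + u₁ ε) + 2 * θ ε 2 * A₀ ε ∧
        w₂ ε ^ 2 - u₁ ε ^ 2 =
          -(4 * (S.C.D * ξ + S.C.b * θ ε 4) / S.C.b ^ 2) + 2 * θ ε 3 * A₁ ε ∧
        w₃ ε ^ 2 - w₂ ε ^ 2 = -2 * θ ε 1 * (w₂ ε + w₃ ε) ∧
        (Y 4 (θ ε, y₀) - yR) ^ 2 - w₃ ε ^ 2 =
          4 * (S.C.D * ξ + S.C.b * θ ε 4) / S.C.b ^ 2 + 2 * θ ε 3 * A₂ ε := by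
  have hp : Tendsto (fun ε : ℝ => (θ ε, y₀)) (𝓝[>] 0) (𝓝 ((0 : Fin 5 → ℝ), y₀)) :=
    hθ.prodMk_nhds tendsto_const_nhds
  have hY : ∀ i, Tendsto (fun ε : ℝ => Y i (θ ε, y₀)) (𝓝[>] 0) (𝓝 (Y i (0, y₀))) := fun i =>
    (h.contDiffAt_Y i).continuousAt.tendsto.comp hp
  have hA := fun i => (h.continuousAt_turnArea i).tendsto.comp hp
  obtain ⟨c1, c2, -, -⟩ := h.turn_zero.closes hS
  obtain ⟨-, p1, p2, p3, -⟩ := h.turn_zero.position hS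
  rw [h.start] at c1
  refine ⟨fun ε => yR - Y 1 (θ ε, y₀), fun ε => yL - Y 2 (θ ε, y₀), fun ε => Y 3 (θ ε, y₀) - yL,
    _, _, _, ⟨?_, (hY 2).const_sub yL, ?_⟩, ⟨hA 0, hA 1, hA 2⟩, ?_⟩
  · rw [← c1]; exact (hY 1).const_sub yR
  · rw [← c2]; exact (hY 3).sub_const yL
  · filter_upwards [hp.eventually h.turn, (hY 1).eventually (gt_mem_nhds p1),
      (hY 2).eventually (gt_mem_nhds p2), (hY 3).eventually (lt_mem_nhds p3)] with ε hε q1 q2 q3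
    have hb := hε.balance hS
    rw [h.start] at hb
    exact ⟨⟨sub_pos.2 q1, sub_pos.2 q2, sub_pos.2 q3⟩, hb⟩

/-- The displacement, of first order in the deformation. -/
theorem HamSystem.IsReturn.sign_displacement_linear (hS : S.NormalForm ξ yR yL)
    (h : S.IsReturn y₀ Y T) (e : Fin 5 → ℝ) {M : ℝ}
    (hM : M = 4 * e 0 * (y₀ - yR) - 4 * e 1 * (yL - Y 2 (0, y₀)) +
      e 2 * (2 * S.turnArea 0 (fun i => Y i (0, y₀)) (fun i => T i (0, y₀)) 0) +
      e 3 * (2 * (S.turnArea 0 (fun i => Y i (0, y₀)) (fun i => T i (0, y₀)) 1 +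
        S.turnArea 0 (fun i => Y i (0, y₀)) (fun i => T i (0, y₀)) 2))) :
    (0 < M → ∀ᶠ ε in 𝓝[>] (0 : ℝ), y₀ < Y 4 (ε • e, y₀)) ∧
      (M < 0 → ∀ᶠ ε in 𝓝[>] (0 : ℝ), Y 4 (ε • e, y₀) < y₀) := by
  have hθ : Tendsto (fun ε : ℝ => ε • e) (𝓝[>] 0) (𝓝 0) := by
    have : Continuous fun ε : ℝ => ε • e := by fun_prop
    simpa using this.continuousWithinAt.tendsto (x := (0 : ℝ)) (s := Ioi 0)
  obtain ⟨u₁, w₂, w₃, A₀, A₁, A₂, ⟨hu, hw2, hw3⟩, ⟨h0, h1, h2⟩, hev⟩ := h.along_curve hS hθ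
  refine h.sign_displacement hS hθ 1 (N := fun ε => 2 * e 0 * ((y₀ - yR) + u₁ ε) +
    2 * e 2 * A₀ ε + 2 * e 3 * (A₁ ε + A₂ ε) - 2 * e 1 * (w₂ ε + w₃ ε)) ?_ ?_
  · have hl := ((((hu.const_add (y₀ - yR)).const_mul (2 * e 0)).add (h0.const_mul (2 * e 2))).add
      ((h1.add h2).const_mul (2 * e 3))).sub ((hw2.add hw3).const_mul (2 * e 1))
    have hval : M = 2 * e 0 * ((y₀ - yR) + (y₀ - yR)) +
        2 * e 2 * S.turnArea 0 (fun i => Y i (0, y₀)) (fun i => T i (0, y₀)) 0 +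
        2 * e 3 * (S.turnArea 0 (fun i => Y i (0, y₀)) (fun i => T i (0, y₀)) 1 +
          S.turnArea 0 (fun i => Y i (0, y₀)) (fun i => T i (0, y₀)) 2) -
        2 * e 1 * ((yL - Y 2 (0, y₀)) + (yL - Y 2 (0, y₀))) := by rw [hM]; ring
    rw [hval]
    exact hl
  · filter_upwards [hev] with ε ⟨_, b0, b1, b2, b3⟩
    simp only [Pi.smul_apply, smul_eq_mul] at b0 b1 b2 b3
    linear_combination b0 + b1 + b2 + b3

/-- The displacement, of second order along a quadratic curve of deformations, in the case of a
central singular point on the `y`-axis, where the first-order effects of the shifts in the left and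
in the right zone cancel. -/
theorem HamSystem.IsReturn.sign_displacement_quadratic (hS : S.NormalForm 0 yR yL)
    (h : S.IsReturn y₀ Y T) (μ β γ δ ν : ℝ) {M : ℝ}
    (hM : M = 4 * μ * (y₀ - yR) + 8 * β * ν / (S.C.b * (y₀ - yR)) +
      γ * (2 * S.turnArea 0 (fun i => Y i (0, y₀)) (fun i => T i (0, y₀)) 0) +
      δ * (2 * (S.turnArea 0 (fun i => Y i (0, y₀)) (fun i => T i (0, y₀)) 1 +
        S.turnArea 0 (fun i => Y i (0, y₀)) (fun i => T i (0, y₀)) 2))) :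
    (0 < M → ∀ᶠ ε in 𝓝[>] (0 : ℝ),
      y₀ < Y 4 (ε • (![β, β, 0, 0, ν] + ε • ![μ, 0, γ, δ, 0]), y₀)) ∧
    (M < 0 → ∀ᶠ ε in 𝓝[>] (0 : ℝ),
      Y 4 (ε • (![β, β, 0, 0, ν] + ε • ![μ, 0, γ, δ, 0]), y₀) < y₀) := by
  set θ : ℝ → Fin 5 → ℝ := fun ε => ε • (![β, β, 0, 0, ν] + ε • ![μ, 0, γ, δ, 0]) with hθdef
  have hθ : Tendsto θ (𝓝[>] 0) (𝓝 0) := by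
    have : Continuous θ := by fun_prop
    have h0 := this.continuousWithinAt.tendsto (x := (0 : ℝ)) (s := Ioi 0)
    rwa [show θ 0 = 0 from zero_smul _ _] at h0
  obtain ⟨p0, pw, c3⟩ := h.velocity_left hS
  have hw : yL - Y 2 (0, y₀) = y₀ - yR :=
    (pow_left_inj₀ pw.le p0.le two_ne_zero).1 (by rw [c3]; ring)
  have hε0 : Tendsto (fun ε : ℝ => ε) (𝓝[>] 0) (𝓝 0) :=
    tendsto_nhdsWithin_of_tendsto_nhds tendsto_id
  have hbC := hS.bC_pos
  obtain ⟨u₁, w₂, w₃, A₀, A₁, A₂, ⟨hu, hw2, hw3⟩, ⟨h0, h1, h2⟩, hev⟩ := h.along_curve hS hθ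
  rw [hw] at hw2 hw3
  generalize S.turnArea 0 (fun i => Y i (0, y₀)) (fun i => T i (0, y₀)) 0 = B₀ at *
  generalize S.turnArea 0 (fun i => Y i (0, y₀)) (fun i => T i (0, y₀)) 1 = B₁ at *
  generalize S.turnArea 0 (fun i => Y i (0, y₀)) (fun i => T i (0, y₀)) 2 = B₂ at *
  refine h.sign_displacement hS hθ 2 (N := fun ε => 2 * μ * ((y₀ - yR) + u₁ ε) +
    2 * γ * A₀ ε + 2 * δ * (A₁ ε + A₂ ε) +
    2 * β * (2 * ((4 * ν / S.C.b - ε * (2 * δ * A₁ ε)) / (w₂ ε + u₁ ε)) -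
      ε * (2 * μ + 2 * γ * A₀ ε / ((y₀ - yR) + u₁ ε)))) ?_ ?_
  · have hne : (y₀ - yR) + (y₀ - yR) ≠ 0 := by linarith
    have hl := ((((hu.const_add (y₀ - yR)).const_mul (2 * μ)).add (h0.const_mul (2 * γ))).add
      ((h1.add h2).const_mul (2 * δ))).add
      ((((((hε0.mul (h1.const_mul (2 * δ))).const_sub (4 * ν / S.C.b)).div
        (hw2.add hu) hne).const_mul 2).sub (hε0.mul (((h0.const_mul (2 * γ)).div
        (hu.const_add (y₀ - yR)) hne).const_add (2 * μ)))).const_mul (2 * β))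
    have hval : M = 2 * μ * ((y₀ - yR) + (y₀ - yR)) + 2 * γ * B₀ + 2 * δ * (B₁ + B₂) +
        2 * β * (2 * ((4 * ν / S.C.b - 0 * (2 * δ * B₁)) / ((y₀ - yR) + (y₀ - yR))) -
          0 * (2 * μ + 2 * γ * B₀ / ((y₀ - yR) + (y₀ - yR)))) := by
      have := hbC.ne'
      have := p0.ne'
      rw [hM, ← two_mul]
      field_simp
      ring
    rw [hval]
    exact hl
  · filter_upwards [hev, self_mem_nhdsWithin] with ε ⟨⟨q1, q2, q3⟩, b0, b1, b2, b3⟩ hε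
    have t0 : θ ε 0 = ε * β + ε ^ 2 * μ := by simp [hθdef]; ring
    have t1 : θ ε 1 = ε * β := by simp [hθdef]
    have t2 : θ ε 2 = ε ^ 2 * γ := by simp [hθdef]; ring
    have t3 : θ ε 3 = ε ^ 2 * δ := by simp [hθdef]; ring
    have t4 : θ ε 4 = ε * ν := by simp [hθdef]
    rw [t0, t2] at b0
    rw [t3, t4] at b1 b3
    rw [t1] at b2
    generalize Y 4 (θ ε, y₀) = y4 at b3 ⊢
    generalize u₁ ε = u1 at *
    generalize w₂ ε = w2 at *
    generalize w₃ ε = w3 at *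
    generalize A₀ ε = a0 at *
    generalize A₁ ε = a1 at *
    generalize A₂ ε = a2 at *
    generalize y₀ - yR = u0 at *
    have hq1 : u0 + u1 ≠ 0 := by linarith
    have hq2 : w2 + u1 ≠ 0 := by linarith
    have hb' := hbC.ne'
    have d3 : w3 = w2 - 2 * ε * β := by
      have : w2 + w3 ≠ 0 := by linarith
      exact mul_left_cancel₀ this (by linear_combination b2)
    obtain ⟨D1, hD1⟩ : ∃ D1, D1 = 2 * μ + 2 * γ * a0 / (u0 + u1) := ⟨_, rfl⟩
    obtain ⟨D2, hD2⟩ : ∃ D2, D2 = (4 * ν / S.C.b - ε * (2 * δ * a1)) / (w2 + u1) := ⟨_, rfl⟩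
    rw [← hD1, ← hD2]
    have d1 : u1 - u0 = 2 * ε * β + ε ^ 2 * D1 := by
      have hD1' : (u0 + u1) * D1 = 2 * μ * (u0 + u1) + 2 * γ * a0 := by
        rw [hD1, mul_add, mul_div_cancel₀ _ hq1]; ring
      exact mul_left_cancel₀ hq1 (by linear_combination b0 - ε ^ 2 * hD1')
    have d2 : u1 - w2 = ε * D2 := by
      have hD2' : (w2 + u1) * D2 = 4 * ν / S.C.b - ε * (2 * δ * a1) := by
        rw [hD2, mul_div_cancel₀ _ hq2]
      have hb2 : 4 * (S.C.D * 0 + S.C.b * (ε * ν)) / S.C.b ^ 2 = ε * (4 * ν / S.C.b) := by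
        field_simp
        ring
      rw [hb2] at b1
      exact mul_left_cancel₀ hq2 (by linear_combination -b1 - ε * hD2')
    linear_combination b0 + b1 + b2 + b3 + 2 * ε * β * (2 * d2 - d1 - d3)

end

/-! ### Sign changes of combinations of independent functions -/

/-- A continuous function that changes sign from plus to minus between `a` and `b`, and vanishes
identically on no interval, takes both signs arbitrarily close to some point. -/
theorem exists_sign_change {f : ℝ → ℝ} {a b : ℝ} (hab : a < b) (hf : ContinuousOn f (Icc a b))
    (ha : 0 < f a) (hb : f b < 0)
    (hne : ∀ s t, a ≤ s → s < t → t ≤ b → ∃ y ∈ Ioo s t, f y ≠ 0) :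
    ∃ h ∈ Ioo a b, ∀ η > 0, ∃ s t, |s - h| < η ∧ |t - h| < η ∧ s ∈ Icc a b ∧ t ∈ Icc a b ∧
      0 < f s ∧ f t < 0 := by
  set A := {t | t ∈ Icc a b ∧ 0 < f t} with hA
  have hAa : a ∈ A := ⟨⟨le_rfl, hab.le⟩, ha⟩
  have hbdd : BddAbove A := ⟨b, fun t ht => ht.1.2⟩
  set h := sSup A with hh
  have hah : a ≤ h := le_csSup hbdd hAa
  have hhb : h ≤ b := csSup_le ⟨a, hAa⟩ fun t ht => ht.1.2
  have hafter : ∀ t, h < t → t ≤ b → f t ≤ 0 := fun t ht htb => by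
    by_contra hcon
    exact absurd (le_csSup hbdd ⟨⟨hah.trans ht.le, htb⟩, not_le.1 hcon⟩) ht.not_ge
  have h1 : a < h := by
    have := (hf a ⟨le_rfl, hab.le⟩).eventually (lt_mem_nhds ha)
    rw [eventually_nhdsWithin_iff] at this
    obtain ⟨r, hr, hball⟩ := Metric.eventually_nhds_iff.1 this
    have hm : min (r / 2) (b - a) > 0 := lt_min (by linarith) (by linarith)
    have hmem : a + min (r / 2) (b - a) ∈ A := by
      have h2 := min_le_right (r / 2) (b - a)
      have h3 := min_le_left (r / 2) (b - a)
      refine ⟨⟨by linarith, by linarith⟩, hball ?_ ⟨by linarith, by linarith⟩⟩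
      rw [Real.dist_eq, add_sub_cancel_left, abs_of_pos hm]
      linarith
    exact (lt_add_of_pos_right a hm).trans_le (le_csSup hbdd hmem)
  have h2 : h < b := by
    have := (hf b ⟨hab.le, le_rfl⟩).eventually (gt_mem_nhds hb)
    rw [eventually_nhdsWithin_iff] at this
    obtain ⟨r, hr, hball⟩ := Metric.eventually_nhds_iff.1 this
    by_contra hcon
    have hhb' : h = b := le_antisymm hhb (not_lt.1 hcon)
    obtain ⟨t, ht, htr⟩ := exists_lt_of_lt_csSup ⟨a, hAa⟩ (show b - r < sSup A by
      rw [← hh, hhb']; linarith)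
    have := hball (y := t) (by
      rw [Real.dist_eq, abs_of_nonpos (by linarith [ht.1.2])]; linarith) ht.1
    exact lt_asymm this ht.2
  refine ⟨h, ⟨h1, h2⟩, fun η hη => ?_⟩
  obtain ⟨s, hs, hsη⟩ := exists_lt_of_lt_csSup ⟨a, hAa⟩ (show h - η < sSup A by linarith)
  have hsh := le_csSup hbdd hs
  have hm : min (η / 2) (b - h) > 0 := lt_min (by linarith) (by linarith)
  have h3 := min_le_left (η / 2) (b - h)
  have h4 := min_le_right (η / 2) (b - h)
  obtain ⟨t, ht, htne⟩ := hne h (h + min (η / 2) (b - h)) hah (by linarith) (by linarith)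
  refine ⟨s, t, ?_, ?_, hs.1, ⟨hah.trans ht.1.le, by linarith [ht.2]⟩, hs.2,
    lt_of_le_of_ne (hafter t ht.1 (by linarith [ht.2])) htne⟩
  · rw [abs_of_nonpos (by linarith)]; linarith
  · rw [abs_of_pos (by linarith [ht.1])]; linarith [ht.2]

/-- Functions that are independent on an interval can be interpolated at suitable points. -/
theorem exists_interpolation {n : ℕ} (f : Fin n → ℝ → ℝ) (A : Set ℝ)
    (hind : ∀ c : Fin n → ℝ, (∀ y ∈ A, ∑ i, c i * f i y = 0) → c = 0) :
    ∃ q : Fin n → ℝ, StrictMono q ∧ (∀ j, q j ∈ A) ∧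
      ∀ v : Fin n → ℝ, ∃ c : Fin n → ℝ, ∀ j, ∑ i, c i * f i (q j) = v j := by
  classical
  set F : ℝ → Fin n → ℝ := fun y i => f i y with hF
  have hker : ∀ φ : (Fin n → ℝ) →ₗ[ℝ] ℝ, ∀ x, φ x = ∑ i, φ (Pi.single i 1) * x i := by
    intro φ x
    conv_lhs => rw [← Finset.univ_sum_single x]
    rw [map_sum]
    refine Finset.sum_congr rfl fun i _ => ?_
    rw [show (Pi.single i (x i) : Fin n → ℝ) = x i • Pi.single i 1 by
      rw [← Pi.single_smul, smul_eq_mul, mul_one], map_smul, smul_eq_mul, mul_comm]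
  have hspan : Submodule.span ℝ (F '' A) = ⊤ := by
    by_contra hne
    obtain ⟨φ, hφ, hle⟩ := Submodule.exists_le_ker_of_lt_top _ (lt_top_iff_ne_top.2 hne)
    have hc : (fun i => φ (Pi.single i 1)) = 0 := hind _ fun y hy => by
      have : φ (F y) = 0 := hle (Submodule.subset_span ⟨y, hy, rfl⟩)
      rwa [hker] at this
    refine hφ (LinearMap.ext fun x => ?_)
    rw [hker]
    simp [fun i => congrFun hc i]
  have hrank : Module.finrank ℝ (Submodule.span ℝ (F '' A)) = n := by
    rw [hspan, finrank_top, Module.finrank_fin_fun]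
  obtain ⟨g, hg, hgspan, hgind⟩ : ∃ g : Fin n → Fin n → ℝ, (∀ i, g i ∈ F '' A) ∧
      Submodule.span ℝ (range g) = Submodule.span ℝ (F '' A) ∧ LinearIndependent ℝ g := by
    have h := Submodule.exists_fun_fin_finrank_span_eq ℝ (F '' A)
    rwa [hrank] at h
  choose p hpA hpg using hg
  have hpinj : Function.Injective p := fun i j hij =>
    hgind.injective (by rw [← hpg i, ← hpg j, hij])
  have hcard : (Finset.univ.image p).card = n := by
    rw [Finset.card_image_of_injective _ hpinj, Finset.card_univ, Fintype.card_fin]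
  set q := (Finset.univ.image p).orderEmbOfFin hcard with hq
  have hrange : range q = range p := by
    rw [hq, Finset.range_orderEmbOfFin]; simp
  refine ⟨q, q.strictMono, fun j => ?_, ?_⟩
  · obtain ⟨i, hi⟩ : q j ∈ range p := hrange ▸ mem_range_self j
    rw [← hi]; exact hpA i
  · let L : (Fin n → ℝ) →ₗ[ℝ] (Fin n → ℝ) :=
      { toFun := fun c j => ∑ i, c i * f i (q j)
        map_add' := fun c d => by
          funext j; simp only [Pi.add_apply, add_mul, Finset.sum_add_distrib]
        map_smul' := fun a c => by
          funext j
          simp only [Pi.smul_apply, smul_eq_mul, RingHom.id_apply, Finset.mul_sum, mul_assoc] }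
    have hLinj : Function.Injective L := by
      rw [← LinearMap.ker_eq_bot, LinearMap.ker_eq_bot']
      intro c hc
      let ψ : (Fin n → ℝ) →ₗ[ℝ] ℝ := ∑ i, c i • LinearMap.proj i
      have hψ : ∀ x, ψ x = ∑ i, c i * x i := fun x => by simp [ψ]
      have hle : Submodule.span ℝ (F '' A) ≤ LinearMap.ker ψ := by
        rw [← hgspan, Submodule.span_le]
        rintro _ ⟨i, rfl⟩
        obtain ⟨j, hj⟩ : p i ∈ range q := hrange ▸ mem_range_self i
        have h1 : ∑ i, c i * f i (q j) = 0 := congrFun hc j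
        rw [SetLike.mem_coe, LinearMap.mem_ker, hψ, ← hpg i, ← hj]
        exact h1
      refine hind c fun y hy => ?_
      have := hle (Submodule.subset_span ⟨y, hy, rfl⟩)
      rwa [LinearMap.mem_ker, hψ] at this
    intro v
    obtain ⟨c, hc⟩ := LinearMap.surjective_of_injective hLinj v
    exact ⟨c, fun j => congrFun hc j⟩

/-- If four continuous functions are independent on every subinterval of an interval, then some
combination of them changes sign at three different points. -/
theorem exists_three_sign_changes {f : Fin 4 → ℝ → ℝ} {a b : ℝ} (hab : a < b)
    (hf : ∀ i, ContinuousOn (f i) (Ioo a b))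
    (hind : ∀ a' b', a ≤ a' → a' < b' → b' ≤ b → ∀ c : Fin 4 → ℝ,
      (∀ y ∈ Ioo a' b', ∑ i, c i * f i y = 0) → c = 0) :
    ∃ (c : Fin 4 → ℝ) (h : Fin 3 → ℝ), Function.Injective h ∧ (∀ i, h i ∈ Ioo a b) ∧
      ∀ i, ∀ η > 0, ∃ s t, |s - h i| < η ∧ |t - h i| < η ∧ s ∈ Ioo a b ∧ t ∈ Ioo a b ∧
        0 < ∑ j, c j * f j s ∧ ∑ j, c j * f j t < 0 := by
  obtain ⟨q, hq, hqm, hint⟩ := exists_interpolation f (Ioo a b) (hind a b le_rfl hab le_rfl)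
  obtain ⟨c, hc⟩ := hint ![1, -1, 1, -1]
  set g := fun y => ∑ j, c j * f j y with hg
  have hgc : ContinuousOn g (Ioo a b) :=
    continuousOn_finsetSum _ fun i _ => (hf i).const_smul (c i)
  have hc0 : c ≠ 0 := by
    rintro rfl
    have := hc 0
    simp at this
  have hne : ∀ s t, a ≤ s → s < t → t ≤ b → ∃ y ∈ Ioo s t, g y ≠ 0 := by
    intro s t h1 h2 h3
    by_contra hcon
    push Not at hcon
    exact hc0 (hind s t h1 h2 h3 c hcon)
  have g0 : g (q 0) = 1 := hc 0
  have g1 : g (q 1) = -1 := hc 1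
  have g2 : g (q 2) = 1 := hc 2
  have g3 : g (q 3) = -1 := hc 3
  have l01 : q 0 < q 1 := hq (by decide)
  have l12 : q 1 < q 2 := hq (by decide)
  have l23 : q 2 < q 3 := hq (by decide)
  have hsub : ∀ i j, Icc (q i) (q j) ⊆ Ioo a b := fun i j y hy =>
    ⟨(hqm i).1.trans_le hy.1, hy.2.trans_lt (hqm j).2⟩
  obtain ⟨h0, m0, H0⟩ := exists_sign_change l01 (hgc.mono (hsub 0 1)) (by rw [g0]; norm_num)
    (by rw [g1]; norm_num) fun s t h1 h2 h3 => hne s t ((hqm 0).1.le.trans h1) h2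
      (h3.trans (hqm 1).2.le)
  obtain ⟨h1, m1, H1⟩ := exists_sign_change (f := fun y => -g y) l12 (hgc.mono (hsub 1 2)).neg
    (by rw [g1]; norm_num) (by rw [g2]; norm_num) fun s t h1 h2 h3 => by
      simpa using hne s t ((hqm 1).1.le.trans h1) h2 (h3.trans (hqm 2).2.le)
  obtain ⟨h2, m2, H2⟩ := exists_sign_change l23 (hgc.mono (hsub 2 3)) (by rw [g2]; norm_num)
    (by rw [g3]; norm_num) fun s t h1 h2 h3 => hne s t ((hqm 2).1.le.trans h1) h2
      (h3.trans (hqm 3).2.le)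
  have hmono : StrictMono ![h0, h1, h2] := by
    rw [Fin.strictMono_iff_lt_succ]
    intro i
    fin_cases i
    · exact m0.2.trans m1.1
    · exact m1.2.trans m2.1
  refine ⟨c, ![h0, h1, h2], hmono.injective, fun i => ?_, fun i η hη => ?_⟩
  · fin_cases i
    · exact hsub 0 1 (Ioo_subset_Icc_self m0)
    · exact hsub 1 2 (Ioo_subset_Icc_self m1)
    · exact hsub 2 3 (Ioo_subset_Icc_self m2)
  · fin_cases i
    · obtain ⟨s, t, e1, e2, e3, e4, e5, e6⟩ := H0 η hη
      exact ⟨s, t, e1, e2, hsub _ _ e3, hsub _ _ e4, e5, e6⟩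
    · obtain ⟨s, t, e1, e2, e3, e4, e5, e6⟩ := H1 η hη
      exact ⟨t, s, e2, e1, hsub _ _ e4, hsub _ _ e3, neg_neg_iff_pos.1 e6, neg_pos.1 e5⟩
    · obtain ⟨s, t, e1, e2, e3, e4, e5, e6⟩ := H2 η hη
      exact ⟨s, t, e1, e2, hsub _ _ e3, hsub _ _ e4, e5, e6⟩

/-! ### Independence of the four functions in the displacement -/

theorem polynomial_eq_of_sq {p q : Polynomial ℝ} {a b c : ℝ} (hab : a < b) (hc : c ≤ a)
    (h : ∀ y ∈ Ioo a b, p.eval ((y - c) ^ 2) = q.eval ((y - c) ^ 2)) : p = q := by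
  refine Polynomial.eq_of_infinite_eval_eq p q ?_
  have hinj : InjOn (fun y : ℝ => (y - c) ^ 2) (Ioo a b) := fun x hx y hy hxy => by
    have := (pow_left_inj₀ (show 0 ≤ x - c by linarith [hx.1]) (show 0 ≤ y - c by linarith [hy.1])
      two_ne_zero).1 hxy
    linarith
  refine ((Ioo_infinite hab).image hinj).mono ?_
  rintro _ ⟨y, hy, rfl⟩
  exact h y hy

theorem hasDerivAt_eq_zero_of_eqOn {f : ℝ → ℝ} {f' a b y : ℝ} (hy : y ∈ Ioo a b)
    (hf : HasDerivAt f f' y) (h0 : ∀ y ∈ Ioo a b, f y = 0) : f' = 0 :=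
  (hf.congr_of_eventuallyEq ((eventually_of_mem (Ioo_mem_nhds hy.1 hy.2) h0).mono
    fun _ h => h.symm)).unique (hasDerivAt_const y 0)

section

open Polynomial

/-- Independence in the case `K ≠ 0`, in which `w = (u² - K)^(1/2)` is not rational in `u`. Two
differentiations remove `t` and `s`, and give a relation between rational functions of `u` and
`w`. -/
theorem independent_of_ne_zero {a b c K k r m g p q α β γ δ : ℝ} {w t s : ℝ → ℝ} (hab : a < b)
    (hc : c ≤ a) (hK : K ≠ 0) (hm : 0 < m) (hmK : 0 < m + K) (hg : g ≠ 0) (hq : q ≠ 0)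
    (hkr : r ≠ 0 → k ≠ 0) (hw : ∀ y ∈ Ioo a b, 0 < w y ∧ w y ^ 2 = (y - c) ^ 2 - K)
    (hw' : ∀ y ∈ Ioo a b, HasDerivAt w ((y - c) / w y) y)
    (ht : ∀ y ∈ Ioo a b, 0 < t y ∧ (y - c) ^ 2 + k ≠ 0 ∧ HasDerivAt t (r / ((y - c) ^ 2 + k)) y)
    (hs : ∀ y ∈ Ioo a b,
      HasDerivAt s (-g * (p + q * ((y - c) / w y)) / ((y - c) ^ 2 + m)) y)
    (h0 : ∀ y ∈ Ioo a b, α * (y - c) + β * w y + γ * (((y - c) ^ 2 + k) * t y) +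
      δ * (((y - c) ^ 2 + m) * s y) = 0) : α = 0 ∧ β = 0 ∧ γ = 0 ∧ δ = 0 := by
  have hu : ∀ y ∈ Ioo a b, 0 < y - c := fun y hy => by linarith [hy.1]
  have hm' : ∀ y, (y - c) ^ 2 + m ≠ 0 := fun y => by positivity
  obtain ⟨A, hA⟩ : ∃ A, A = α + γ * r - δ * g * p := ⟨_, rfl⟩
  obtain ⟨B, hB⟩ : ∃ B, B = β - δ * g * q := ⟨_, rfl⟩
  have hid : ∀ y, HasDerivAt (fun y : ℝ => y - c) 1 y := fun y => (hasDerivAt_id y).sub_const c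
  have hG : ∀ y ∈ Ioo a b, A / (y - c) + B / w y + 2 * γ * t y + 2 * δ * s y = 0 := by
    intro y hy
    have hsq : ∀ κ, HasDerivAt (fun y : ℝ => (y - c) ^ 2 + κ) (2 * (y - c)) y := fun κ =>
      (((hid y).pow 2).add_const κ).congr_deriv (by simp)
    have hd := (((((hid y).const_mul α).add ((hw' y hy).const_mul β)).add
      (((hsq k).mul (ht y hy).2.2).const_mul γ)).add (((hsq m).mul (hs y hy)).const_mul δ))
    have := hasDerivAt_eq_zero_of_eqOn hy hd h0
    have h1 := (hu y hy).ne'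
    have h2 := (hw y hy).1.ne'
    rw [mul_div_cancel₀ _ (ht y hy).2.1, mul_div_cancel₀ _ (hm' y)] at this
    rw [hA, hB]
    field_simp at this ⊢
    linear_combination this
  have hpoly : ∀ x : ℝ, (x - K) ^ 3 *
      (-A * (x + k) * (x + m) + 2 * γ * r * x * (x + m) - 2 * δ * g * p * x * (x + k)) ^ 2 =
      x ^ 3 * ((x + k) * (B * (x + m) + 2 * δ * g * q * (x - K))) ^ 2 := by
    have := polynomial_eq_of_sq (p := (X - C K) ^ 3 * (-C A * (X + C k) * (X + C m) +
        2 * C γ * C r * X * (X + C m) - 2 * C δ * C g * C p * X * (X + C k)) ^ 2)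
      (q := X ^ 3 * ((X + C k) * (C B * (X + C m) + 2 * C δ * C g * C q * (X - C K))) ^ 2)
      hab hc fun y hy => by
        have h1 := (hu y hy).ne'
        obtain ⟨h2, h3⟩ := hw y hy
        have hd := ((((hasDerivAt_const y A).div (hid y) h1).add
          ((hasDerivAt_const y B).div (hw' y hy) h2.ne')).add
          ((ht y hy).2.2.const_mul (2 * γ))).add ((hs y hy).const_mul (2 * δ))
        have h4 := hasDerivAt_eq_zero_of_eqOn hy hd hG
        have h5 := (ht y hy).2.1
        have h6 := hm' y
        simp only [eval_mul, eval_pow, eval_sub, eval_add, eval_neg, eval_X, eval_C, eval_ofNat]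
        rw [← h3]
        have hK' : (y - c) ^ 2 = w y ^ 2 + K := by rw [h3]; ring
        generalize y - c = u at *
        generalize w y = v at *
        have h7 : v ^ 3 * (-A * (u ^ 2 + k) * (u ^ 2 + m) + 2 * γ * r * u ^ 2 * (u ^ 2 + m) -
            2 * δ * g * p * u ^ 2 * (u ^ 2 + k)) =
            u ^ 3 * ((u ^ 2 + k) * (B * (u ^ 2 + m) + 2 * δ * g * q * v ^ 2)) := by
          have h8 := h2.ne'
          field_simp at h4
          linear_combination h4
        linear_combination (v ^ 3 * (-A * (u ^ 2 + k) * (u ^ 2 + m) +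
            2 * γ * r * u ^ 2 * (u ^ 2 + m) - 2 * δ * g * p * u ^ 2 * (u ^ 2 + k)) +
            u ^ 3 * ((u ^ 2 + k) * (B * (u ^ 2 + m) + 2 * δ * g * q * v ^ 2))) * h7
    intro x
    have := congrArg (eval x) this
    simpa using this
  -- between `0` and `K` the two sides have opposite signs, so that both of them vanish
  have hmid : ∀ x, x * (x - K) < 0 →
      (-A * (x + k) * (x + m) + 2 * γ * r * x * (x + m) - 2 * δ * g * p * x * (x + k)) = 0 ∧
      (x + k) * (B * (x + m) + 2 * δ * g * q * (x - K)) = 0 := by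
    intro x hx
    have h1 := hpoly x
    generalize (-A * (x + k) * (x + m) + 2 * γ * r * x * (x + m) -
      2 * δ * g * p * x * (x + k)) = R at *
    generalize (x + k) * (B * (x + m) + 2 * δ * g * q * (x - K)) = N at *
    have hx0 : x ≠ 0 := by rintro rfl; simp at hx
    have hxK : x - K ≠ 0 := by intro h; rw [h, mul_zero] at hx; exact lt_irrefl _ hx
    have h2 : x ^ 4 * N ^ 2 + (-(x * (x - K))) * ((x - K) ^ 2 * R ^ 2) = 0 := by
      linear_combination -x * h1
    have h3 : 0 ≤ x ^ 4 * N ^ 2 := by positivity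
    have h4 : 0 ≤ (-(x * (x - K))) * ((x - K) ^ 2 * R ^ 2) :=
      mul_nonneg (by linarith) (by positivity)
    have h5 : x ^ 4 * N ^ 2 = 0 := by linarith
    have h6 : (-(x * (x - K))) * ((x - K) ^ 2 * R ^ 2) = 0 := by linarith
    constructor
    · have := (mul_eq_zero.1 ((mul_eq_zero.1 h6).resolve_left (by linarith))).resolve_left
        (pow_ne_zero 2 hxK)
      exact pow_eq_zero_iff two_ne_zero |>.1 this
    · exact pow_eq_zero_iff two_ne_zero |>.1 ((mul_eq_zero.1 h5).resolve_left (pow_ne_zero 4 hx0))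
  have hinf : {x : ℝ | x * (x - K) < 0}.Infinite := by
    refine (Ioo_infinite (show min 0 K < max 0 K from min_lt_max.2 hK.symm)).mono fun x hx => ?_
    rcases lt_or_gt_of_ne hK with h | h
    · rw [min_eq_right h.le, max_eq_left h.le] at hx
      exact mul_neg_of_neg_of_pos hx.2 (by linarith [hx.1])
    · rw [min_eq_left h.le, max_eq_right h.le] at hx
      exact mul_neg_of_pos_of_neg hx.1 (by linarith [hx.2])
  have hR : ∀ x : ℝ,
      -A * (x + k) * (x + m) + 2 * γ * r * x * (x + m) - 2 * δ * g * p * x * (x + k) = 0 := by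
    have := Polynomial.eq_of_infinite_eval_eq (-C A * (X + C k) * (X + C m) +
        2 * C γ * C r * X * (X + C m) - 2 * C δ * C g * C p * X * (X + C k)) 0
      (hinf.mono fun x hx => by simpa using (hmid x hx).1)
    intro x
    simpa using congrArg (eval x) this
  have hN : ∀ x : ℝ, (x + k) * (B * (x + m) + 2 * δ * g * q * (x - K)) = 0 := by
    have := Polynomial.eq_of_infinite_eval_eq
      ((X + C k) * (C B * (X + C m) + 2 * C δ * C g * C q * (X - C K))) 0
      (hinf.mono fun x hx => by simpa using (hmid x hx).2)
    intro x
    simpa using congrArg (eval x) this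
  have habs := neg_abs_le k
  have n1 := (mul_eq_zero.1 (hN (|k| + 1))).resolve_left (by linarith)
  have n2 := (mul_eq_zero.1 (hN (|k| + 2))).resolve_left (by linarith)
  have n3 : B = -(2 * δ * g * q) := by linear_combination n2 - n1
  have n4 : δ * (g * q * (m + K)) = 0 := by
    rw [n3] at n1
    linear_combination -n1 / 2
  have hδ : δ = 0 := (mul_eq_zero.1 n4).resolve_right (mul_ne_zero (mul_ne_zero hg hq) hmK.ne')
  subst hδ
  have hβ : β = 0 := by rw [hB] at n3; linear_combination n3
  have r0 := hR 0
  have r1 := hR 1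
  have hAk : A * k = 0 :=
    (mul_eq_zero.1 (show m * (A * k) = 0 by linear_combination -r0)).resolve_left
    hm.ne'
  have hAr : A = 2 * γ * r := by
    have : (1 + m) * (A - 2 * γ * r) = 0 := by linear_combination -r1 - (1 + m) * hAk
    linear_combination (mul_eq_zero.1 this).resolve_left (by positivity)
  have hy : (a + b) / 2 ∈ Ioo a b := ⟨by linarith, by linarith⟩
  have hA0 : A = 0 := by
    rcases eq_or_ne r 0 with hr | hr
    · rw [hAr, hr, mul_zero]
    · exact (mul_eq_zero.1 hAk).resolve_right (hkr hr)
  have hγ : γ = 0 := by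
    have := hG _ hy
    rw [hA0, hB, hβ] at this
    simp only [zero_div, zero_mul, mul_zero, sub_zero, add_zero, zero_add] at this
    have := (mul_eq_zero.1 this).resolve_right (ht _ hy).1.ne'
    linarith
  refine ⟨?_, hβ, hγ, rfl⟩
  rw [hA0, hγ] at hA
  linarith

/-- Independence in the case `K = 0`. -/
theorem independent_of_eq_zero {a b c k r₁ m r₂ α β γ δ : ℝ} {t s : ℝ → ℝ} (hab : a < b)
    (hc : c ≤ a) (hm : 0 < m) (hr₂ : r₂ ≠ 0) (hkr : k ≠ 0 ↔ r₁ ≠ 0)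
    (ht : ∀ y ∈ Ioo a b, 0 < t y ∧ (y - c) ^ 2 + k ≠ 0 ∧ HasDerivAt t (r₁ / ((y - c) ^ 2 + k)) y)
    (hs : ∀ y ∈ Ioo a b, HasDerivAt s (r₂ / ((y - c) ^ 2 + m)) y)
    (hkm : k = m → ∀ y ∈ Ioo a b, r₂ * t y ≠ r₁ * s y)
    (h0 : ∀ y ∈ Ioo a b, α * (y - c) + β * (1 / (y - c)) + γ * (((y - c) ^ 2 + k) * t y) +
      δ * (((y - c) ^ 2 + m) * s y) = 0) : α = 0 ∧ β = 0 ∧ γ = 0 ∧ δ = 0 := by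
  have hu : ∀ y ∈ Ioo a b, 0 < y - c := fun y hy => by linarith [hy.1]
  have hm' : ∀ y, (y - c) ^ 2 + m ≠ 0 := fun y => by positivity
  obtain ⟨A, hA⟩ : ∃ A, A = α + γ * r₁ + δ * r₂ := ⟨_, rfl⟩
  have hid : ∀ y, HasDerivAt (fun y : ℝ => y - c) 1 y := fun y => (hasDerivAt_id y).sub_const c
  have hG : ∀ y ∈ Ioo a b, A / (y - c) - β / (y - c) ^ 3 + 2 * γ * t y + 2 * δ * s y = 0 := by
    intro y hy
    have hsq : ∀ κ, HasDerivAt (fun y : ℝ => (y - c) ^ 2 + κ) (2 * (y - c)) y := fun κ =>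
      (((hid y).pow 2).add_const κ).congr_deriv (by simp)
    have h1 := (hu y hy).ne'
    have hd := (((((hid y).const_mul α).add
      (((hasDerivAt_const y (1 : ℝ)).div (hid y) h1).const_mul β)).add
      (((hsq k).mul (ht y hy).2.2).const_mul γ)).add (((hsq m).mul (hs y hy)).const_mul δ))
    have := hasDerivAt_eq_zero_of_eqOn hy hd h0
    rw [mul_div_cancel₀ _ (ht y hy).2.1, mul_div_cancel₀ _ (hm' y)] at this
    rw [hA]
    field_simp at this ⊢
    linear_combination this
  have hpoly : ∀ x : ℝ, (3 * β - A * x) * (x + k) * (x + m) + 2 * γ * r₁ * x ^ 2 * (x + m) +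
      2 * δ * r₂ * x ^ 2 * (x + k) = 0 := by
    have := polynomial_eq_of_sq (p := (3 * C β - C A * X) * (X + C k) * (X + C m) +
        2 * C γ * C r₁ * X ^ 2 * (X + C m) + 2 * C δ * C r₂ * X ^ 2 * (X + C k)) (q := 0)
      hab hc fun y hy => by
        have h1 := (hu y hy).ne'
        have hcube : HasDerivAt (fun y : ℝ => (y - c) ^ 3) (3 * (y - c) ^ 2) y :=
          ((hid y).pow 3).congr_deriv (by simp)
        have hd := ((((hasDerivAt_const y A).div (hid y) h1).sub
          ((hasDerivAt_const y β).div hcube (pow_ne_zero 3 h1))).add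
          ((ht y hy).2.2.const_mul (2 * γ))).add ((hs y hy).const_mul (2 * δ))
        have h4 := hasDerivAt_eq_zero_of_eqOn hy hd hG
        have h5 := (ht y hy).2.1
        have h6 := hm' y
        simp only [eval_mul, eval_pow, eval_sub, eval_add, eval_X, eval_C, eval_ofNat, eval_zero]
        generalize y - c = u at *
        field_simp at h4
        linear_combination h4
    intro x
    simpa using congrArg (eval x) this
  have hy : (a + b) / 2 ∈ Ioo a b := ⟨by linarith, by linarith⟩
  have p0 := hpoly 0
  have p1 := hpoly 1
  have p2 := hpoly 2
  have p3 := hpoly (-1)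
  by_cases hk : k = 0
  · have hr₁ : r₁ = 0 := by by_contra h; exact hkr.2 h hk
    rw [hk, hr₁] at p1 p2 p3
    -- the relation is `x` times a quadratic polynomial, hence all coefficients vanish
    have hβ : β = 0 := by
      have : m * β = 0 := by linear_combination (p1 * 3 - p2 / 2 - p3) / 9
      exact (mul_eq_zero.1 this).resolve_left hm.ne'
    rw [hβ] at p1 p2 p3
    have hA0 : A = 0 := by
      have : m * A = 0 := by linear_combination (p2 / 4 - p1 * 2 )
      exact (mul_eq_zero.1 this).resolve_left hm.ne'
    rw [hA0] at p1
    have hδ : δ = 0 := by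
      have : δ * r₂ = 0 := by linear_combination p1 / 2
      exact (mul_eq_zero.1 this).resolve_right hr₂
    have hγ : γ = 0 := by
      have := hG _ hy
      rw [hA0, hβ, hδ] at this
      simp only [zero_div, mul_zero, zero_mul, sub_zero, zero_add, add_zero] at this
      have := (mul_eq_zero.1 this).resolve_right (ht _ hy).1.ne'
      linarith
    refine ⟨?_, hβ, hγ, hδ⟩
    rw [hA0, hγ, hδ] at hA
    linarith
  · have hr₁ := hkr.1 hk
    have hβ : β = 0 := by
      have : β * (k * m) = 0 := by linear_combination p0 / 3
      exact (mul_eq_zero.1 this).resolve_right (mul_ne_zero hk hm.ne')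
    rw [hβ] at p1 p2 p3
    have hA0 : A = 0 := by
      have : A * (k * m) = 0 := by linear_combination p2 / 6 - p1 + p3 / 3
      exact (mul_eq_zero.1 this).resolve_right (mul_ne_zero hk hm.ne')
    rw [hA0] at p1 p2 hA
    have q1 : γ * r₁ = -(δ * r₂) := by linear_combination p2 / 8 - p1 / 2
    have q2 : δ * (r₂ * (k - m)) = 0 := by linear_combination p1 / 2 - (1 + m) * q1
    have hδ : δ = 0 := by
      by_contra hδ
      have hkm' : k = m := by
        have := (mul_eq_zero.1 ((mul_eq_zero.1 q2).resolve_left hδ)).resolve_left hr₂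
        linarith
      have h1 := hG _ hy
      rw [hA0, hβ] at h1
      simp only [zero_div, sub_zero, zero_add] at h1
      refine hkm hkm' _ hy (mul_left_cancel₀ hδ ?_)
      linear_combination -(r₁ / 2) * h1 + t ((a + b) / 2) * q1
    have hγ : γ = 0 := by
      rw [hδ, zero_mul, neg_zero] at q1
      exact (mul_eq_zero.1 q1).resolve_right hr₁
    refine ⟨?_, hβ, hγ, hδ⟩
    rw [hγ, hδ] at hA
    linarith

end

/-! ### Comparison of the transition times -/

section

variable {S : HamSystem} {ξ yR yL : ℝ} {y₀ : ℝ} {Y : Fin 5 → (Fin 5 → ℝ) × ℝ → ℝ}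
  {T : Fin 4 → (Fin 5 → ℝ) × ℝ → ℝ}

theorem hasDerivAt_sin_div {v : ℝ} (hv : v ≠ 0) (t : ℝ) :
    HasDerivAt (fun t => Real.sin (v * t) / v) (Real.cos (v * t)) t := by
  have := ((((hasDerivAt_id t).const_mul v)).sin).div_const v
  exact this.congr_deriv (by simp only [id, mul_one]; field_simp)

theorem hasDerivAt_cos_mul {v D : ℝ} (hv : v ≠ 0) (hD : v ^ 2 = D) (t : ℝ) :
    HasDerivAt (fun t => Real.cos (v * t)) (-D * (Real.sin (v * t) / v)) t := by
  have := (((hasDerivAt_id t).const_mul v)).cos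
  exact this.congr_deriv (by simp only [id, mul_one, ← hD]; field_simp)

/-- A solution of `x'' = -D x` that starts at distance `1` from the center returns to this distance
within half a period. -/
theorem time_le_half_period {x V : ℝ → ℝ} {D τ : ℝ} (hD : 0 < D)
    (hx : ∀ t, HasDerivAt x (V t) t) (hV : ∀ t, HasDerivAt V (-D * x t + D * 0) t)
    (h0 : x 0 ^ 2 = 1) (hin : ∀ t ∈ Ioo 0 τ, 0 < 1 - x t ^ 2) : √D * τ ≤ Real.pi := by
  have hω := Real.sqrt_pos.2 hD
  by_contra hcon
  have hmem : Real.pi / √D ∈ Ioo 0 τ := by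
    refine ⟨div_pos Real.pi_pos hω, ?_⟩
    rw [div_lt_iff₀ hω, mul_comm]
    exact not_le.1 hcon
  obtain ⟨-, r⟩ := solution_relations hx hV (hasDerivAt_sin_div hω.ne')
    (hasDerivAt_cos_mul hω.ne' (Real.sq_sqrt hD.le)) (by simp) (by simp) (Real.pi / √D)
  rw [mul_div_cancel₀ _ hω.ne', Real.cos_pi, Real.sin_pi] at r
  have : x (Real.pi / √D) = -x 0 := mul_left_cancel₀ hD.ne' (by linear_combination -r)
  have h1 := hin _ hmem
  rw [this, neg_sq, h0] at h1
  linarith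

/-- In the case `K = 0` the two transition times are never in the ratio in which their derivatives
are if `k = m`: that would make the phase along the right arc, which exceeds `π`, the mean of the
phases along the two central arcs, which do not. -/
theorem HamSystem.IsReturn.time_ratio (hS : S.NormalForm 0 yR yL) (h : S.IsReturn y₀ Y T)
    (hkm : S.pull ^ 2 / (S.R.D * S.R.b ^ 2) = S.C.D / S.C.b ^ 2) :
    -(4 / S.C.b) * T 0 (0, y₀) ≠ 2 * S.pull / (S.R.D * S.R.b) * (T 1 (0, y₀) + T 3 (0, y₀)) := by
  intro heq
  have t0 := h.turn_zero.right.pos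
  have t1 := h.turn_zero.lower.pos
  have t3 := h.turn_zero.upper.pos
  have bC := hS.bC_pos
  have bR := hS.bR_pos
  have hDC := hS.D_pos
  have hd0 : S.pull ≠ 0 := by
    intro h0
    rw [h0, zero_pow two_ne_zero, zero_div] at hkm
    exact (div_pos hDC (pow_pos bC 2)).ne hkm
  have hDR : 0 < S.R.D := by
    have h1 : 0 < S.pull ^ 2 / (S.R.D * S.R.b ^ 2) := hkm ▸ div_pos hDC (pow_pos bC 2)
    rcases div_pos_iff.1 h1 with ⟨-, h2⟩ | ⟨h2, -⟩
    · exact pos_of_mul_pos_left h2 (pow_pos bR 2).le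
    · exact absurd h2 (sq_nonneg _).not_gt
  have hd : S.pull < 0 := by
    by_contra hcon
    have h1 : 0 ≤ 2 * S.pull / (S.R.D * S.R.b) * (T 1 (0, y₀) + T 3 (0, y₀)) :=
      mul_nonneg (div_nonneg (by linarith) (mul_pos hDR bR).le) (by linarith)
    have h2 : 0 < 4 / S.C.b * T 0 (0, y₀) := mul_pos (by positivity) t0
    linarith
  have hωR := Real.sqrt_pos.2 hDR
  have hωC := Real.sqrt_pos.2 hDC
  have hsR := Real.sq_sqrt hDR.le
  have hsC := Real.sq_sqrt hDC.le
  -- the right arc takes more than half a period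
  have hR : Real.pi < √S.R.D * T 0 (0, y₀) := by
    obtain ⟨x, V, hx, hV, x0, x1, V0, V1, -⟩ := h.turn_zero.right_relations hS
    obtain ⟨r1, r2⟩ := solution_relations hx hV (hasDerivAt_sin_div hωR.ne')
      (hasDerivAt_cos_mul hωR.ne' hsR) (by simp) (by simp) (T 0 (0, y₀))
    have hu := (h.velocity_left hS).1
    rw [h.start] at V0 V1
    rw [x1, V1, V0] at r1
    rw [x1, V1, x0] at r2
    have hv : 0 < S.R.b * (y₀ - yR) := mul_pos bR hu
    set s := Real.sin (√S.R.D * T 0 (0, y₀)) / √S.R.D with hs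
    have key : s * (S.R.D * (S.R.b * (y₀ - yR)) ^ 2 + S.pull ^ 2) =
        2 * S.pull * (S.R.b * (y₀ - yR)) := by
      rw [HamSystem.pull]
      linear_combination (S.R.D - (S.R.a * S.R.α + S.R.b * S.R.β)) * r1 +
        S.R.b * (y₀ - yR) * r2
    have hsneg : s < 0 := by
      by_contra hcon
      have h1 : 0 ≤ s * (S.R.D * (S.R.b * (y₀ - yR)) ^ 2 + S.pull ^ 2) :=
        mul_nonneg (not_lt.1 hcon) (by positivity)
      have h2 : S.pull * (S.R.b * (y₀ - yR)) < 0 := mul_neg_of_neg_of_pos hd hv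
      linarith
    by_contra hcon
    have := Real.sin_nonneg_of_nonneg_of_le_pi (mul_pos hωR t0).le (not_lt.1 hcon)
    exact hsneg.not_ge (div_nonneg this hωR.le)
  have h1 : √S.C.D * T 1 (0, y₀) ≤ Real.pi := by
    obtain ⟨x, V, hx, hV, x0, -, -, -, -, hin⟩ := h.turn_zero.lower_relations hS
    exact time_le_half_period hDC hx hV (by rw [x0]; norm_num) hin
  have h3 : √S.C.D * T 3 (0, y₀) ≤ Real.pi := by
    obtain ⟨x, V, hx, hV, x0, -, -, -, -, hin⟩ := h.turn_zero.upper_relations hS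
    exact time_le_half_period hDC hx hV (by rw [x0]; norm_num) hin
  have hrat : -S.pull * S.C.b = √S.C.D * (√S.R.D * S.R.b) := by
    have h4 : (-S.pull * S.C.b) ^ 2 = (√S.C.D * (√S.R.D * S.R.b)) ^ 2 := by
      rw [mul_pow, mul_pow, mul_pow, hsR, hsC]
      have := hDR.ne'
      have := bR.ne'
      have := bC.ne'
      field_simp at hkm
      linear_combination hkm
    refine (pow_left_inj₀ ?_ ?_ two_ne_zero).1 h4
    · exact mul_nonneg (by linarith) bC.le
    · positivity
  have h5 : 2 * (√S.R.D * T 0 (0, y₀)) = √S.C.D * T 1 (0, y₀) + √S.C.D * T 3 (0, y₀) := by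
    have := bR.ne'
    have := bC.ne'
    have := hDR.ne'
    field_simp at heq
    have h6 : (√S.R.D * S.R.b) * (2 * (√S.R.D * T 0 (0, y₀))) = (√S.R.D * S.R.b) *
        (√S.C.D * T 1 (0, y₀) + √S.C.D * T 3 (0, y₀)) := by
      have h7 : (√S.R.D * S.R.b) * (2 * (√S.R.D * T 0 (0, y₀))) =
          2 * S.R.D * S.R.b * T 0 (0, y₀) := by
        rw [← hsR]; ring_nf
        rw [Real.sqrt_sq hωR.le]
      rw [h7]
      linear_combination (T 1 (0, y₀) + T 3 (0, y₀)) * hrat - heq / 2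
    exact mul_left_cancel₀ (mul_pos hωR bR).ne' h6
  linarith

/-! ### Bifurcation of three limit cycles -/

/-- From a displacement whose leading part ranges over the combinations of four independent
functions, to three limit cycles. -/
theorem HamSystem.exists_three_limitCycles {J : Set ℝ} (hJo : IsOpen J)
    (hJ : ∀ h ∈ J, ∃ (γ : ℝ → ℝ × ℝ) (T : ℝ), S.unperturbed.IsAnnulusOrbit γ T h)
    (hS : S.NormalForm ξ yR yL) {y : Fin 5 → ℝ} {τ : Fin 4 → ℝ} (h : S.IsTurn 0 y τ)
    (hy : y 0 ∈ J) (Good : (ℝ → Perturbation) → Prop)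
    (hf : ∀ (Y : Fin 5 → (Fin 5 → ℝ) × ℝ → ℝ) (T : Fin 4 → (Fin 5 → ℝ) × ℝ → ℝ),
      ∃ f : Fin 4 → ℝ → ℝ, (∀ z, S.IsReturn z Y T → ∀ i, ContinuousAt (f i) z) ∧
        (∀ a b, a < b → yR ≤ a → (∀ z ∈ Ioo a b, S.IsReturn z Y T) → ∀ c : Fin 4 → ℝ,
          (∀ z ∈ Ioo a b, ∑ i, c i * f i z = 0) → c = 0) ∧
        ∀ c : Fin 4 → ℝ, ∃ (P : ℝ → Perturbation) (θ : ℝ → Fin 5 → ℝ), Good P ∧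
          Tendsto θ (𝓝[>] 0) (𝓝 0) ∧
          (∀ᶠ ε in 𝓝[>] (0 : ℝ), S.perturbed (P ε) ε = (S.deform (θ ε)).toField) ∧
          ∀ z, S.IsReturn z Y T →
            (0 < ∑ i, c i * f i z → ∀ᶠ ε in 𝓝[>] (0 : ℝ), z < Y 4 (θ ε, z)) ∧
            (∑ i, c i * f i z < 0 → ∀ᶠ ε in 𝓝[>] (0 : ℝ), Y 4 (θ ε, z) < z)) :
    ∃ P, Good P ∧ S.LimitCyclesBifurcate J P 3 := by
  have hpos := h.position hS
  obtain ⟨Y, T, θ', φ, htr, hYc, hTc, hYv, hst, hturn⟩ := h.persist hpos.2.1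
  obtain ⟨f, hfc, hind, hsgn⟩ := hf Y T
  have hret : S.IsReturn (y 0) Y T := ⟨hYc, hTc, hst, hturn⟩
  have hret' := hret.eventually_nhds
  obtain ⟨ρ, hρ, hbif⟩ := htr.limitCyclesBifurcate hJ S.unperturbed_eq hpos.1
    (hret'.mono fun z hz => by rw [(hz.turn_zero.closes hS).2.2.1, hst])
  obtain ⟨r, hr, hball⟩ := Metric.eventually_nhds_iff.1 (hret'.and (hJo.mem_nhds hy))
  set η := min (min r ρ) (y 0 - yR) with hη
  have hη0 : 0 < η := lt_min (lt_min hr hρ) (by linarith [hpos.1])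
  have hηr : η ≤ r := (min_le_left _ _).trans (min_le_left _ _)
  have hηρ : η ≤ ρ := (min_le_left _ _).trans (min_le_right _ _)
  have hηy : η ≤ y 0 - yR := min_le_right _ _
  have hIabs : ∀ z ∈ Ioo (y 0 - η) (y 0 + η), |z - y 0| < η := fun z hz => by
    rw [abs_lt]; constructor <;> linarith [hz.1, hz.2]
  have hI : ∀ z ∈ Ioo (y 0 - η) (y 0 + η), S.IsReturn z Y T ∧ z ∈ J := fun z hz =>
    hball (by rw [Real.dist_eq]; exact (hIabs z hz).trans_le hηr)
  obtain ⟨c, q, hqinj, hqm, hq⟩ := exists_three_sign_changes (f := f)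
    (show y 0 - η < y 0 + η by linarith)
    (fun i z hz => (hfc z (hI z hz).1 i).continuousWithinAt)
    (fun a b ha hab hb => hind a b hab (by linarith) fun z hz =>
      (hI z ⟨ha.trans_lt hz.1, hz.2.trans_le hb⟩).1)
  obtain ⟨P, θ, hP, hθ, hpert, hsign⟩ := hsgn c
  refine ⟨P, hP, hbif P θ hθ hpert 3 q hqinj (fun i => ⟨(hI _ (hqm i)).2,
    (hIabs _ (hqm i)).trans_le hηρ⟩) fun i κ hκ => ?_⟩
  obtain ⟨s, t, hs, ht, hsI, htI, hs0, ht0⟩ := hq i κ hκ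
  exact ⟨s, t, hs, ht, ((hsign s (hI s hsI).1).1 hs0).and ((hsign t (hI t htI).1).2 ht0)⟩

theorem HamSystem.exists_bounded_pert (S : HamSystem) :
    ∃ κ > 0, ∀ e : Fin 5 → ℝ, (∀ i, |e i| ≤ κ) → (S.pert e).Bounded := by
  set N := |S.L.b| + |S.C.b * S.C.a| + |S.C.b * S.C.b| + (|S.C.b * S.C.α| + 1) +
    |S.R.b| + |S.R.b * S.R.a| + |S.R.b * S.R.b| + |S.R.b * S.R.α| with hN
  have h1 := abs_nonneg S.L.b
  have h2 := abs_nonneg (S.C.b * S.C.a)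
  have h3 := abs_nonneg (S.C.b * S.C.b)
  have h4 := abs_nonneg (S.C.b * S.C.α)
  have h5 := abs_nonneg S.R.b
  have h6 := abs_nonneg (S.R.b * S.R.a)
  have h7 := abs_nonneg (S.R.b * S.R.b)
  have h8 := abs_nonneg (S.R.b * S.R.α)
  have hN0 : 0 < N := by linarith
  refine ⟨1 / N, by positivity, fun e he => ?_⟩
  have key : ∀ (A : ℝ) i, |A| ≤ N → |A * e i| ≤ 1 := fun A i hA => by
    rw [abs_mul]
    calc |A| * |e i| ≤ N * (1 / N) := mul_le_mul hA (he i) (abs_nonneg _) hN0.le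
      _ = 1 := by field_simp
  refine ⟨⟨?_, ?_, ?_, ?_, ?_, ?_⟩, ⟨?_, ?_, ?_, ?_, ?_, ?_⟩, ⟨?_, ?_, ?_, ?_, ?_, ?_⟩⟩ <;>
    simp only [HamSystem.pert, abs_zero, zero_le_one]
  · exact key _ 1 (by linarith)
  · rw [mul_right_comm]; exact key _ 3 (by linarith)
  · rw [mul_right_comm]; exact key _ 3 (by linarith)
  · rw [mul_right_comm]
    calc |S.C.b * S.C.α * e 3 + e 4| ≤ |S.C.b * S.C.α| * |e 3| + |e 4| := by
          rw [← abs_mul]; exact abs_add_le _ _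
      _ ≤ |S.C.b * S.C.α| * (1 / N) + 1 / N :=
          add_le_add (mul_le_mul_of_nonneg_left (he 3) h4) (he 4)
      _ = (|S.C.b * S.C.α| + 1) / N := by ring
      _ ≤ 1 := (div_le_one hN0).2 (by linarith)
  · exact key _ 0 (by linarith)
  · rw [mul_right_comm]; exact key _ 2 (by linarith)
  · rw [mul_right_comm]; exact key _ 2 (by linarith)
  · rw [mul_right_comm]; exact key _ 2 (by linarith)

/-- The bifurcation in the case `ξ ≠ 0`, with a perturbation that does not depend on `ε`. -/
theorem HamSystem.IsTurn.bifurcate_of_ne_zero {J : Set ℝ} (hJo : IsOpen J)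
    (hJ : ∀ h ∈ J, ∃ (γ : ℝ → ℝ × ℝ) (T : ℝ), S.unperturbed.IsAnnulusOrbit γ T h)
    (hS : S.NormalForm ξ yR yL) (hξ : ξ ≠ 0) {y : Fin 5 → ℝ} {τ : Fin 4 → ℝ}
    (h : S.IsTurn 0 y τ) (hy : y 0 ∈ J) :
    ∃ P : Perturbation, P.Bounded ∧ S.LimitCyclesBifurcate J (fun _ => P) 3 := by
  suffices ∃ P, (∃ P₀ : Perturbation, P₀.Bounded ∧ P = fun _ => P₀) ∧
      S.LimitCyclesBifurcate J P 3 by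
    obtain ⟨P, ⟨P₀, hP₀, rfl⟩, hP⟩ := this
    exact ⟨P₀, hP₀, hP⟩
  have bC := hS.bC_pos
  have bR := hS.bR_pos
  have hDC := hS.D_pos
  have hDR := hS.D_ne_zero
  have hξ1 := hS.neg_one_lt
  have hξ2 := hS.lt_one
  refine HamSystem.exists_three_limitCycles hJo hJ hS h hy _ fun Y T => ?_
  refine ⟨![fun z => z - yR, fun z => yL - Y 2 (0, z),
    fun z => ((z - yR) ^ 2 + S.pull ^ 2 / (S.R.D * S.R.b ^ 2)) * T 0 (0, z),
    fun z => ((z - yR) ^ 2 + S.C.D * (1 - ξ) ^ 2 / S.C.b ^ 2) * (T 1 (0, z) + T 3 (0, z))],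
    fun z hz i => ?_, fun a b hab ha hz c hc => ?_, fun c => ?_⟩
  · have c0 : ContinuousAt (fun z => z - yR) z := by fun_prop
    fin_cases i
    · exact c0
    · exact (hz.hasDerivAt_velocity_left hS).continuousAt
    · exact ((c0.pow 2).add continuousAt_const).mul
        (hz.hasDerivAt_time_right hS).2.continuousAt
    · exact ((c0.pow 2).add continuousAt_const).mul (hz.hasDerivAt_time_center hS).continuousAt
  · have := independent_of_ne_zero (K := 4 * S.C.D * ξ / S.C.b ^ 2)
      (m := S.C.D * (1 - ξ) ^ 2 / S.C.b ^ 2) (q := 1 + ξ) (r := 2 * S.pull / (S.R.D * S.R.b))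
      (g := 2 / S.C.b) (p := 1 - ξ) (w := fun z => yL - Y 2 (0, z)) (t := fun z => T 0 (0, z))
      (s := fun z => T 1 (0, z) + T 3 (0, z)) (k := S.pull ^ 2 / (S.R.D * S.R.b ^ 2))
      (α := c 0) (β := c 1) (γ := c 2) (δ := c 3)
      hab ha (by positivity) (by have : 0 < 1 - ξ := by linarith
                                 positivity)
      (by have h1 : 0 < 1 + ξ := by linarith
          have h2 : S.C.D * (1 - ξ) ^ 2 / S.C.b ^ 2 + 4 * S.C.D * ξ / S.C.b ^ 2 =
            S.C.D * (1 + ξ) ^ 2 / S.C.b ^ 2 := by ring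
          rw [h2]; positivity) (by positivity) (by linarith)
      (fun hr hk => by
        rcases div_eq_zero_iff.1 hk with h1 | h1
        · exact hr (by rw [pow_eq_zero_iff two_ne_zero |>.1 h1]; simp)
        · exact absurd h1 (by positivity))
      (fun z hzI => ((hz z hzI).velocity_left hS).2)
      (fun z hzI => (hz z hzI).hasDerivAt_velocity_left hS)
      (fun z hzI => ⟨(hz z hzI).turn_zero.right.pos, (hz z hzI).hasDerivAt_time_right hS⟩)
      (fun z hzI => (hz z hzI).hasDerivAt_time_center hS)
      (fun z hzI => by simpa [Fin.sum_univ_four] using hc z hzI)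
    funext i
    fin_cases i
    · exact this.1
    · exact this.2.1
    · exact this.2.2.1
    · exact this.2.2.2
  · obtain ⟨κ, hκ, hbd⟩ := S.exists_bounded_pert
    -- the deformation that realizes the coefficients `c`
    set e : Fin 5 → ℝ := ![(c 0 + 2 * (c 2 / S.R.b ^ 2) * S.R.b * S.pull / S.R.D -
      2 * (c 3 / S.C.b ^ 2) * S.C.b * (1 - ξ)) / 4,
      (2 * (c 3 / S.C.b ^ 2) * S.C.b * (1 + ξ) - c 1) / 4,
      c 2 / S.R.b ^ 2, c 3 / S.C.b ^ 2, 0] with he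
    set l := κ / (1 + ‖e‖) with hl
    have hl0 : 0 < l := by positivity
    refine ⟨fun _ => S.pert (l • e), fun ε => ε • l • e, ⟨_, hbd _ fun i => ?_, rfl⟩, ?_,
      Eventually.of_forall fun ε => S.perturbed_pert _ _, fun z hz => ?_⟩
    · rw [Pi.smul_apply, smul_eq_mul, abs_mul, abs_of_pos hl0, hl, div_mul_eq_mul_div,
        div_le_iff₀ (by positivity)]
      have : |e i| ≤ ‖e‖ := norm_le_pi_norm e i
      nlinarith
    · have : Continuous fun ε : ℝ => ε • l • e := by fun_prop
      simpa using this.continuousWithinAt.tendsto (x := (0 : ℝ)) (s := Ioi 0)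
    · have hA := hz.turn_zero.area_right hS
      have hB := hz.turn_zero.area_center hS
      simp only [hz.start] at hA hB
      obtain ⟨s1, s2⟩ := hz.sign_displacement_linear hS (l • e) rfl
      rw [hA, hB] at s1 s2
      have hM : 4 * (l • e) 0 * (z - yR) - 4 * (l • e) 1 * (yL - Y 2 (0, z)) +
          (l • e) 2 * (S.R.b ^ 2 * (((z - yR) ^ 2 + S.pull ^ 2 / (S.R.D * S.R.b ^ 2)) *
            T 0 (0, z)) - 2 * S.R.b * S.pull / S.R.D * (z - yR)) +
          (l • e) 3 * (S.C.b ^ 2 * (((z - yR) ^ 2 + S.C.D * (1 - ξ) ^ 2 / S.C.b ^ 2) *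
            (T 1 (0, z) + T 3 (0, z))) + 2 * S.C.b * (1 + ξ) * (yL - Y 2 (0, z)) +
            2 * S.C.b * (1 - ξ) * (z - yR)) =
          l * (c 0 * (z - yR) + c 1 * (yL - Y 2 (0, z)) +
            c 2 * (((z - yR) ^ 2 + S.pull ^ 2 / (S.R.D * S.R.b ^ 2)) * T 0 (0, z)) +
            c 3 * (((z - yR) ^ 2 + S.C.D * (1 - ξ) ^ 2 / S.C.b ^ 2) *
              (T 1 (0, z) + T 3 (0, z)))) := by
        simp only [Pi.smul_apply, smul_eq_mul, he, Matrix.cons_val]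
        generalize T 0 (0, z) = t0
        generalize T 1 (0, z) + T 3 (0, z) = t1
        generalize Y 2 (0, z) = y2
        have := bC.ne'
        have := bR.ne'
        field_simp
        ring
      simp only [Fin.sum_univ_four, Matrix.cons_val]
      exact ⟨fun h => s1 (hM ▸ mul_pos hl0 h), fun h => s2 (hM ▸ mul_neg_of_pos_of_neg hl0 h)⟩

/-- The bifurcation in the case `ξ = 0`, along a quadratic curve of perturbations. -/
theorem HamSystem.IsTurn.bifurcate_of_eq_zero {J : Set ℝ} (hJo : IsOpen J)
    (hJ : ∀ h ∈ J, ∃ (γ : ℝ → ℝ × ℝ) (T : ℝ), S.unperturbed.IsAnnulusOrbit γ T h)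
    (hS : S.NormalForm 0 yR yL) {y : Fin 5 → ℝ} {τ : Fin 4 → ℝ}
    (h : S.IsTurn 0 y τ) (hy : y 0 ∈ J) :
    ∃ P : ℝ → Perturbation, (∀ ε, (P ε).Bounded) ∧ S.LimitCyclesBifurcate J P 3 := by
  have bC := hS.bC_pos
  have bR := hS.bR_pos
  have hDC := hS.D_pos
  have hDR := hS.D_ne_zero
  have hwu : ∀ z Y T, S.IsReturn z Y T → yL - Y 2 (0, z) = z - yR := fun z Y T hz => by
    obtain ⟨p0, pw, c3⟩ := hz.velocity_left hS
    exact (pow_left_inj₀ pw.le p0.le two_ne_zero).1 (by rw [c3]; ring)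
  refine HamSystem.exists_three_limitCycles hJo hJ hS h hy _ fun Y T => ?_
  refine ⟨![fun z => z - yR, fun z => 1 / (z - yR),
    fun z => ((z - yR) ^ 2 + S.pull ^ 2 / (S.R.D * S.R.b ^ 2)) * T 0 (0, z),
    fun z => ((z - yR) ^ 2 + S.C.D / S.C.b ^ 2) * (T 1 (0, z) + T 3 (0, z))],
    fun z hz i => ?_, fun a b hab ha hz c hc => ?_, fun c => ?_⟩
  · have c0 : ContinuousAt (fun z => z - yR) z := by fun_prop
    fin_cases i
    · exact c0
    · exact continuousAt_const.div c0 (hz.velocity_left hS).1.ne'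
    · exact ((c0.pow 2).add continuousAt_const).mul
        (hz.hasDerivAt_time_right hS).2.continuousAt
    · exact ((c0.pow 2).add continuousAt_const).mul (hz.hasDerivAt_time_center hS).continuousAt
  · have := independent_of_eq_zero (m := S.C.D / S.C.b ^ 2) (r₁ := 2 * S.pull / (S.R.D * S.R.b))
      (r₂ := -(4 / S.C.b)) (t := fun z => T 0 (0, z))
      (s := fun z => T 1 (0, z) + T 3 (0, z)) (k := S.pull ^ 2 / (S.R.D * S.R.b ^ 2))
      (α := c 0) (β := c 1) (γ := c 2) (δ := c 3)
      hab ha (by positivity) (neg_ne_zero.2 (by positivity))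
      (by
        have h1 : S.R.D * S.R.b ^ 2 ≠ 0 := by positivity
        have h2 : S.R.D * S.R.b ≠ 0 := by positivity
        simp [div_eq_zero_iff, h1, h2])
      (fun z hzI => ⟨(hz z hzI).turn_zero.right.pos, (hz z hzI).hasDerivAt_time_right hS⟩)
      (fun z hzI => ((hz z hzI).hasDerivAt_time_center hS).congr_deriv (by
        have h1 := ((hz z hzI).velocity_left hS).1.ne'
        rw [hwu z Y T (hz z hzI), div_self h1]
        ring))
      (fun hkm z hzI => (hz z hzI).time_ratio hS hkm)
      (fun z hzI => by simpa [Fin.sum_univ_four] using hc z hzI)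
    funext i
    fin_cases i
    · exact this.1
    · exact this.2.1
    · exact this.2.2.1
    · exact this.2.2.2
  · obtain ⟨κ, hκ, hbd⟩ := S.exists_bounded_pert
    -- the deformation that realizes the coefficients `c`
    set ν := κ / 2 with hν
    have hν0 : 0 < ν := by positivity
    set γ := c 2 / S.R.b ^ 2 with hγ
    set δ := c 3 / S.C.b ^ 2 with hδ
    set μ := (c 0 + 2 * γ * S.R.b * S.pull / S.R.D - 4 * δ * S.C.b) / 4 with hμ
    set β := c 1 * S.C.b / (8 * ν) with hβ
    set l := (κ / 2) / (1 + (|μ| + |β| + |γ| + |δ|)) with hl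
    have hl0 : 0 < l := by positivity
    have hle : ∀ x, |x| ≤ |μ| + |β| + |γ| + |δ| → |l * x| ≤ κ / 2 := fun x hx => by
      rw [abs_mul, abs_of_pos hl0, hl, div_mul_eq_mul_div, div_le_iff₀ (by positivity)]
      nlinarith
    have a1 := abs_nonneg μ
    have a2 := abs_nonneg β
    have a3 := abs_nonneg γ
    have a4 := abs_nonneg δ
    have b1 := hle μ (by linarith)
    have b2 := hle β (by linarith)
    have b3 := hle γ (by linarith)
    have b4 := hle δ (by linarith)
    refine ⟨fun ε => if |ε| ≤ 1 then
        S.pert (![l * β, l * β, 0, 0, ν] + ε • ![l * μ, 0, l * γ, l * δ, 0]) else S.pert 0,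
      fun ε => ε • (![l * β, l * β, 0, 0, ν] + ε • ![l * μ, 0, l * γ, l * δ, 0]),
      fun ε => ?_, ?_, ?_, fun z hz => ?_⟩
    · dsimp only
      split_ifs with hε
      · have hmul : ∀ x, |x| ≤ κ / 2 → |ε * x| ≤ κ / 2 := fun x hx => by
          rw [abs_mul]
          calc |ε| * |x| ≤ 1 * (κ / 2) := mul_le_mul hε hx (abs_nonneg _) zero_le_one
            _ = κ / 2 := one_mul _
        refine hbd _ fun i => ?_
        rw [Pi.add_apply, Pi.smul_apply, smul_eq_mul]
        refine (abs_add_le _ _).trans ?_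
        have hν' : |ν| ≤ κ / 2 := by rw [abs_of_pos hν0]
        have h0 : |(0 : ℝ)| ≤ κ / 2 := by rw [abs_zero]; positivity
        have hsplit : κ = κ / 2 + κ / 2 := by ring
        rw [hsplit]
        fin_cases i
        · exact add_le_add b2 (hmul _ b1)
        · exact add_le_add b2 (hmul _ h0)
        · exact add_le_add h0 (hmul _ b3)
        · exact add_le_add h0 (hmul _ b4)
        · exact add_le_add hν' (hmul _ h0)
      · exact hbd _ fun i => by simpa using hκ.le
    · have : Continuous fun ε : ℝ =>
          ε • (![l * β, l * β, 0, 0, ν] + ε • ![l * μ, 0, l * γ, l * δ, 0]) := by fun_prop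
      have h0 := this.continuousWithinAt.tendsto (x := (0 : ℝ)) (s := Ioi 0)
      rwa [zero_smul ℝ (_ : Fin 5 → ℝ)] at h0
    · filter_upwards [nhdsWithin_le_nhds (Metric.ball_mem_nhds (0 : ℝ) one_pos)] with ε hε
      rw [if_pos (by simpa using (mem_ball_zero_iff.1 hε).le), S.perturbed_pert]
    · have hA := hz.turn_zero.area_right hS
      have hB := hz.turn_zero.area_center hS
      simp only [hz.start, hwu z Y T hz] at hA hB
      obtain ⟨s1, s2⟩ := hz.sign_displacement_quadratic hS (l * μ) (l * β) (l * γ) (l * δ) ν rfl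
      rw [hA, hB] at s1 s2
      have hM : 4 * (l * μ) * (z - yR) + 8 * (l * β) * ν / (S.C.b * (z - yR)) +
          l * γ * (S.R.b ^ 2 * (((z - yR) ^ 2 + S.pull ^ 2 / (S.R.D * S.R.b ^ 2)) *
            T 0 (0, z)) - 2 * S.R.b * S.pull / S.R.D * (z - yR)) +
          l * δ * (S.C.b ^ 2 * (((z - yR) ^ 2 + S.C.D * (1 - 0) ^ 2 / S.C.b ^ 2) *
            (T 1 (0, z) + T 3 (0, z))) + 2 * S.C.b * (1 + 0) * (z - yR) +
            2 * S.C.b * (1 - 0) * (z - yR)) =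
          l * (c 0 * (z - yR) + c 1 * (1 / (z - yR)) +
            c 2 * (((z - yR) ^ 2 + S.pull ^ 2 / (S.R.D * S.R.b ^ 2)) * T 0 (0, z)) +
            c 3 * (((z - yR) ^ 2 + S.C.D / S.C.b ^ 2) * (T 1 (0, z) + T 3 (0, z)))) := by
        rw [hμ, hβ, hγ, hδ]
        generalize T 0 (0, z) = t0
        generalize T 1 (0, z) + T 3 (0, z) = t1
        have h1 := (hz.velocity_left hS).1.ne'
        generalize z - yR = u at *
        clear_value l ν
        clear b1 b2 b3 b4 a1 a2 a3 a4 hle hγ hδ hμ hβ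
        have := bC.ne'
        have := bR.ne'
        field_simp
        ring
      simp only [Fin.sum_univ_four, Matrix.cons_val]
      exact ⟨fun h => s1 (hM ▸ mul_pos hl0 h), fun h => s2 (hM ▸ mul_neg_of_pos_of_neg hl0 h)⟩

end

/-! ### Turns and orbits of the annulus -/

/-- A solution with the initial point of an orbit of the flow coincides with it. -/
theorem PertCoeffs.flow_eq (m : PertCoeffs) {φ : ℝ → ℝ × ℝ} {τ : ℝ} (hφ : ContinuousOn φ (Icc 0 τ))
    (hd : ∀ t ∈ Ico 0 τ, HasDerivWithinAt φ (m.field (φ t)) (Ici t) t) :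
    ∀ t ∈ Icc 0 τ, m.flow t (φ 0) = φ t := by
  obtain ⟨K, hK⟩ := m.lipschitz_field
  have h1 : ∀ t, HasDerivAt (fun t => m.flow t (φ 0)) (m.field (m.flow t (φ 0))) t :=
    fun t => m.hasDerivAt_flow t _
  exact ODE_solution_unique (v := fun _ => m.field) (fun _ => hK)
    (fun t _ => (h1 t).continuousAt.continuousWithinAt) (fun t _ => (h1 t).hasDerivWithinAt) hφ hd
    (m.flow_zero _)

/-- The part of a crossing solution in a zone, between two switching times, is an arc. -/
theorem PWField.IsCrossingSolution.isArc {P : Perturbation} {γ : ℝ → ℝ × ℝ}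
    (h : P.toField.IsCrossingSolution γ) {i : Zone} {s τ : ℝ} (hτ : 0 < τ)
    (h0 : i.gap (γ s).1 = 0) (h1 : i.gap (γ (s + τ)).1 = 0)
    (hin : ∀ t ∈ Ioo 0 τ, 0 < i.gap (γ (s + t)).1) : P.IsArc i (γ s) (γ (s + τ)) τ := by
  have hd : ∀ t, P.toField.DepartsAt (fun t => γ (s + t)) t := fun t =>
    (h.departs_arrives (s + t)).1.shift
  have hen : P.toField.Enters i (γ (s + 0)) ∧
      HasDerivWithinAt (fun t => γ (s + t)) (P.toField.fld i (γ (s + 0))) (Ici 0) 0 := by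
    obtain ⟨j, hj, hjd⟩ := hd 0
    obtain ⟨r, hr, hr'⟩ := ((PWField.Enters.eventually_right
      (φ := fun t => γ (s + t)) hj hjd).and (Ioo_mem_nhdsGT hτ)).exists
    obtain rfl : j = i :=
      (enters_of_gap_pos (Z := P.toField) hr).unique (enters_of_gap_pos (hin r hr'))
    exact ⟨hj, hjd⟩
  have hle : P.toField.Leaves i (γ (s + τ)) := by
    obtain ⟨j, hj, hjd⟩ := (h.departs_arrives (s + τ)).2.shift
    obtain ⟨r, hr, hr'⟩ := ((PWField.Leaves.eventually_left
      (φ := fun t => γ (s + t)) hj hjd).and (Ioo_mem_nhdsLT hτ)).exists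
    obtain rfl : j = i :=
      (enters_of_gap_pos (Z := P.toField) hr).unique (enters_of_gap_pos (hin r hr'))
    exact hj
  have hflow := (P.coeffs i).flow_eq (φ := fun t => γ (s + t)) (τ := τ)
    (h.continuous.comp (continuous_const.add continuous_id)).continuousOn (fun t ht => by
      rw [← P.fld_toField]
      rcases eq_or_lt_of_le ht.1 with rfl | ht0
      · exact hen.2
      · obtain ⟨j, hj, hjd⟩ := hd t
        obtain rfl : j = i := hj.unique (enters_of_gap_pos (hin t ⟨ht0, ht.2⟩))
        exact hjd)
  simp only [add_zero] at hflow hen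
  refine ⟨hτ, h0, h1, hen.1, hle, fun t ht => ?_, hflow τ ⟨hτ.le, le_rfl⟩⟩
  rw [hflow t (Ioo_subset_Icc_self ht)]
  exact hin t ht

/-- An orbit of the annulus consists of the four arcs of a turn. -/
theorem HamSystem.exists_isTurn {S : HamSystem} {γ : ℝ → ℝ × ℝ} {T h : ℝ}
    (hγ : S.unperturbed.IsAnnulusOrbit γ T h) :
    ∃ y τ, S.IsTurn 0 y τ ∧ y 0 = h ∧ y 4 = h ∧ y 1 < y 0 ∧ y 2 < y 3 := by
  obtain ⟨hsol, hper, h0, t₁, t₂, t₃, l1, l2, l3, l4, x1, x2, x3, hy1, hy2, hR, hlo, hL, hup⟩ := hγ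
  rw [S.unperturbed_eq] at hsol
  have hT : γ T = (1, h) := by rw [← h0]; simpa using hper 0
  have arc : ∀ {i : Zone} {s s' : ℝ}, s < s' → i.gap (γ s).1 = 0 → i.gap (γ s').1 = 0 →
      (∀ t ∈ Ioo s s', 0 < i.gap (γ t).1) →
      (S.deform 0).IsArc i (γ s) (γ s') (s' - s) := by
    intro i s s' hs g g' hin
    have := hsol.isArc (i := i) (s := s) (sub_pos.2 hs) g (by rwa [add_sub_cancel])
      fun t ht => hin _ ⟨by linarith [ht.1], by linarith [ht.2]⟩
    rwa [add_sub_cancel] at this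
  have e1 : γ t₁ = (1, (γ t₁).2) := Prod.ext x1 rfl
  have e2 : γ t₂ = (-1, (γ t₂).2) := Prod.ext x2 rfl
  have e3 : γ t₃ = (-1, (γ t₃).2) := Prod.ext x3 rfl
  refine ⟨![h, (γ t₁).2, (γ t₂).2, (γ t₃).2, h], ![t₁ - 0, t₂ - t₁, t₃ - t₂, T - t₃],
    ⟨?_, ?_, ?_, ?_⟩, rfl, rfl, hy1, hy2⟩ <;> simp only [Matrix.cons_val]
  · rw [← e1, ← h0]
    exact arc l1 (by simp [Zone.gap, h0]) (by simp [Zone.gap, x1])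
      fun t ht => Zone.gap_pos_R.2 (hR t ht)
  · rw [← e1, ← e2]
    exact arc l2 (by simp [Zone.gap, x1]) (by simp [Zone.gap, x2])
      fun t ht => Zone.gap_pos_C.2 (hlo t ht).1
  · rw [← e2, ← e3]
    exact arc l3 (by simp [Zone.gap, x2]) (by simp [Zone.gap, x3])
      fun t ht => Zone.gap_pos_L.2 (hL t ht)
  · rw [← e3, ← hT]
    exact arc l4 (by simp [Zone.gap, x3]) (by simp [Zone.gap, hT])
      fun t ht => Zone.gap_pos_C.2 (hup t ht).1

/-- Two increasing affine functions whose product is never negative have the same zero: between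
different zeros the product would be negative. -/
theorem same_zero {b b' p p' : ℝ} (hb : 0 < b) (hb' : 0 < b')
    (h : ∀ y, 0 < (p + b * y) * (p' + b' * y) ∨ p + b * y = 0 ∨ p' + b' * y = 0) :
    p' / b' = p / b := by
  obtain ⟨r, rfl⟩ : ∃ r, p = b * r := ⟨p / b, by field_simp⟩
  obtain ⟨r', rfl⟩ : ∃ r', p' = b' * r' := ⟨p' / b', by field_simp⟩
  rw [mul_div_cancel_left₀ _ hb.ne', mul_div_cancel_left₀ _ hb'.ne']
  have hbb := mul_pos hb hb'
  rcases h (-(r + r') / 2) with h | h | h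
  · have : 0 < (b * b') * -((r - r') ^ 2 / 4) := by linarith
    nlinarith [pos_of_mul_pos_right this hbb.le, sq_nonneg (r - r')]
  · have : b * (r - r') = 0 := by linarith
    rcases mul_eq_zero.1 this with h | h <;> linarith
  · have : b' * (r' - r) = 0 := by linarith
    rcases mul_eq_zero.1 this with h | h <;> linarith

/-- The hypotheses (H1) and (H2), and one orbit of the annulus, provide the normal form. -/
theorem HamSystem.exists_normalForm {S : HamSystem} (h1 : S.H1) (h2 : S.H2) {y : Fin 5 → ℝ}
    {τ : Fin 4 → ℝ} (h : S.IsTurn 0 y τ) (h40 : y 4 = y 0) (h10 : y 1 < y 0) (h23 : y 2 < y 3) :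
    ∃ ξ yR yL, S.NormalForm ξ yR yL := by
  obtain ⟨⟨hC, z, hz, hz0⟩, -, hR⟩ := h1
  obtain ⟨h2L, h2R⟩ := h2
  have k0 := (h.right.enters.2.resolve_left (by norm_num [Zone.gap])).2
  have k1 := (h.right.leaves.2.resolve_left (by norm_num [Zone.gap])).2
  have k2 := (h.left.enters.2.resolve_left (by norm_num [Zone.gap])).2
  have k3 := (h.left.leaves.2.resolve_left (by norm_num [Zone.gap])).2
  have k4 := (h.lower.enters.2.resolve_left (by norm_num [Zone.gap])).2
  have k5 := (h.upper.leaves.2.resolve_left (by norm_num [Zone.gap])).2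
  rw [← S.unperturbed_eq] at k0 k1 k2 k3 k4 k5
  simp only [Zone.dgap, PWField.fld, HamSystem.unperturbed, HamCoeffs.field,
    h40] at k0 k1 k2 k3 k4 k5
  have bpos : ∀ {b u v : ℝ}, u < v → 0 < b * v - b * u → 0 < b := fun {b u v} huv hb => by
    rw [← mul_sub] at hb
    exact pos_of_mul_pos_left hb (sub_pos.2 huv).le
  have bR : 0 < S.R.b := bpos h10 (by linarith)
  have bL : 0 < S.L.b := bpos h23 (by linarith)
  have bC : 0 < S.C.b := bpos h10 (by linarith)
  have tR := same_zero (p := S.R.a + S.R.α) (p' := S.C.a + S.C.α) bR bC fun w => by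
    have := h2R (1, w) rfl
    simp only [PWField.crossingR, mem_ofPred_eq, HamSystem.unperturbed, HamCoeffs.field] at this
    rcases this with ⟨-, h⟩ | h | h
    · left; linarith
    · right; left; linarith
    · right; right; linarith
  have tL := same_zero (p := -S.L.a + S.L.α) (p' := -S.C.a + S.C.α) bL bC fun w => by
    have := h2L (-1, w) rfl
    simp only [PWField.crossingL, mem_ofPred_eq, HamSystem.unperturbed, HamCoeffs.field] at this
    rcases this with ⟨-, h⟩ | h | h
    · left; linarith
    · right; left; linarith
    · right; right; linarith
  have z1 : S.C.a * z.1 + S.C.b * z.2 + S.C.α = 0 := congrArg Prod.fst hz0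
  have z2 : S.C.c * z.1 - S.C.a * z.2 + S.C.β = 0 := congrArg Prod.snd hz0
  refine ⟨z.1, -((S.R.a + S.R.α) / S.R.b), -((-S.L.a + S.L.α) / S.L.b), bL, bC, bR, ?_, ?_, ?_, ?_,
    ?_, ?_, hz.1, hz.2, ?_⟩
  · field_simp
  · rw [← tR]; field_simp
  · rw [← tL]; field_simp
  · field_simp
  · rw [← HamCoeffs.det_linearPart]; exact hC
  · rw [HamCoeffs.D]
    linear_combination S.C.a * z1 + S.C.b * z2
  · rw [← HamCoeffs.det_linearPart]
    exact hR.elim (fun h => h.ne') fun h => h.ne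

/-- Along an arc through the central zone the abscissa is monotone: by conservation of energy the
velocity does not vanish. -/
theorem HamSystem.NormalForm.velocity_ne_zero {S : HamSystem} {ξ yR yL : ℝ}
    (hS : S.NormalForm ξ yR yL) {p p' : ℝ × ℝ} {τ : ℝ} (h : (S.deform 0).IsArc .C p p' τ)
    (hp : p.1 = 1 ∧ p'.1 = -1 ∨ p.1 = -1 ∧ p'.1 = 1) {t : ℝ} (ht : t ∈ Ico 0 τ) :
    ((S.deform 0).C.field ((S.deform 0).C.flow t p)).1 ≠ 0 := by
  have hx : 0 ≤ 1 - ((S.deform 0).C.flow t p).1 ^ 2 := by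
    rcases eq_or_lt_of_le ht.1 with rfl | h0
    · rw [PertCoeffs.flow_zero]
      exact h.gap_start.ge
    · exact (h.inside t ⟨h0, ht.2⟩).le
  have hD := hS.D_pos
  have E1 := S.C.energy_balance 0 (S.C.b * (0 : Fin 5 → ℝ) 3) ((0 : Fin 5 → ℝ) 4) p t rfl
  have E2 := S.C.energy_balance 0 (S.C.b * (0 : Fin 5 → ℝ) 3) ((0 : Fin 5 → ℝ) 4) p τ h.exit
  have hf : S.C.forcing 0 (S.C.b * (0 : Fin 5 → ℝ) 3) ((0 : Fin 5 → ℝ) 4) = S.C.D * ξ := by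
    rw [← hS.center]; simp [HamCoeffs.forcing]
  change ((S.deform 0).C.field ((S.deform 0).C.flow t p)).1 ^ 2 -
    ((S.deform 0).C.field p).1 ^ 2 = _ * (((S.deform 0).C.flow t p).1 ^ 2 - _) +
    _ * (((S.deform 0).C.flow t p).1 - _) + _ at E1
  change ((S.deform 0).C.field p').1 ^ 2 - ((S.deform 0).C.field p).1 ^ 2 = _ at E2
  rw [hf] at E1 E2
  simp only [Pi.zero_apply, mul_zero, zero_mul, add_zero] at E1 E2
  have hv := h.enters.2.resolve_left h.gap_start.not_gt
  have hv' := h.leaves.2.resolve_left h.gap_end.not_gt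
  have u0 : 0 < ((S.deform 0).C.field p).1 ^ 2 :=
    sq_pos_of_ne_zero fun h0 => by
      have : 0 < Zone.C.dgap p.1 * ((S.deform 0).C.field p).1 := hv.2
      rw [h0, mul_zero] at this; exact lt_irrefl _ this
  have u1 : 0 < ((S.deform 0).C.field p').1 ^ 2 :=
    sq_pos_of_ne_zero fun h0 => by
      have : Zone.C.dgap p'.1 * ((S.deform 0).C.field p').1 < 0 := hv'.2
      rw [h0, mul_zero] at this; exact lt_irrefl _ this
  generalize ((S.deform 0).C.flow t p).1 = x at *
  generalize ((S.deform 0).C.field p).1 ^ 2 = u at *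
  generalize ((S.deform 0).C.field p').1 ^ 2 = u' at *
  intro h0
  rw [h0] at E1
  have hx1 : -1 ≤ x := by nlinarith
  have hx2 : x ≤ 1 := by nlinarith
  -- the squared velocity dominates the linear interpolation of its boundary values
  rcases hp with ⟨a, a'⟩ | ⟨a, a'⟩ <;> rw [a] at E1 <;> rw [a, a'] at E2
  · have key : u * (1 + x) / 2 + u' * (1 - x) / 2 + S.C.D * (1 - x ^ 2) = 0 := by
      linear_combination -E1 + (1 - x) / 2 * E2
    have := mul_nonneg hD.le hx
    have a1 := mul_nonneg u0.le (by linarith : 0 ≤ 1 + x)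
    have a2 := mul_nonneg u1.le (by linarith : 0 ≤ 1 - x)
    nlinarith
  · have key : u * (1 - x) / 2 + u' * (1 + x) / 2 + S.C.D * (1 - x ^ 2) = 0 := by
      linear_combination -E1 + (1 + x) / 2 * E2
    have := mul_nonneg hD.le hx
    have a1 := mul_nonneg u0.le (by linarith : 0 ≤ 1 - x)
    have a2 := mul_nonneg u1.le (by linarith : 0 ≤ 1 + x)
    nlinarith

/-- If the tangent points of the central field lie on the `x`-axis, every closed turn is an orbit of
the annulus. -/
theorem HamSystem.IsTurn.exists_isAnnulusOrbit {S : HamSystem} {ξ : ℝ} (hS : S.NormalForm ξ 0 0)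
    (ha : S.C.a = 0) (hα : S.C.α = 0) {y : Fin 5 → ℝ} {τ : Fin 4 → ℝ} (h : S.IsTurn 0 y τ) :
    ∃ γ T, S.unperturbed.IsAnnulusOrbit γ T (y 0) := by
  obtain ⟨q0, q1, q2, q3, -⟩ := h.position hS
  have hcl := (h.closes hS).2.2.1
  have p0 := h.right.pos
  have p1 := h.lower.pos
  have p2 := h.left.pos
  have p3 := h.upper.pos
  -- in the central zone the velocity is `b y`
  have hv : ∀ z, ((S.deform 0).C.field z).1 = S.C.b * z.2 := fun z => by
    simp [HamSystem.deform, HamCoeffs.deform, PertCoeffs.field, ha, hα]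
  have hcont : ∀ z, Continuous fun t => ((S.deform 0).C.flow t z).2 := fun z =>
    continuous_snd.comp (continuous_iff_continuousAt.2 fun t =>
      ((S.deform 0).C.hasDerivAt_flow t z).continuousAt)
  have hlow : ∀ t ∈ Ioo 0 (τ 1), ((S.deform 0).C.flow t (1, y 1)).2 < 0 := fun t ht => by
    by_contra hneg
    obtain ⟨s, hs, hs0⟩ := intermediate_value_Icc ht.1.le (hcont (1, y 1)).continuousOn
      ⟨by simpa only [PertCoeffs.flow_zero] using q1.le, not_lt.1 hneg⟩
    refine hS.velocity_ne_zero h.lower (Or.inl ⟨rfl, rfl⟩) (t := s) ⟨hs.1, hs.2.trans_lt ht.2⟩ ?_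
    rw [hv]
    exact mul_eq_zero_of_right _ hs0
  have hupp : ∀ t ∈ Ioo 0 (τ 3), 0 < ((S.deform 0).C.flow t (-1, y 3)).2 := fun t ht => by
    by_contra hneg
    obtain ⟨s, hs, hs0⟩ := intermediate_value_Icc' ht.1.le (hcont (-1, y 3)).continuousOn
      ⟨not_lt.1 hneg, by simpa only [PertCoeffs.flow_zero] using q3.le⟩
    refine hS.velocity_ne_zero h.upper (Or.inr ⟨rfl, rfl⟩) (t := s) ⟨hs.1, hs.2.trans_lt ht.2⟩ ?_
    rw [hv]
    exact mul_eq_zero_of_right _ hs0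
  set f0 := fun t => (S.deform 0).R.flow t (1, y 0)
  set f1 := fun t => (S.deform 0).C.flow t (1, y 1)
  set f2 := fun t => (S.deform 0).L.flow t (-1, y 2)
  set f3 := fun t => (S.deform 0).C.flow t (-1, y 3)
  have s1 : f1 0 = (1, y 1) := PertCoeffs.flow_zero _ _
  have s2 : f2 0 = (-1, y 2) := PertCoeffs.flow_zero _ _
  have s3 : f3 0 = (-1, y 3) := PertCoeffs.flow_zero _ _
  have j1 : f0 (τ 0) = f1 0 := h.right.exit.trans s1.symm
  have c1 : ∀ t ∈ Icc 0 (τ 1), concat f0 f1 (τ 0) (τ 0 + t) = f1 t := fun t ht => by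
    rw [concat_of_ge j1 (by linarith [ht.1]), add_sub_cancel_left]
  have j2 : concat f0 f1 (τ 0) (τ 0 + τ 1) = f2 0 := by
    rw [c1 _ ⟨p1.le, le_rfl⟩, s2]; exact h.lower.exit
  set g := concat (concat f0 f1 (τ 0)) f2 (τ 0 + τ 1) with hg
  have c2 : ∀ t ∈ Icc 0 (τ 2), g (τ 0 + τ 1 + t) = f2 t := fun t ht => by
    rw [hg, concat_of_ge j2 (by linarith [ht.1]), add_sub_cancel_left]
  have j3 : g (τ 0 + τ 1 + τ 2) = f3 0 := by
    rw [c2 _ ⟨p2.le, le_rfl⟩, s3]; exact h.left.exit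
  set φ := concat g f3 (τ 0 + τ 1 + τ 2) with hφ
  have hpath : (S.deform 0).toField.PathOn φ (τ 0 + τ 1 + τ 2 + τ 3) :=
    ((h.right.pathOn.concat h.lower.pathOn j1).concat h.left.pathOn j2).concat h.upper.pathOn j3
  have v3 : ∀ t ∈ Icc 0 (τ 3), φ (τ 0 + τ 1 + τ 2 + t) = f3 t := fun t ht => by
    rw [hφ, concat_of_ge j3 (by linarith [ht.1]), add_sub_cancel_left]
  have v2 : ∀ t ∈ Icc 0 (τ 2), φ (τ 0 + τ 1 + t) = f2 t := fun t ht => by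
    rw [hφ, concat_of_le (by linarith [ht.2]), c2 t ht]
  have v1 : ∀ t ∈ Icc 0 (τ 1), φ (τ 0 + t) = f1 t := fun t ht => by
    rw [hφ, concat_of_le (by linarith [ht.2]), hg, concat_of_le (by linarith [ht.2]), c1 t ht]
  have v0 : ∀ t ∈ Icc 0 (τ 0), φ t = f0 t := fun t ht => by
    rw [hφ, concat_of_le (by linarith [ht.2]), hg, concat_of_le (by linarith [ht.2]),
      concat_of_le ht.2]
  have hφ0 : φ 0 = (1, y 0) := (v0 0 ⟨le_rfl, p0.le⟩).trans (PertCoeffs.flow_zero _ _)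
  have hφT : φ (τ 0 + τ 1 + τ 2 + τ 3) = φ 0 := by
    rw [v3 _ ⟨p3.le, le_rfl⟩, hφ0, ← hcl]; exact h.upper.exit
  have hT : 0 < τ 0 + τ 1 + τ 2 + τ 3 := by linarith
  have hmem : ∀ t ∈ Icc 0 (τ 0 + τ 1 + τ 2 + τ 3), periodize φ hT t = φ t := fun t ht =>
    periodize_of_mem hT hφT ht
  have w1 : periodize φ hT (τ 0) = (1, y 1) := by
    rw [hmem _ ⟨by linarith, by linarith⟩, v0 _ ⟨p0.le, le_rfl⟩]; exact h.right.exit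
  have w2 : periodize φ hT (τ 0 + τ 1) = (-1, y 2) := by
    rw [hmem _ ⟨by linarith, by linarith⟩, v1 _ ⟨p1.le, le_rfl⟩]; exact h.lower.exit
  have w3 : periodize φ hT (τ 0 + τ 1 + τ 2) = (-1, y 3) := by
    rw [hmem _ ⟨by linarith, by linarith⟩, v2 _ ⟨p2.le, le_rfl⟩]; exact h.left.exit
  refine ⟨periodize φ hT, _, ?_, periodize_periodic φ hT, ?_, τ 0, τ 0 + τ 1, τ 0 + τ 1 + τ 2, p0,
    by linarith, by linarith, by linarith, by rw [w1], by rw [w2], by rw [w3], by rw [w1]; linarith,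
    by rw [w2, w3]; linarith, ?_, ?_, ?_, ?_⟩
  · rw [S.unperturbed_eq]
    exact hpath.isCrossingSolution hT hφT
  · rw [hmem _ ⟨le_rfl, hT.le⟩, hφ0]
  · intro t ht
    rw [hmem _ ⟨ht.1.le, by linarith [ht.2]⟩, v0 _ (Ioo_subset_Icc_self ht)]
    exact Zone.gap_pos_R.1 (h.right.inside t ht)
  · intro t ht
    have ht' : t - τ 0 ∈ Ioo 0 (τ 1) := ⟨by linarith [ht.1], by linarith [ht.2]⟩
    have hvt := v1 _ (Ioo_subset_Icc_self ht')
    rw [add_sub_cancel] at hvt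
    rw [hmem _ ⟨by linarith [ht.1], by linarith [ht.2]⟩, hvt]
    exact ⟨Zone.gap_pos_C.1 (h.lower.inside _ ht'), fun _ => hlow _ ht'⟩
  · intro t ht
    have ht' : t - (τ 0 + τ 1) ∈ Ioo 0 (τ 2) := ⟨by linarith [ht.1], by linarith [ht.2]⟩
    have hvt := v2 _ (Ioo_subset_Icc_self ht')
    rw [add_sub_cancel] at hvt
    rw [hmem _ ⟨by linarith [ht.1], by linarith [ht.2]⟩, hvt]
    exact Zone.gap_pos_L.1 (h.left.inside _ ht')
  · intro t ht
    have ht' : t - (τ 0 + τ 1 + τ 2) ∈ Ioo 0 (τ 3) := ⟨by linarith [ht.1], by linarith [ht.2]⟩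
    have hvt := v3 _ (Ioo_subset_Icc_self ht')
    rw [add_sub_cancel] at hvt
    rw [hmem _ ⟨by linarith [ht.1], by linarith [ht.2]⟩, hvt]
    exact ⟨Zone.gap_pos_C.1 (h.upper.inside _ ht'), fun _ => hupp _ ht'⟩

/-- The turns near a given one provide a periodic annulus. -/
theorem HamSystem.IsTurn.exists_h3 {S : HamSystem} {ξ : ℝ} (hS : S.NormalForm ξ 0 0)
    (ha : S.C.a = 0) (hα : S.C.α = 0) {y : Fin 5 → ℝ} {τ : Fin 4 → ℝ} (h : S.IsTurn 0 y τ) :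
    ∃ J, y 0 ∈ J ∧ S.H3 J := by
  obtain ⟨Y, T, θ, φ, -, hY, hT, -, hstart, hturn⟩ := h.persist (h.position hS).2.1
  have hret : S.IsReturn (y 0) Y T := ⟨hY, hT, hstart, hturn⟩
  obtain ⟨r, hr, hball⟩ := Metric.eventually_nhds_iff_ball.1 hret.eventually_nhds
  rw [Real.ball_eq_Ioo] at hball
  refine ⟨Ioo (y 0 - r) (y 0 + r), ⟨by linarith, by linarith⟩, isOpen_Ioo, ordConnected_Ioo,
    nonempty_Ioo.2 (by linarith), fun w hw => ?_⟩
  obtain ⟨γ, T', hγ⟩ := (hball w hw).turn_zero.exists_isAnnulusOrbit hS ha hα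
  rw [hstart] at hγ
  exact ⟨γ, T', hγ⟩

/-- Three limit cycles bifurcate from every periodic annulus. -/
theorem HamSystem.exists_limitCyclesBifurcate {S : HamSystem} {J : Set ℝ} (h1 : S.H1) (h2 : S.H2)
    (h3 : S.H3 J) :
    ∃ P : ℝ → Perturbation, (∀ ε, (P ε).Bounded) ∧ S.LimitCyclesBifurcate J P 3 := by
  obtain ⟨hJo, -, ⟨h, hh⟩, hJ⟩ := h3
  obtain ⟨γ, T, hγ⟩ := hJ h hh
  obtain ⟨y, τ, ht, hy0, hy4, h10, h23⟩ := HamSystem.exists_isTurn hγ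
  obtain ⟨ξ, yR, yL, hS⟩ := HamSystem.exists_normalForm h1 h2 ht (hy4.trans hy0.symm) h10 h23
  have hy : y 0 ∈ J := hy0 ▸ hh
  rcases eq_or_ne ξ 0 with rfl | hξ
  · exact ht.bifurcate_of_eq_zero hJo hJ hS hy
  · obtain ⟨P, hP, hb⟩ := ht.bifurcate_of_ne_zero hJo hJ hS hξ hy
    exact ⟨fun _ => P, fun _ => hP, hb⟩

/-! ### Systems with prescribed outer singular points -/

/-- For every kind of singular point and every velocity `A`, an equation `x'' = c x + β` with a
singular point of this kind relative to `x > 1` and a solution that starts at `x = 1` with the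
velocity `A`, moves in `x > 1` and returns to `x = 1`. The reflection at the origin is an equation
with the same properties relative to `x < -1`. -/
theorem exists_outer_arc (κ : OuterKind) {A : ℝ} (hA : 0 < A) : ∃ (c β τ : ℝ) (x V : ℝ → ℝ),
    c ≠ 0 ∧ (⟨0, 1, c, 0, β⟩ : HamCoeffs).HasKind zoneR κ ∧
    (⟨0, 1, c, 0, -β⟩ : HamCoeffs).HasKind zoneL κ ∧ 0 < τ ∧ (∀ t, HasDerivAt x (V t) t) ∧
    (∀ t, HasDerivAt V (c * x t + β) t) ∧ x 0 = 1 ∧ V 0 = A ∧ x τ = 1 ∧ V τ = -A ∧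
    ∀ t ∈ Ioo 0 τ, 1 < x t := by
  have hs := Real.hasDerivAt_sin
  have hc := Real.hasDerivAt_cos
  have hpi := Real.pi_pos
  cases κ with
  | realSaddle =>
    refine ⟨1, -(1 + 3 * A), Real.log 2,
      fun t => 1 + 3 * A - 3 * A * Real.cosh t + A * Real.sinh t,
      fun t => -(3 * A * Real.sinh t) + A * Real.cosh t, one_ne_zero, ⟨?_, (1 + 3 * A, 0), ?_, ?_⟩,
      ⟨?_, (-(1 + 3 * A), 0), ?_, ?_⟩, Real.log_pos one_lt_two, fun t => ?_, fun t => ?_, ?_, ?_,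
      ?_, ?_, fun t ht => ?_⟩
    · simp [HamCoeffs.IsSaddle, HamCoeffs.det_linearPart, HamCoeffs.D]
    · change 1 < 1 + 3 * A
      linarith
    · simp [HamCoeffs.field]
    · simp [HamCoeffs.IsSaddle, HamCoeffs.det_linearPart, HamCoeffs.D]
    · change -(1 + 3 * A) < -1
      linarith
    · simp [HamCoeffs.field]
    · exact ((((Real.hasDerivAt_cosh t).const_mul (3 * A)).const_sub (1 + 3 * A)).add
        ((Real.hasDerivAt_sinh t).const_mul A)).congr_deriv (by ring)
    · exact (((Real.hasDerivAt_sinh t).const_mul (3 * A)).neg.add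
        ((Real.hasDerivAt_cosh t).const_mul A)).congr_deriv (by ring)
    · simp
    · simp
    · simp only [Real.cosh_log two_pos, Real.sinh_log two_pos]
      ring
    · simp only [Real.cosh_log two_pos, Real.sinh_log two_pos]
      ring
    · have h1 : 1 < Real.exp t := Real.one_lt_exp_iff.2 ht.1
      have h2 : Real.exp t < 2 := (Real.lt_log_iff_exp_lt two_pos).1 ht.2
      beta_reduce
      rw [Real.cosh_eq, Real.sinh_eq, Real.exp_neg]
      have h0 : 0 < Real.exp t := by linarith
      have : 1 + 3 * A - 3 * A * ((Real.exp t + (Real.exp t)⁻¹) / 2) +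
          A * ((Real.exp t - (Real.exp t)⁻¹) / 2) =
          1 + A * ((Real.exp t - 1) * (2 - Real.exp t)) / Real.exp t := by
        field_simp
        ring
      rw [this]
      have := div_pos (mul_pos hA (mul_pos (sub_pos.2 h1) (sub_pos.2 h2))) h0
      linarith
  | realCenter =>
    have hτ : 3 * Real.pi / 2 = Real.pi / 2 + Real.pi := by ring
    refine ⟨-1, 1 + A, 3 * Real.pi / 2, fun t => 1 + A - A * Real.cos t + A * Real.sin t,
      fun t => A * Real.sin t + A * Real.cos t, by norm_num, ⟨?_, (1 + A, 0), ?_, ?_⟩,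
      ⟨?_, (-(1 + A), 0), ?_, ?_⟩, by positivity, fun t => ?_, fun t => ?_, ?_, ?_, ?_, ?_,
      fun t ht => ?_⟩
    · simp [HamCoeffs.IsCenter, HamCoeffs.det_linearPart, HamCoeffs.D]
    · change 1 < 1 + A
      linarith
    · simp [HamCoeffs.field]
    · simp [HamCoeffs.IsCenter, HamCoeffs.det_linearPart, HamCoeffs.D]
    · change -(1 + A) < -1
      linarith
    · simp [HamCoeffs.field]
    · exact ((((hc t).const_mul A).const_sub (1 + A)).add ((hs t).const_mul A)).congr_deriv
        (by ring)
    · exact (((hs t).const_mul A).add ((hc t).const_mul A)).congr_deriv (by ring)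
    · simp
    · simp
    · simp only [hτ, Real.cos_add_pi, Real.sin_add_pi, Real.cos_pi_div_two, Real.sin_pi_div_two]
      ring
    · simp only [hτ, Real.cos_add_pi, Real.sin_add_pi, Real.cos_pi_div_two, Real.sin_pi_div_two]
      ring
    · -- half-angle formulas: `1 - cos t + sin t = 2 sin (t/2) (sin (t/2) + cos (t/2))`
      obtain ⟨s, rfl⟩ : ∃ s, t = 2 * s := ⟨t / 2, by ring⟩
      have h1 : 0 < Real.sin s := Real.sin_pos_of_pos_of_lt_pi (by linarith [ht.1])
        (by linarith [ht.2])
      have h2 : 0 < Real.sin (s + Real.pi / 4) :=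
        Real.sin_pos_of_pos_of_lt_pi (by linarith [ht.1]) (by linarith [ht.2])
      rw [Real.sin_add, Real.cos_pi_div_four, Real.sin_pi_div_four, ← add_mul] at h2
      have h3 : 0 < Real.sin s + Real.cos s := pos_of_mul_pos_left h2 (by positivity)
      beta_reduce
      rw [Real.cos_two_mul, Real.sin_two_mul]
      have h4 := mul_pos hA (mul_pos h1 h3)
      have h5 := Real.sin_sq_add_cos_sq s
      have : 1 + A - A * (2 * Real.cos s ^ 2 - 1) + A * (2 * Real.sin s * Real.cos s) =
          1 + 2 * (A * (Real.sin s * (Real.sin s + Real.cos s))) := by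
        linear_combination -2 * A * h5
      rw [this]
      linarith
  | virtualCenter =>
    refine ⟨-1, 1 - A, Real.pi / 2, fun t => 1 - A + A * Real.cos t + A * Real.sin t,
      fun t => -(A * Real.sin t) + A * Real.cos t, by norm_num, ⟨?_, (1 - A, 0), ?_, ?_⟩,
      ⟨?_, (-(1 - A), 0), ?_, ?_⟩, by positivity, fun t => ?_, fun t => ?_, ?_, ?_, ?_, ?_,
      fun t ht => ?_⟩
    · simp [HamCoeffs.IsCenter, HamCoeffs.det_linearPart, HamCoeffs.D]
    · change ¬ 1 < 1 - A
      linarith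
    · simp [HamCoeffs.field]
    · simp [HamCoeffs.IsCenter, HamCoeffs.det_linearPart, HamCoeffs.D]
    · change ¬ -(1 - A) < -1
      linarith
    · simp [HamCoeffs.field]
    · exact ((((hc t).const_mul A).const_add (1 - A)).add ((hs t).const_mul A)).congr_deriv
        (by ring)
    · exact (((hs t).const_mul A).neg.add ((hc t).const_mul A)).congr_deriv (by ring)
    · simp
    · simp
    · simp
    · simp
    · have h1 : 0 < Real.sin t := Real.sin_pos_of_pos_of_lt_pi ht.1 (by linarith [ht.2])
      have h2 : 0 < Real.cos t := Real.cos_pos_of_mem_Ioo ⟨by linarith [ht.1], ht.2⟩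
      have h3 := Real.sin_sq_add_cos_sq t
      have h4 : 1 < Real.cos t + Real.sin t := by nlinarith [mul_pos h1 h2]
      nlinarith

/-- A system with `x' = y` in all zones, whose central singular point is the center `(1/2, 0)`. -/
def exampleSystem (cL βL cR βR : ℝ) : HamSystem :=
  ⟨⟨0, 1, cL, 0, -βL⟩, ⟨0, 1, -1, 0, 1 / 2⟩, ⟨0, 1, cR, 0, βR⟩⟩

theorem exampleSystem_fld_fst (cL βL cR βR : ℝ) (i : Zone) (z : ℝ × ℝ) :
    ((exampleSystem cL βL cR βR).unperturbed.fld i z).1 = z.2 := by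
  cases i <;> simp [exampleSystem, HamSystem.unperturbed, PWField.fld, HamCoeffs.field]

theorem exampleSystem_isArc {cL βL cR βR : ℝ} {i : Zone} {x V : ℝ → ℝ} {τ : ℝ} (hτ : 0 < τ)
    (hx : ∀ t, HasDerivAt x (V t) t)
    (hV : ∀ t, HasDerivAt V ((exampleSystem cL βL cR βR).unperturbed.fld i (x t, V t)).2 t)
    (g0 : i.gap (x 0) = 0) (g1 : i.gap (x τ) = 0) (h0 : 0 < i.dgap (x 0) * V 0)
    (h1 : i.dgap (x τ) * V τ < 0) (hin : ∀ t ∈ Ioo 0 τ, 0 < i.gap (x t)) :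
    ((exampleSystem cL βL cR βR).deform 0).IsArc i (x 0, V 0) (x τ, V τ) τ := by
  set S := exampleSystem cL βL cR βR
  have hfst := exampleSystem_fld_fst cL βL cR βR
  have hcr : ∀ z : ℝ × ℝ, z.2 ≠ 0 → S.unperturbed.Crossing z := fun z hz => by
    have := mul_self_pos.2 hz
    constructor <;> intro
    · have h1 := hfst .R z
      have h2 := hfst .C z
      simp only [PWField.fld] at h1 h2
      rwa [h1, h2]
    · have h1 := hfst .L z
      have h2 := hfst .C z
      simp only [PWField.fld] at h1 h2
      rwa [h1, h2]
  have hflow := ((S.deform 0).coeffs i).flow_eq (φ := fun t => (x t, V t)) (τ := τ)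
    (fun t _ => ((hx t).prodMk (hV t)).continuousAt.continuousWithinAt) fun t _ => by
      rw [← Perturbation.fld_toField, ← S.unperturbed_eq]
      refine ((hx t).prodMk (hV t)).hasDerivWithinAt.congr_deriv (Prod.ext ?_ rfl)
      exact (hfst i (x t, V t)).symm
  refine ⟨hτ, g0, g1, ?_, ?_, fun t ht => ?_, hflow τ ⟨hτ.le, le_rfl⟩⟩
  · rw [← S.unperturbed_eq]
    refine ⟨hcr _ fun h => ?_, Or.inr ⟨g0, by rwa [hfst]⟩⟩
    rw [show V 0 = 0 from h, mul_zero] at h0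
    exact lt_irrefl _ h0
  · rw [← S.unperturbed_eq]
    refine ⟨hcr _ fun h => ?_, Or.inr ⟨g1, by rwa [hfst]⟩⟩
    rw [show V τ = 0 from h, mul_zero] at h1
    exact lt_irrefl _ h1
  · rw [hflow t (Ioo_subset_Icc_self ht)]
    exact hin t ht

theorem exampleSystem_normalForm {cL βL cR βR : ℝ} (hR : cR ≠ 0) :
    (exampleSystem cL βL cR βR).NormalForm (1 / 2) 0 0 := by
  constructor <;> norm_num [exampleSystem, HamCoeffs.D]
  exact hR

theorem exampleSystem_h1 {cL βL cR βR : ℝ} (hL : cL ≠ 0) (hR : cR ≠ 0) :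
    (exampleSystem cL βL cR βR).H1 := by
  have key : ∀ {c β : ℝ}, c ≠ 0 → (⟨0, 1, c, 0, β⟩ : HamCoeffs).IsCenter ∨
      (⟨0, 1, c, 0, β⟩ : HamCoeffs).IsSaddle := fun {c β} hc => by
    rcases lt_or_gt_of_ne hc with h | h
    · left; simpa [HamCoeffs.IsCenter, HamCoeffs.det_linearPart, HamCoeffs.D] using h
    · right; simpa [HamCoeffs.IsSaddle, HamCoeffs.det_linearPart, HamCoeffs.D] using h
  refine ⟨⟨?_, (1 / 2, 0), ⟨?_, ?_⟩, ?_⟩, key hL, key hR⟩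
  · simp [exampleSystem, HamCoeffs.IsCenter, HamCoeffs.det_linearPart, HamCoeffs.D]
  · norm_num
  · norm_num
  · norm_num [exampleSystem, HamCoeffs.field]

theorem exampleSystem_h2 (cL βL cR βR : ℝ) : (exampleSystem cL βL cR βR).H2 := by
  have hfst := exampleSystem_fld_fst cL βL cR βR
  constructor
  · intro z hz
    have h1 := hfst .L z
    have h2 := hfst .C z
    rcases eq_or_ne z.2 0 with h0 | h0
    · exact Or.inr (Or.inl (h1.trans h0))
    · refine Or.inl ⟨hz, ?_⟩
      simp only [PWField.fld] at h1 h2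
      rw [h1, h2]
      exact mul_self_pos.2 h0
  · intro z hz
    have h1 := hfst .R z
    have h2 := hfst .C z
    rcases eq_or_ne z.2 0 with h0 | h0
    · exact Or.inr (Or.inl (h1.trans h0))
    · refine Or.inl ⟨hz, ?_⟩
      simp only [PWField.fld] at h1 h2
      rw [h1, h2]
      exact mul_self_pos.2 h0

/-- Every pair of kinds of outer singular points occurs in a system with a periodic annulus. -/
theorem exists_exampleSystem (κL κR : OuterKind) : ∃ (cL βL cR βR : ℝ) (y : Fin 5 → ℝ)
    (τ : Fin 4 → ℝ), cL ≠ 0 ∧ cR ≠ 0 ∧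
    (exampleSystem cL βL cR βR).L.HasKind zoneL κL ∧
    (exampleSystem cL βL cR βR).R.HasKind zoneR κR ∧
    (exampleSystem cL βL cR βR).IsTurn 0 y τ := by
  -- the central arcs below are quarter periods, with velocities `3/2` at `x = 1` and `1/2` at
  -- `x = -1`
  obtain ⟨cR, βR, τR, x, V, hcR, hkR, -, hτR, hx, hV, x0, V0, x1, V1, hin⟩ :=
    exists_outer_arc κR (A := 3 / 2) (by norm_num)
  obtain ⟨cL, βL, τL, x', V', hcL, -, hkL, hτL, hx', hV', x0', V0', x1', V1', hin'⟩ :=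
    exists_outer_arc κL (A := 1 / 2) (by norm_num)
  have hs := Real.hasDerivAt_sin
  have hc := Real.hasDerivAt_cos
  have hpi := Real.pi_div_two_pos
  have hpos : ∀ t ∈ Ioo 0 (Real.pi / 2), 0 < Real.sin t ∧ Real.sin t ≤ 1 ∧ 0 < Real.cos t ∧
      Real.cos t ≤ 1 := fun t ht =>
    ⟨Real.sin_pos_of_pos_of_lt_pi ht.1 (by linarith [ht.2]), Real.sin_le_one t,
      Real.cos_pos_of_mem_Ioo ⟨by linarith [ht.1], ht.2⟩, Real.cos_le_one t⟩
  refine ⟨cL, βL, cR, βR, ![3 / 2, -(3 / 2), -(1 / 2), 1 / 2, 3 / 2],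
    ![τR, Real.pi / 2, τL, Real.pi / 2], hcL, hcR, hkL, hkR, ?_, ?_, ?_, ?_⟩ <;>
    simp only [Matrix.cons_val]
  · have := exampleSystem_isArc (cL := cL) (βL := βL) (cR := cR) (βR := βR) (i := .R) hτR hx
      (fun t => (hV t).congr_deriv (by
        simp [exampleSystem, HamSystem.unperturbed, PWField.fld, HamCoeffs.field]))
      (by norm_num [Zone.gap, x0]) (by norm_num [Zone.gap, x1]) (by norm_num [Zone.dgap, V0])
      (by norm_num [Zone.dgap, V1]) fun t ht => Zone.gap_pos_R.2 (hin t ht)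
    rwa [x0, V0, x1, V1] at this
  · have := exampleSystem_isArc (cL := cL) (βL := βL) (cR := cR) (βR := βR) (i := .C) hpi
      (x := fun t => 1 / 2 + (Real.cos t - 3 * Real.sin t) / 2)
      (V := fun t => -(Real.sin t + 3 * Real.cos t) / 2)
      (fun t => ((((hc t).sub ((hs t).const_mul 3)).div_const 2).const_add (1 / 2)).congr_deriv
        (by ring))
      (fun t => ((((hs t).add ((hc t).const_mul 3)).neg).div_const 2).congr_deriv (by
        simp only [exampleSystem, HamSystem.unperturbed, PWField.fld, HamCoeffs.field]
        ring))
      (by norm_num [Zone.gap]) (by norm_num [Zone.gap]) (by norm_num [Zone.dgap])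
      (by norm_num [Zone.dgap]) fun t ht => Zone.gap_pos_C.2 (by
        obtain ⟨h1, h2, h3, h4⟩ := hpos t ht
        constructor <;> linarith)
    norm_num at this
    norm_num
    exact this
  · have := exampleSystem_isArc (cL := cL) (βL := βL) (cR := cR) (βR := βR) (i := .L) hτL
      (x := fun t => -x' t) (V := fun t => -V' t) (fun t => (hx' t).neg)
      (fun t => (hV' t).neg.congr_deriv (by
        simp only [exampleSystem, HamSystem.unperturbed, PWField.fld, HamCoeffs.field]
        ring))
      (by norm_num [Zone.gap, x0']) (by norm_num [Zone.gap, x1']) (by norm_num [Zone.dgap, V0'])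
      (by norm_num [Zone.dgap, V1']) fun t ht => Zone.gap_pos_L.2 (by linarith [hin' t ht])
    rwa [x0', V0', x1', V1', neg_neg] at this
  · have := exampleSystem_isArc (cL := cL) (βL := βL) (cR := cR) (βR := βR) (i := .C) hpi
      (x := fun t => 1 / 2 + (Real.sin t - 3 * Real.cos t) / 2)
      (V := fun t => (Real.cos t + 3 * Real.sin t) / 2)
      (fun t => ((((hs t).sub ((hc t).const_mul 3)).div_const 2).const_add (1 / 2)).congr_deriv
        (by ring))
      (fun t => (((hc t).add ((hs t).const_mul 3)).div_const 2).congr_deriv (by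
        simp only [exampleSystem, HamSystem.unperturbed, PWField.fld, HamCoeffs.field]
        ring))
      (by norm_num [Zone.gap]) (by norm_num [Zone.gap]) (by norm_num [Zone.dgap])
      (by norm_num [Zone.dgap]) fun t ht => Zone.gap_pos_C.2 (by
        obtain ⟨h1, h2, h3, h4⟩ := hpos t ht
        constructor <;> linarith)
    norm_num at this
    norm_num
    exact this

/-- Three limit cycles bifurcate, with a perturbation that does not depend on `ε`, for every pair of
kinds of outer singular points. -/
theorem exists_limitCyclesBifurcate_of_kinds (κL κR : OuterKind) : ∃ (S : HamSystem) (J : Set ℝ),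
    S.H1 ∧ S.H2 ∧ S.H3 J ∧ S.L.HasKind zoneL κL ∧ S.R.HasKind zoneR κR ∧
      ∃ P : Perturbation, S.LimitCyclesBifurcate J (fun _ => P) 3 := by
  obtain ⟨cL, βL, cR, βR, y, τ, hL, hR, hkL, hkR, ht⟩ := exists_exampleSystem κL κR
  have hS := exampleSystem_normalForm (cL := cL) (βL := βL) (βR := βR) hR
  obtain ⟨J, hy, hJ⟩ := ht.exists_h3 hS rfl rfl
  obtain ⟨P, -, hP⟩ := ht.bifurcate_of_ne_zero hJ.1 hJ.2.2.2 hS (by norm_num) hy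
  exact ⟨_, J, exampleSystem_h1 hL hR, exampleSystem_h2 .., hJ, hkL, hkR, P, hP⟩

end ThreeZone

end

/-- At least three limit cycles can bifurcate from the periodic annulus.  First part: this holds
for every system and every annulus, for suitable piecewise linear perturbations of size `O(ε)`.
Second part: for every configuration of the outer singular points it is realized by some system
with a perturbation `(f, g)` that does not depend on `ε`. -/
theorem theorem1 :
    (∀ (S : ThreeZone.HamSystem) (J : Set ℝ), S.H1 → S.H2 → S.H3 J →
      ∃ P : ℝ → ThreeZone.Perturbation,
        (∀ ε, (P ε).Bounded) ∧ S.LimitCyclesBifurcate J P 3) ∧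
    (∀ κL κR : ThreeZone.OuterKind, ∃ (S : ThreeZone.HamSystem) (J : Set ℝ),
      S.H1 ∧ S.H2 ∧ S.H3 J ∧
      S.L.HasKind ThreeZone.zoneL κL ∧ S.R.HasKind ThreeZone.zoneR κR ∧
      ∃ P : ThreeZone.Perturbation, S.LimitCyclesBifurcate J (fun _ => P) 3) :=
  ⟨fun _ _ h1 h2 h3 => ThreeZone.HamSystem.exists_limitCyclesBifurcate h1 h2 h3,
    ThreeZone.exists_limitCyclesBifurcate_of_kinds⟩
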